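/- Let $n\ge 2$, $s_1,s_2\in(0,1)$, $\lambda\ge 1$, $\varrho\in(0,\infty]$, $\sigma\in\mathbb R$. **Kernels.** For $i=1,2$ let $K_i:\mathbb R^n\setminus\{0\}\to[0,\infty)$ be an even function of class $C^2$ such that, for all $\zeta\ne0$, $$\frac{\chi_{B_\varrho}(\zeta)}{\lambda|\zeta|^{n+s_i}}\le K_i(\zeta)\le\frac{\lambda}{|\zeta|^{n+s_i}},\qquad |D^jK_i(\zeta)|\le\frac{\lambda}{|\zeta|^{n+s_i+j}}\quad(j=1,2),$$ where $B_\infty=\mathbb R^n$. Suppose that for all $\zeta\neq 0$ $$\lim_{r\to0^+}r^{n+s_i}K_i(r\zeta)=\frac{a_i(\zeta/|\zeta|)}{|\zeta|^{n+s_i}},$$ where $a_i$ is a continuous even function on $\partial B_1$ bounded between two positive constants, and suppose that $a_1$ is constant. **Functional.** Let $g\in C^1(\mathbb R^n)$, let $\Omega\subset\mathbb R^n$ be a bounded open set with $C^1$ boundary, and for measurable $E\subseteq\Omega$ let $$\mathcal C(E)=\int_E\int_{E^c\cap\Omega}K_1(x-y)\,dx\,dy+\sigma\int_E\int_{\Omega^c}K_2(x-y)\,dx\,dy+\int_E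 g\,dx .$$ Let $E\subseteq\Omega$ be a volume-constrained critical set of $\mathcal C$: both double integrals are finite, and $\frac{d}{dt}\big|_{t=0}\mathcal C(f_t(E))=0$ for every family $\{f_t\}_{|t|<\delta}$ of diffeomorphisms of $\mathbb R^n$, smooth in $(t,x)$, with $f_0=\mathrm{Id}$, $f_t=\mathrm{Id}$ outside a compact set independent of $t$, $f_t(\Omega)=\Omega$ and $|f_t(E)|=|E|$ for all $|t|<\delta$. As usual, $E$ is normalized up to a null set so that $0<|E\cap B_r(x)|<|B_r(x)|$ for all $x\in\Omega\cap\partial E$ and $r>0$. **Contact angle.** Let $\mathrm{Reg}_E$ be the set of the points $x\in\overline{\Omega\cap\partial E}$ for which there are $\rho>0$ and $\alpha\in(s_1,1)$ such that $B_\rho(x)\cap\overline{\Omega\cap\partial E}$ is a hypersurface of class $C^{1,\alpha}$, possibly with boundary, the boundary (if any) being contained in $\partial\Omega$. Let $x_0\in\mathrm{Reg}_E\cap\partial\Omega$ and let $H$, $V$ be open half-spaces such that $$\frac{\Omega-x_0}{r}\to H,\qquad \frac{E-x_0}{r}\to H\cap V\qquad\text{in }L^1_{\rm loc}(\mathbb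 R^n)\text{ as }r\to0^+ .$$ Let $\vartheta\in[0,\pi]$ be the angle between $H$ and $V$, that is, in suitable orthonormal coordinates, $H=\{x_n>0\}$ and $H\cap V$ is the set of the points $x$ with $(x_1,x_n)=\varrho'(\cos\beta,\sin\beta)$ for some $\varrho'>0$ and $\beta\in(0,\vartheta)$. Then: 1. if $s_1<s_2$ and $\sigma<0$, then $\vartheta=0$; 2. if $s_1<s_2$ and $\sigma>0$, then $\vartheta=\pi$; 3. if either $s_1<s_2$ and $\sigma=0$, or $s_1>s_2$, then $\vartheta=\frac{\pi}{2}$. -/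

import Mathlib

open MeasureTheory Set Filter Topology
open scoped ENNReal NNReal symmDiff

namespace NonlocalCapillarity

/-- `ℝⁿ` with its Euclidean norm. -/
abbrev Eu (n : ℕ) : Type := EuclideanSpace ℝ (Fin n)

/-! ### Interaction kernels -/

/-- The class `𝐊(n, s, lam, ϱ)`: even kernels `K : ℝⁿ ∖ {0} → [0, ∞)` with
`χ_{B_ϱ}(ζ) / (lam |ζ|^{n+s}) ≤ K(ζ) ≤ lam / |ζ|^{n+s}` for all `ζ ≠ 0`, where `ϱ ∈ (0, ∞]` and
`B_∞ = ℝⁿ`. The value of `K` at `0` plays no role. -/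
structure IsKernel {n : ℕ} (s lam : ℝ) (ϱ : ℝ≥0∞) (K : Eu n → ℝ) : Prop where
  even : ∀ ζ, ζ ≠ 0 → K (-ζ) = K ζ
  nonneg : ∀ ζ, ζ ≠ 0 → 0 ≤ K ζ
  lower : ∀ ζ, ζ ≠ 0 → ENNReal.ofReal ‖ζ‖ < ϱ → 1 / (lam * ‖ζ‖ ^ ((n : ℝ) + s)) ≤ K ζ
  upper : ∀ ζ, ζ ≠ 0 → K ζ ≤ lam / ‖ζ‖ ^ ((n : ℝ) + s)

/-- The class `𝐊ʰ(n, s, lam, ϱ)`: kernels of class `Cʰ` away from the origin with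
`|DʲK(ζ)| ≤ lam / |ζ|^{n+s+j}` for `1 ≤ j ≤ h`. -/
structure IsKernelC {n : ℕ} (h : ℕ) (s lam : ℝ) (ϱ : ℝ≥0∞) (K : Eu n → ℝ) : Prop
    extends IsKernel s lam ϱ K where
  contDiffOn : ContDiffOn ℝ h K {0}ᶜ
  deriv_le : ∀ j : ℕ, 1 ≤ j → j ≤ h → ∀ ζ, ζ ≠ 0 →
    ‖iteratedFDeriv ℝ j K ζ‖ ≤ lam / ‖ζ‖ ^ ((n : ℝ) + s + j)

/-- `K` admits the blow-up limit `K*(ζ) = lim_{r → 0⁺} r^{n+s} K(rζ) = a(ζ/|ζ|) / |ζ|^{n+s}`, with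
`a` continuous and even on the unit sphere and bounded between two positive constants. -/
structure HasBlowUp {n : ℕ} (s : ℝ) (a : Eu n → ℝ) (K : Eu n → ℝ) : Prop where
  continuousOn : ContinuousOn a (Metric.sphere 0 1)
  bounds : ∃ c C : ℝ, 0 < c ∧ ∀ w ∈ Metric.sphere (0 : Eu n) 1, c ≤ a w ∧ a w ≤ C
  even : ∀ w ∈ Metric.sphere (0 : Eu n) 1, a w = a (-w)
  tendsto : ∀ ζ : Eu n, ζ ≠ 0 →
    Tendsto (fun r : ℝ => r ^ ((n : ℝ) + s) * K (r • ζ)) (𝓝[>] 0)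
      (𝓝 (a (‖ζ‖⁻¹ • ζ) / ‖ζ‖ ^ ((n : ℝ) + s)))

/-! ### The capillarity functional and its critical points -/

/-- The interaction `I_K(E, F) = ∫_E ∫_F K(x - y) dx dy ∈ [0, ∞]`. -/
noncomputable def interaction {n : ℕ} (K : Eu n → ℝ) (E F : Set (Eu n)) : ℝ≥0∞ :=
  ∫⁻ x in E, ∫⁻ y in F, ENNReal.ofReal (K (x - y))

/-- The functional `𝒞(E) = I₁(E, Eᶜ ∩ Ω) + σ I₂(E, Ωᶜ) + ∫_E g` (meaningful when both
interactions are finite). -/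
noncomputable def capillarity {n : ℕ} (K₁ K₂ : Eu n → ℝ) (σ : ℝ) (g : Eu n → ℝ)
    (Ω E : Set (Eu n)) : ℝ :=
  (interaction K₁ E (Eᶜ ∩ Ω)).toReal + σ * (interaction K₂ E Ωᶜ).toReal + ∫ x in E, g x

/-- `{f_t}_{|t| < δ}` is a smooth one-parameter family of diffeomorphisms of `ℝⁿ`, with `f_0 = Id`
and `f_t - Id` supported in a compact set, which preserves `Ω` and the volume of `E`. -/
structure IsAdmissibleFamily {n : ℕ} (Ω E : Set (Eu n)) (δ : ℝ) (f : ℝ → Eu n → Eu n) : Prop where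
  pos : 0 < δ
  smooth : ContDiffOn ℝ (⊤ : ℕ∞) (fun p : ℝ × Eu n => f p.1 p.2) (Ioo (-δ) δ ×ˢ univ)
  diffeo : ∀ t ∈ Ioo (-δ) δ, ∃ g : Eu n → Eu n, ContDiff ℝ (⊤ : ℕ∞) g ∧
    Function.LeftInverse g (f t) ∧ Function.RightInverse g (f t)
  zero : ∀ x, f 0 x = x
  compact : ∃ C : Set (Eu n), IsCompact C ∧ ∀ t ∈ Ioo (-δ) δ, ∀ x, x ∉ C → f t x = x
  domain : ∀ t ∈ Ioo (-δ) δ, f t '' Ω = Ω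
  volume_eq : ∀ t ∈ Ioo (-δ) δ, volume (f t '' E) = volume E

/-- `E ⊆ Ω` is a critical point, with finite energy, of `𝒞` among the sets with prescribed
Lebesgue measure. -/
structure IsCritical {n : ℕ} (K₁ K₂ : Eu n → ℝ) (σ : ℝ) (g : Eu n → ℝ)
    (Ω E : Set (Eu n)) : Prop where
  measurableSet : MeasurableSet E
  subset : E ⊆ Ω
  finite₁ : interaction K₁ E (Eᶜ ∩ Ω) < ∞
  finite₂ : interaction K₂ E Ωᶜ < ∞
  deriv_eq_zero : ∀ (δ : ℝ) (f : ℝ → Eu n → Eu n), IsAdmissibleFamily Ω E δ f →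
    HasDerivAt (fun t => capillarity K₁ K₂ σ g Ω (f t '' E)) 0 0

/-! ### Regularity of boundaries -/

/-- The open set `Ω` has `C¹` boundary: near each boundary point it is a strict sublevel set of a
`C¹` function with nonvanishing differential. -/
def HasC1Boundary {n : ℕ} (Ω : Set (Eu n)) : Prop :=
  ∀ p ∈ frontier Ω, ∃ (U : Set (Eu n)) (φ : Eu n → ℝ), IsOpen U ∧ p ∈ U ∧ ContDiffOn ℝ 1 φ U ∧
    fderiv ℝ φ p ≠ 0 ∧ Ω ∩ U = {x ∈ U | φ x < 0}

/-- `φ` is of class `C^{1,α}` on the open set `U`. -/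
def IsC1Holder {n : ℕ} (α : ℝ≥0) (φ : Eu n → ℝ) (U : Set (Eu n)) : Prop :=
  ContDiffOn ℝ 1 φ U ∧ ∃ C : ℝ≥0, HolderOnWith C α (fderiv ℝ φ) U

/-- Near `p`, the set `S` is a `C^{1,α}` hypersurface without boundary. -/
def IsInteriorManifoldPoint {n : ℕ} (α : ℝ≥0) (S : Set (Eu n)) (p : Eu n) : Prop :=
  ∃ (U : Set (Eu n)) (φ : Eu n → ℝ), IsOpen U ∧ p ∈ U ∧ IsC1Holder α φ U ∧
    fderiv ℝ φ p ≠ 0 ∧ S ∩ U = {x ∈ U | φ x = 0}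

/-- Near `p`, the set `S` is a `C^{1,α}` hypersurface with boundary, and `p` is one of its boundary
points: the hypersurface is `{φ = 0, η ≥ 0}` and its boundary is `{φ = 0, η = 0}`. -/
def IsBoundaryManifoldPoint {n : ℕ} (α : ℝ≥0) (S : Set (Eu n)) (p : Eu n) : Prop :=
  ∃ (U : Set (Eu n)) (φ η : Eu n → ℝ), IsOpen U ∧ p ∈ U ∧ IsC1Holder α φ U ∧ IsC1Holder α η U ∧
    φ p = 0 ∧ η p = 0 ∧ LinearIndependent ℝ ![fderiv ℝ φ p, fderiv ℝ η p] ∧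
    S ∩ U = {x ∈ U | φ x = 0 ∧ 0 ≤ η x}

/-- The closure of the part of the boundary of `E` inside the container `Ω`. -/
def liquidInterface {n : ℕ} (Ω E : Set (Eu n)) : Set (Eu n) := closure (Ω ∩ frontier E)

/-- `Reg_E`: the points `x₀` of the closure of `Ω ∩ ∂E` near which this set is a hypersurface of
class `C^{1,α}`, for some `α ∈ (s₁, 1)`, possibly with boundary, the boundary being contained in
`∂Ω`. -/
def regularSet {n : ℕ} (s₁ : ℝ) (Ω E : Set (Eu n)) : Set (Eu n) :=
  {x₀ | x₀ ∈ liquidInterface Ω E ∧ ∃ (ρ : ℝ) (α : ℝ≥0), 0 < ρ ∧ s₁ < α ∧ α < 1 ∧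
    ∀ p ∈ Metric.ball x₀ ρ ∩ liquidInterface Ω E,
      IsInteriorManifoldPoint α (Metric.ball x₀ ρ ∩ liquidInterface Ω E) p ∨
      (p ∈ frontier Ω ∧ IsBoundaryManifoldPoint α (Metric.ball x₀ ρ ∩ liquidInterface Ω E) p)}

/-- `E` is normalized inside `Ω`: each point of `Ω ∩ ∂E` belongs to the measure-theoretic boundary
of `E`, that is, `0 < |E ∩ B_r(x)| < |B_r(x)|` for all `r > 0`. Every measurable set satisfies this
after a modification on a null set. -/
def IsNormalized {n : ℕ} (Ω E : Set (Eu n)) : Prop :=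
  ∀ x ∈ Ω ∩ frontier E, ∀ r : ℝ, 0 < r →
    0 < volume (E ∩ Metric.ball x r) ∧ volume (E ∩ Metric.ball x r) < volume (Metric.ball x r)

/-! ### Blow-ups and the contact angle -/

/-- The rescaled set `F^{x₀,r} = (F - x₀) / r`. -/
def rescale {n : ℕ} (F : Set (Eu n)) (x₀ : Eu n) (r : ℝ) : Set (Eu n) :=
  (fun x => r⁻¹ • (x - x₀)) '' F

/-- `F^{x₀,r} → G` in `L¹_loc(ℝⁿ)` as `r → 0⁺`. -/
def BlowUpTendsto {n : ℕ} (F : Set (Eu n)) (x₀ : Eu n) (G : Set (Eu n)) : Prop :=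
  ∀ C : Set (Eu n), IsCompact C →
    Tendsto (fun r : ℝ => volume ((rescale F x₀ r ∆ G) ∩ C)) (𝓝[>] 0) (𝓝 0)

/-- Open half-spaces of `ℝⁿ`. -/
def IsOpenHalfSpace {n : ℕ} (H : Set (Eu n)) : Prop :=
  ∃ (ν : Eu n) (b : ℝ), ν ≠ 0 ∧ H = {x | inner ℝ ν x < b}

/-- The open sector `J_{ϑ₁,ϑ₂}` of the points whose projection to the plane of the first and the
last coordinates has polar angle in `(ϑ₁, ϑ₂)`. It is empty if `ϑ₁ = ϑ₂`, and `J_{0,π}` is the half-space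
`{x_n > 0}`. -/
def sector {n : ℕ} (hn : 2 ≤ n) (ϑ₁ ϑ₂ : ℝ) : Set (Eu n) :=
  {x | ∃ β ∈ Ioo ϑ₁ ϑ₂, ∃ ρ : ℝ, 0 < ρ ∧
    x ⟨0, by omega⟩ = ρ * Real.cos β ∧ x ⟨n - 1, by omega⟩ = ρ * Real.sin β}

/-- `ϑ ∈ [0, π]` is the angle between the half-spaces `H` and `V`: in suitable orthonormal
coordinates, `H = {x_n > 0} = J_{0,π}` and `H ∩ V = J_{0,ϑ}`. -/
def IsAngleBetween {n : ℕ} (hn : 2 ≤ n) (H V : Set (Eu n)) (ϑ : ℝ) : Prop :=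
  ϑ ∈ Icc 0 Real.pi ∧ ∃ Q : Eu n ≃ₗᵢ[ℝ] Eu n,
    H = Q '' sector hn 0 Real.pi ∧ H ∩ V = Q '' sector hn 0 ϑ

end NonlocalCapillarity

open NonlocalCapillarity

namespace NonlocalCapillarity

variable {n : ℕ}

/-! ### Powers of the norm -/

/-! Criticality is tested with the deformations `x ↦ x + t ξ(x) ν`, where `ν` is a fixed unit vector
and `ξ` is smooth with compact support in `Ω`. Their Jacobian is exactly `1 + t ∂_ν ξ`, so the
volume of the image of `E` is affine in `t` and is conserved as soon as `∫_E ∂_ν ξ = 0`. Correcting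
a general `ξ` by a multiple of one test function with nonzero flux gives an Euler–Lagrange equation
with a multiplier (`IsCritical.exists_multiplier`).

Transplant a bump to points `c_k → x₀` at scales `r_k → 0`. The equation becomes `V₁ + σ r_k^(s₁-s₂)
V₂ → 0`, where `V₁`, `V₂` are the rescaled first variations of the two interactions; the multiplier
and `g` carry a factor `r_k^s₁` (`IsBlowUp.tendsto_rescaled`). The bump sits on the limit interface
and away from the limit of `∂Ω`. Hence `V₂` sees only pairs of points at positive distance, while
near the diagonal `V₁` is controlled by a uniform perimeter bound and `s₁ < 1`.

Suppose that near the bump the limit of `E` is `{ν·x < 0}`. For `y` away from the bump, the first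
variation density in `x` is `∂_ν(K(x - y) ψ(x))`, whose integral over the half-space is a positive
flux (`exists_flux_interaction_ge`). Two exclusions follow. Dominant adhesion (`s₁ < s₂`, `σ ≠ 0`):
`V₁` is bounded, so `V₂ → 0`, against the positive flux created by the complement of the container
(`IsBlowUp.false_of_adhesion_dominant`). Negligible adhesion (`σ = 0` or `s₂ < s₁`): `V₁ → 0`. As
`a₁` is constant, the limit kernel is invariant under reflection across the interface plane, and the
symmetric part of the interaction cancels. What remains is the flux created by the points whose
mirror image leaves the container, which is positive unless the interface is orthogonal to the wall
(`IsBlowUp.false_of_asymmetric`).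

For an angle in `(0, π)` these apply to the blow-up at `x₀`. For the angles `0` and `π`, one of `E`
and `Ω \ E` has zero density at `x₀`, which forces the interface to be tangent to `∂Ω`
(`IsContactPoint.not_tendsto_of_transversal`). One then blows up at interface points `p_k → x₀`, at
the scale of their distance from `∂Ω`: the limit of `E` is a strip or a half-space parallel to the
wall, and the same exclusions apply. So `π / 2` alone survives when adhesion is negligible. When it
dominates no angle survives, whatever the sign of `σ`, and the first two items hold because there is
no such contact point. -/

lemma integrableOn_norm_rpow_far {s ε : ℝ} (hs : 0 < s) (hε : 0 < ε) :
    IntegrableOn (fun z : Eu n => ‖z‖ ^ (-(n + s))) {z | ε ≤ ‖z‖} := by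
  have h1 : Integrable (fun z : Eu n => (1 + ‖z‖) ^ (-(n + s))) :=
    integrable_one_add_norm (by simpa using hs)
  -- The constant comes from `‖z‖ ≥ ε / (1 + ε) * (1 + ‖z‖)`, valid when `‖z‖ ≥ ε`.
  refine Integrable.mono' ((h1.const_mul ((ε / (1 + ε)) ^ (-(n + s)))).integrableOn) ?_ ?_
  · exact (measurable_norm.pow_const _).aestronglyMeasurable
  · refine (ae_restrict_iff' (measurableSet_le measurable_const measurable_norm)).2 (.of_forall ?_)
    intro z hz
    simp only [mem_ofPred_eq] at hz
    rw [Real.norm_of_nonneg (by positivity), ← Real.mul_rpow (by positivity) (by positivity)]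
    refine Real.rpow_le_rpow_of_nonpos (by positivity) ?_ (by
      have : (0 : ℝ) ≤ n := by positivity
      linarith)
    rw [div_mul_eq_mul_div, div_le_iff₀ (by positivity)]
    nlinarith

/-- The gain `+ 1` in the exponent is the volume `O(‖v‖)` of the points that a translation by `v`
carries across the interface; with it the singularity is integrable precisely because `s < 1`. -/
lemma integrableOn_norm_rpow_near (hn : 0 < n) {s R : ℝ} (hs : s < 1) :
    IntegrableOn (fun z : Eu n => ‖z‖ ^ (-(n + s) + 1)) (Metric.ball 0 R) := by
  refine integrableOn_ball_of_norm_le_rpow (C := 1) (α := n + s - 1) (by rw [finrank_euclideanSpace_fin]; exact hn)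
    (by simp; linarith) (.of_forall fun z => ?_) (measurable_norm.pow_const _).aestronglyMeasurable
  rw [Real.norm_of_nonneg (by positivity), one_mul]
  apply le_of_eq; congr 1; ring

/-! ### Kernels -/

/-- Size and first-order bounds of a kernel, away from the origin. -/
structure KernelBound (s lam : ℝ) (K : Eu n → ℝ) : Prop where
  contDiffOn : ContDiffOn ℝ 1 K {0}ᶜ
  abs_le : ∀ z, z ≠ 0 → |K z| ≤ lam * ‖z‖ ^ (-(n + s))
  norm_fderiv_le : ∀ z, z ≠ 0 → ‖fderiv ℝ K z‖ ≤ lam * ‖z‖ ^ (-(n + s) - 1)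

lemma IsKernelC.kernelBound {s lam : ℝ} {ϱ : ℝ≥0∞} {K : Eu n → ℝ}
    (hK : IsKernelC 2 s lam ϱ K) : KernelBound s lam K where
  contDiffOn := hK.contDiffOn.of_le (by norm_num)
  abs_le z hz := by
    rw [abs_of_nonneg (hK.nonneg z hz), Real.rpow_neg (norm_nonneg _), ← div_eq_mul_inv]
    exact hK.upper z hz
  norm_fderiv_le z hz := by
    have := hK.deriv_le 1 le_rfl (by norm_num) z hz
    rw [norm_iteratedFDeriv_one] at this
    rw [show -((n : ℝ) + s) - 1 = -(n + s + 1) by ring, Real.rpow_neg (norm_nonneg _),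
      ← div_eq_mul_inv]
    simpa using this

namespace KernelBound

variable {s lam : ℝ} {K : Eu n → ℝ}

lemma differentiableAt (hK : KernelBound s lam K) {z : Eu n} (hz : z ≠ 0) :
    DifferentiableAt ℝ K z :=
  ((hK.contDiffOn.differentiableOn one_ne_zero) z hz).differentiableAt
    (isOpen_compl_singleton.mem_nhds hz)

lemma measurable (hK : KernelBound s lam K) : Measurable K :=
  measurable_of_continuousOn_compl_singleton 0 hK.contDiffOn.continuousOn

lemma lam_nonneg (hn : 0 < n) (hK : KernelBound s lam K) : 0 ≤ lam := by
  have : Nonempty (Fin n) := ⟨⟨0, hn⟩⟩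
  obtain ⟨z, hz⟩ := exists_ne (0 : Eu n)
  have h1 := (abs_nonneg _).trans (hK.abs_le z hz)
  have h2 : 0 < ‖z‖ ^ (-((n : ℝ) + s)) := Real.rpow_pos_of_pos (norm_pos_iff.2 hz) _
  exact nonneg_of_mul_nonneg_left h1 h2

end KernelBound

/-! ### Test functions and the induced deformations -/

lemma exists_norm_fderiv_le {ξ : Eu n → ℝ} (h : ContDiff ℝ (⊤ : ℕ∞) ξ) (hc : HasCompactSupport ξ) :
    ∃ L : ℝ, 0 ≤ L ∧ ∀ x, ‖fderiv ℝ ξ x‖ ≤ L := by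
  obtain ⟨C, hC⟩ := (hc.fderiv (𝕜 := ℝ)).exists_bound_of_continuous
    (h.continuous_fderiv (by simp))
  exact ⟨C, (norm_nonneg _).trans (hC 0), hC⟩

lemma abs_sub_le_of_norm_fderiv_le {ξ : Eu n → ℝ} (h : Differentiable ℝ ξ) {L : ℝ}
    (hL : ∀ x, ‖fderiv ℝ ξ x‖ ≤ L) (x y : Eu n) : |ξ x - ξ y| ≤ L * ‖x - y‖ := by
  have := convex_univ.norm_image_sub_le_of_norm_fderiv_le (f := ξ) (𝕜 := ℝ) (C := L)
    (fun z _ => h z) (fun z _ => hL z) (mem_univ y) (mem_univ x)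
  simpa using this

lemma abs_fderiv_apply_le {ξ : Eu n → ℝ} {L : ℝ} (hL : ∀ x, ‖fderiv ℝ ξ x‖ ≤ L) {ν : Eu n}
    (hν : ‖ν‖ = 1) (x : Eu n) : |fderiv ℝ ξ x ν| ≤ L := by
  have := (fderiv ℝ ξ x).le_opNorm ν
  rw [hν, mul_one] at this
  exact this.trans (hL x)

/-- The deformation `x ↦ x + t ξ(x) ν`. -/
noncomputable def push (ν : Eu n) (ξ : Eu n → ℝ) (t : ℝ) (x : Eu n) : Eu n := x + (t * ξ x) • ν

section push

variable {ν : Eu n} {ξ : Eu n → ℝ} {t L : ℝ}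

lemma hasFDerivAt_push (h : Differentiable ℝ ξ) (x : Eu n) :
    HasFDerivAt (push ν ξ t)
      (ContinuousLinearMap.id ℝ (Eu n) + (t • fderiv ℝ ξ x).smulRight ν) x :=
  (hasFDerivAt_id x).add ((((h x).hasFDerivAt).const_mul t).smul_const ν)

/-- The differential is a rank-one perturbation of the identity, so the determinant is exactly
affine in `t`. This is what allows volume to be conserved exactly and not just to first order. -/
lemma det_push (x : Eu n) :
    (ContinuousLinearMap.id ℝ (Eu n) + (t • fderiv ℝ ξ x).smulRight ν).det
      = 1 + t * fderiv ℝ ξ x ν := by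
  have := LinearMap.transvection.det (R := ℝ) (V := Eu n)
    ((t • fderiv ℝ ξ x : Eu n →L[ℝ] ℝ) : Eu n →ₗ[ℝ] ℝ) ν
  rw [ContinuousLinearMap.det]
  convert this using 2
  · ext1 v
    simp [LinearMap.transvection.apply]
  · simp

lemma push_sub_push (x y : Eu n) :
    push ν ξ t x - push ν ξ t y = (x - y) + (t * (ξ x - ξ y)) • ν := by
  simp only [push, mul_sub, sub_smul]; abel

/-- The threshold `|t| * L ≤ 1 / 4` makes the displacement `1/4`-Lipschitz: distances are not
reduced below one half, the map is injective, and the Jacobian stays between `3/4` and `5/4`. -/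
lemma norm_smul_sub_le (hν : ‖ν‖ = 1) (h : Differentiable ℝ ξ) (hL : ∀ x, ‖fderiv ℝ ξ x‖ ≤ L)
    (htL : |t| * L ≤ 1 / 4) (x y : Eu n) : ‖(t * (ξ x - ξ y)) • ν‖ ≤ ‖x - y‖ / 4 := by
  rw [norm_smul, hν, mul_one, Real.norm_eq_abs, abs_mul]
  have h1 := abs_sub_le_of_norm_fderiv_le h hL x y
  calc |t| * |ξ x - ξ y| ≤ |t| * (L * ‖x - y‖) := by gcongr
    _ = (|t| * L) * ‖x - y‖ := by ring
    _ ≤ 1 / 4 * ‖x - y‖ := by gcongr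
    _ = _ := by ring

lemma norm_push_sub_push_ge (hν : ‖ν‖ = 1) (h : Differentiable ℝ ξ)
    (hL : ∀ x, ‖fderiv ℝ ξ x‖ ≤ L) (htL : |t| * L ≤ 1 / 4) (x y : Eu n) :
    ‖x - y‖ / 2 ≤ ‖push ν ξ t x - push ν ξ t y‖ := by
  rw [push_sub_push]
  have h1 := norm_smul_sub_le hν h hL htL x y
  have h2 := norm_sub_le_norm_add (x - y) ((t * (ξ x - ξ y)) • ν)
  linarith [norm_nonneg (x - y)]

lemma push_injective (hν : ‖ν‖ = 1) (h : Differentiable ℝ ξ)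
    (hL : ∀ x, ‖fderiv ℝ ξ x‖ ≤ L) (htL : |t| * L ≤ 1 / 4) : Function.Injective (push ν ξ t) := by
  intro x y hxy
  have h1 := norm_push_sub_push_ge hν h hL htL x y
  rw [hxy, sub_self, norm_zero] at h1
  exact sub_eq_zero.1 (norm_le_zero_iff.1 (by linarith))

lemma abs_mul_fderiv_le (hν : ‖ν‖ = 1) (hL : ∀ x, ‖fderiv ℝ ξ x‖ ≤ L) (htL : |t| * L ≤ 1 / 4)
    (x : Eu n) : |t * fderiv ℝ ξ x ν| ≤ 1 / 4 := by
  rw [abs_mul]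
  exact (mul_le_mul_of_nonneg_left (abs_fderiv_apply_le hL hν x) (abs_nonneg t)).trans htL

lemma lintegral_push_image (hν : ‖ν‖ = 1) (h : Differentiable ℝ ξ)
    (hL : ∀ x, ‖fderiv ℝ ξ x‖ ≤ L) (htL : |t| * L ≤ 1 / 4) {A : Set (Eu n)} (hA : MeasurableSet A)
    (g : Eu n → ℝ≥0∞) :
    ∫⁻ x in push ν ξ t '' A, g x =
      ∫⁻ x in A, ENNReal.ofReal (1 + t * fderiv ℝ ξ x ν) * g (push ν ξ t x) := by
  rw [lintegral_image_eq_lintegral_abs_det_fderiv_mul volume hA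
    (fun x _ => (hasFDerivAt_push h x).hasFDerivWithinAt)
    (push_injective hν h hL htL).injOn]
  simp only [det_push]
  refine lintegral_congr fun x => ?_
  have := abs_le.1 (abs_mul_fderiv_le hν hL htL x)
  rw [abs_of_nonneg (by linarith)]

lemma interaction_push (hν : ‖ν‖ = 1) (h : ContDiff ℝ 1 ξ)
    (hL : ∀ x, ‖fderiv ℝ ξ x‖ ≤ L) (htL : |t| * L ≤ 1 / 4) {A B : Set (Eu n)}
    (hA : MeasurableSet A) (hB : MeasurableSet B) {K : Eu n → ℝ} (hK : Measurable K) :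
    interaction K (push ν ξ t '' A) (push ν ξ t '' B) =
      ∫⁻ p in A ×ˢ B, ENNReal.ofReal (K (push ν ξ t p.1 - push ν ξ t p.2) *
        ((1 + t * fderiv ℝ ξ p.1 ν) * (1 + t * fderiv ℝ ξ p.2 ν))) := by
  have hd : Differentiable ℝ ξ := h.differentiable one_ne_zero
  have hfm : Measurable (fun x => fderiv ℝ ξ x ν) := measurable_fderiv_apply_const ℝ ξ ν
  have hpm : Measurable (push ν ξ t) := by
    have := h.continuous
    unfold push; fun_prop
  rw [interaction, lintegral_push_image hν hd hL htL hA, Measure.volume_eq_prod,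
    ← Measure.prod_restrict, lintegral_prod _ (by fun_prop)]
  refine lintegral_congr fun x => ?_
  rw [lintegral_push_image hν hd hL htL hB, ← lintegral_const_mul _ (by fun_prop)]
  refine lintegral_congr fun y => ?_
  have hx := abs_le.1 (abs_mul_fderiv_le hν hL htL x)
  have hy := abs_le.1 (abs_mul_fderiv_le hν hL htL y)
  rw [← ENNReal.ofReal_mul (by linarith), ← ENNReal.ofReal_mul (by linarith)]
  congr 1; ring

end push

/-- The density of the first variation of the interaction along `ξ ν`. -/
noncomputable def firstVar (K : Eu n → ℝ) (ν : Eu n) (ξ : Eu n → ℝ) (x y : Eu n) : ℝ :=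
  fderiv ℝ K (x - y) ν * (ξ x - ξ y) + K (x - y) * (fderiv ℝ ξ x ν + fderiv ℝ ξ y ν)

lemma measurable_firstVar {K : Eu n → ℝ} (hK : Measurable K) {ν : Eu n} {ξ : Eu n → ℝ}
    (h : ContDiff ℝ 1 ξ) : Measurable (fun p : Eu n × Eu n => firstVar K ν ξ p.1 p.2) := by
  have hfm : Measurable (fun x => fderiv ℝ ξ x ν) := measurable_fderiv_apply_const ℝ ξ ν
  have hkm : Measurable (fun x => fderiv ℝ K x ν) := measurable_fderiv_apply_const ℝ K ν
  have := h.continuous.measurable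
  unfold firstVar
  fun_prop

/-- The increment `ξ x - ξ y` compensates for the power lost in differentiating `K`, so the density
is no more singular than `K` itself. -/
lemma abs_firstVar_le {s lam L : ℝ} {K : Eu n → ℝ} (hK : KernelBound s lam K) {ν : Eu n}
    (hν : ‖ν‖ = 1) {ξ : Eu n → ℝ} (h : Differentiable ℝ ξ) (hL : ∀ x, ‖fderiv ℝ ξ x‖ ≤ L)
    {x y : Eu n} (hxy : x ≠ y) :
    |firstVar K ν ξ x y| ≤ 3 * lam * L * ‖x - y‖ ^ (-(n + s)) := by
  have hz : x - y ≠ 0 := sub_ne_zero.2 hxy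
  have hzp : 0 < ‖x - y‖ := norm_pos_iff.2 hz
  have h1 : |fderiv ℝ K (x - y) ν| ≤ lam * ‖x - y‖ ^ (-(n + s) - 1) := by
    have := (fderiv ℝ K (x - y)).le_opNorm ν
    rw [hν, mul_one] at this
    exact this.trans (hK.norm_fderiv_le _ hz)
  have h2 := abs_sub_le_of_norm_fderiv_le h hL x y
  have h3 := hK.abs_le _ hz
  have h4 : |fderiv ℝ ξ x ν + fderiv ℝ ξ y ν| ≤ L + L :=
    (abs_add_le _ _).trans (add_le_add (abs_fderiv_apply_le hL hν x) (abs_fderiv_apply_le hL hν y))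
  have h5 : ‖x - y‖ ^ (-((n : ℝ) + s) - 1) * ‖x - y‖ = ‖x - y‖ ^ (-((n : ℝ) + s)) := by
    rw [Real.rpow_sub_one hzp.ne']; field_simp
  calc |firstVar K ν ξ x y| ≤ |fderiv ℝ K (x - y) ν| * |ξ x - ξ y|
        + |K (x - y)| * |fderiv ℝ ξ x ν + fderiv ℝ ξ y ν| := by
        rw [firstVar, ← abs_mul, ← abs_mul]; exact abs_add_le _ _
    _ ≤ (lam * ‖x - y‖ ^ (-(n + s) - 1)) * (L * ‖x - y‖)
        + (lam * ‖x - y‖ ^ (-(n + s))) * (L + L) :=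
        add_le_add (mul_le_mul h1 h2 (abs_nonneg _) ((abs_nonneg _).trans h1))
          (mul_le_mul h3 h4 (abs_nonneg _) ((abs_nonneg _).trans h3))
    _ = lam * L * (‖x - y‖ ^ (-((n : ℝ) + s) - 1) * ‖x - y‖)
        + 2 * lam * L * ‖x - y‖ ^ (-((n : ℝ) + s)) := by ring
    _ = _ := by rw [h5]; ring

/-! ### First variation of the interaction -/

section

variable {s lam L : ℝ} {K : Eu n → ℝ} {ν : Eu n} {ξ : Eu n → ℝ}

lemma hasDerivAt_kernel_push (hK : KernelBound s lam K) (hν : ‖ν‖ = 1) (h : Differentiable ℝ ξ)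
    (hL : ∀ x, ‖fderiv ℝ ξ x‖ ≤ L) {t : ℝ} (htL : |t| * L ≤ 1 / 4) {x y : Eu n} (hxy : x ≠ y) :
    HasDerivAt (fun t => K (push ν ξ t x - push ν ξ t y) *
        ((1 + t * fderiv ℝ ξ x ν) * (1 + t * fderiv ℝ ξ y ν)))
      (fderiv ℝ K (push ν ξ t x - push ν ξ t y) ((ξ x - ξ y) • ν) *
        ((1 + t * fderiv ℝ ξ x ν) * (1 + t * fderiv ℝ ξ y ν)) +
        K (push ν ξ t x - push ν ξ t y) *
          (fderiv ℝ ξ x ν * (1 + t * fderiv ℝ ξ y ν) +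
            (1 + t * fderiv ℝ ξ x ν) * fderiv ℝ ξ y ν)) t := by
  have hne : push ν ξ t x - push ν ξ t y ≠ 0 :=
    sub_ne_zero.2 ((push_injective hν h hL htL).ne hxy)
  have h1 : HasDerivAt (fun t => push ν ξ t x - push ν ξ t y) ((ξ x - ξ y) • ν) t := by
    simp only [push_sub_push]
    have := (((hasDerivAt_id t).mul_const (ξ x - ξ y)).smul_const ν).const_add (x - y)
    simpa using this
  have h2 := ((hK.differentiableAt hne).hasFDerivAt).comp_hasDerivAt t h1
  have h3 (a : ℝ) : HasDerivAt (fun t : ℝ => 1 + t * a) a t := by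
    simpa using ((hasDerivAt_id t).mul_const a).const_add 1
  exact h2.mul ((h3 _).mul (h3 _))

/-- Since distances shrink at most by a factor two, the derivative at time `t` is bounded in terms
of the distance at time zero. This is the dominating function, uniform in `t`; the constant is `12 =
8 + 4`, one summand for each term of the product rule. -/
lemma abs_deriv_kernel_push_le (hn : 0 < n) (hs : 0 < s) (hK : KernelBound s lam K) (hν : ‖ν‖ = 1)
    (h : Differentiable ℝ ξ) (hL : ∀ x, ‖fderiv ℝ ξ x‖ ≤ L) {t : ℝ} (htL : |t| * L ≤ 1 / 4)
    {x y : Eu n} (hxy : x ≠ y) :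
    |fderiv ℝ K (push ν ξ t x - push ν ξ t y) ((ξ x - ξ y) • ν) *
        ((1 + t * fderiv ℝ ξ x ν) * (1 + t * fderiv ℝ ξ y ν)) +
        K (push ν ξ t x - push ν ξ t y) *
          (fderiv ℝ ξ x ν * (1 + t * fderiv ℝ ξ y ν) +
            (1 + t * fderiv ℝ ξ x ν) * fderiv ℝ ξ y ν)| ≤
      12 * lam * L * (1 / 2) ^ (-(n + s)) * ‖x - y‖ ^ (-(n + s)) := by
  have hlam := hK.lam_nonneg hn
  have hL0 : 0 ≤ L := (norm_nonneg _).trans (hL 0)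
  have hne : push ν ξ t x - push ν ξ t y ≠ 0 :=
    sub_ne_zero.2 ((push_injective hν h hL htL).ne hxy)
  have hz : 0 < ‖x - y‖ := norm_pos_iff.2 (sub_ne_zero.2 hxy)
  have hge := norm_push_sub_push_ge hν h hL htL x y
  set w := push ν ξ t x - push ν ξ t y
  have hn0 : (0 : ℝ) < n := by exact_mod_cast hn
  have hp1 : ‖w‖ ^ (-((n : ℝ) + s)) ≤ (‖x - y‖ / 2) ^ (-((n : ℝ) + s)) :=
    Real.rpow_le_rpow_of_nonpos (by positivity) hge (by linarith)
  have hp2 : ‖w‖ ^ (-((n : ℝ) + s) - 1) ≤ (‖x - y‖ / 2) ^ (-((n : ℝ) + s) - 1) :=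
    Real.rpow_le_rpow_of_nonpos (by positivity) hge (by linarith)
  have ha := abs_fderiv_apply_le hL hν x
  have hb := abs_fderiv_apply_le hL hν y
  have ha1 : |1 + t * fderiv ℝ ξ x ν| ≤ 2 := by
    have := abs_le.1 (abs_mul_fderiv_le hν hL htL x)
    exact abs_le.2 ⟨by linarith, by linarith⟩
  have hb1 : |1 + t * fderiv ℝ ξ y ν| ≤ 2 := by
    have := abs_le.1 (abs_mul_fderiv_le hν hL htL y)
    exact abs_le.2 ⟨by linarith, by linarith⟩
  have h1 : |fderiv ℝ K w ((ξ x - ξ y) • ν)| ≤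
      lam * (‖x - y‖ / 2) ^ (-((n : ℝ) + s) - 1) * (L * ‖x - y‖) := by
    have h0 := (fderiv ℝ K w).le_opNorm ((ξ x - ξ y) • ν)
    rw [norm_smul, hν, mul_one] at h0
    refine h0.trans (mul_le_mul ((hK.norm_fderiv_le _ hne).trans ?_)
      (abs_sub_le_of_norm_fderiv_le h hL x y) (norm_nonneg _) (by positivity))
    gcongr
  have h2 : |K w| ≤ lam * (‖x - y‖ / 2) ^ (-((n : ℝ) + s)) := by
    refine (hK.abs_le _ hne).trans ?_
    gcongr
  have h5 : (‖x - y‖ / 2) ^ (-((n : ℝ) + s) - 1) * ‖x - y‖ =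
      2 * (‖x - y‖ / 2) ^ (-((n : ℝ) + s)) := by
    rw [Real.rpow_sub_one (by positivity)]; field_simp
  have h6 : (‖x - y‖ / 2) ^ (-((n : ℝ) + s)) =
      (1 / 2) ^ (-((n : ℝ) + s)) * ‖x - y‖ ^ (-((n : ℝ) + s)) := by
    rw [← Real.mul_rpow (by norm_num) (by positivity)]; congr 1; ring
  have h3 : |(1 + t * fderiv ℝ ξ x ν) * (1 + t * fderiv ℝ ξ y ν)| ≤ 2 * 2 := by
    rw [abs_mul]; gcongr
  have h4 : |fderiv ℝ ξ x ν * (1 + t * fderiv ℝ ξ y ν) +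
            (1 + t * fderiv ℝ ξ x ν) * fderiv ℝ ξ y ν| ≤ L * 2 + 2 * L := by
    refine (abs_add_le _ _).trans ?_
    rw [abs_mul, abs_mul]; gcongr
  refine (abs_add_le _ _).trans ?_
  rw [abs_mul, abs_mul (K w)]
  calc _ ≤ lam * (‖x - y‖ / 2) ^ (-((n : ℝ) + s) - 1) * (L * ‖x - y‖) * (2 * 2)
        + lam * (‖x - y‖ / 2) ^ (-((n : ℝ) + s)) * (L * 2 + 2 * L) := by
        gcongr
    _ = 4 * lam * L * ((‖x - y‖ / 2) ^ (-((n : ℝ) + s) - 1) * ‖x - y‖)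
        + 4 * lam * L * (‖x - y‖ / 2) ^ (-((n : ℝ) + s)) := by ring
    _ = _ := by rw [h5, h6]; ring

lemma toReal_interaction_push (hK : KernelBound s lam K)
    (hnn : ∀ z, z ≠ 0 → 0 ≤ K z) (hν : ‖ν‖ = 1)
    (h : ContDiff ℝ 1 ξ) (hL : ∀ x, ‖fderiv ℝ ξ x‖ ≤ L) {t : ℝ} (htL : |t| * L ≤ 1 / 4)
    {A B : Set (Eu n)} (hA : MeasurableSet A) (hB : MeasurableSet B) (hAB : Disjoint A B) :
    (interaction K (push ν ξ t '' A) (push ν ξ t '' B)).toReal =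
      ∫ p in A ×ˢ B, K (push ν ξ t p.1 - push ν ξ t p.2) *
        ((1 + t * fderiv ℝ ξ p.1 ν) * (1 + t * fderiv ℝ ξ p.2 ν)) := by
  have hd : Differentiable ℝ ξ := h.differentiable one_ne_zero
  have hfm : Measurable (fun x => fderiv ℝ ξ x ν) := measurable_fderiv_apply_const ℝ ξ ν
  have hpm : Measurable (push ν ξ t) := by
    have := h.continuous
    unfold push; fun_prop
  have hKm := hK.measurable
  rw [interaction_push hν h hL htL hA hB hKm, integral_eq_lintegral_of_nonneg_ae]
  · refine (ae_restrict_iff' (hA.prod hB)).2 (.of_forall fun p hp => ?_)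
    have hxy : p.1 ≠ p.2 := fun heq => disjoint_left.1 hAB hp.1 (heq ▸ hp.2)
    have hx := abs_le.1 (abs_mul_fderiv_le hν hL htL p.1)
    have hy := abs_le.1 (abs_mul_fderiv_le hν hL htL p.2)
    exact mul_nonneg (hnn _ (sub_ne_zero.2 ((push_injective hν hd hL htL).ne hxy)))
      (mul_nonneg (by linarith) (by linarith))
  · exact (by fun_prop : Measurable _).aestronglyMeasurable

/-- After the change of variables the domain `A ×ˢ B` no longer depends on `t`, and the derivative
passes under the integral. -/
theorem hasDerivAt_interaction_push (hn : 0 < n) (hs : 0 < s) (hK : KernelBound s lam K)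
    (hnn : ∀ z, z ≠ 0 → 0 ≤ K z) (hν : ‖ν‖ = 1) (h : ContDiff ℝ 1 ξ)
    (hL : ∀ x, ‖fderiv ℝ ξ x‖ ≤ L) {A B : Set (Eu n)} (hA : MeasurableSet A)
    (hB : MeasurableSet B) (hAB : Disjoint A B)
    (hint : IntegrableOn (fun p : Eu n × Eu n => ‖p.1 - p.2‖ ^ (-(n + s))) (A ×ˢ B)) :
    HasDerivAt (fun t => (interaction K (push ν ξ t '' A) (push ν ξ t '' B)).toReal)
      (∫ p in A ×ˢ B, firstVar K ν ξ p.1 p.2) 0 := by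
  have hd : Differentiable ℝ ξ := h.differentiable one_ne_zero
  have hL0 : 0 ≤ L := (norm_nonneg _).trans (hL 0)
  have hfm : Measurable (fun x => fderiv ℝ ξ x ν) := measurable_fderiv_apply_const ℝ ξ ν
  have hpm (t : ℝ) : Measurable (push ν ξ t) := by
    have := h.continuous
    unfold push; fun_prop
  have hKm := hK.measurable
  have hS : {t : ℝ | |t| * L ≤ 1 / 4} ∈ 𝓝 (0 : ℝ) := by
    have hc : ContinuousAt (fun t : ℝ => |t| * L) 0 := by fun_prop
    exact hc.eventually_le_const (by norm_num) |>.mono fun t ht => ht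
  have hmem := ae_restrict_mem (μ := (volume : Measure (Eu n × Eu n))) (hA.prod hB)
  have hne : ∀ p : Eu n × Eu n, p ∈ A ×ˢ B → p.1 ≠ p.2 :=
    fun p hp heq => disjoint_left.1 hAB hp.1 (heq ▸ hp.2)
  have key := hasDerivAt_integral_of_dominated_loc_of_deriv_le
    (μ := volume.restrict (A ×ˢ B)) (x₀ := (0 : ℝ))
    (F := fun t (p : Eu n × Eu n) => K (push ν ξ t p.1 - push ν ξ t p.2) *
        ((1 + t * fderiv ℝ ξ p.1 ν) * (1 + t * fderiv ℝ ξ p.2 ν)))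
    (F' := fun t (p : Eu n × Eu n) =>
      fderiv ℝ K (push ν ξ t p.1 - push ν ξ t p.2) ((ξ p.1 - ξ p.2) • ν) *
        ((1 + t * fderiv ℝ ξ p.1 ν) * (1 + t * fderiv ℝ ξ p.2 ν)) +
        K (push ν ξ t p.1 - push ν ξ t p.2) *
          (fderiv ℝ ξ p.1 ν * (1 + t * fderiv ℝ ξ p.2 ν) +
            (1 + t * fderiv ℝ ξ p.1 ν) * fderiv ℝ ξ p.2 ν))
    (bound := fun p => 12 * lam * L * (1 / 2) ^ (-((n : ℝ) + s)) * ‖p.1 - p.2‖ ^ (-(n + s)))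
    hS (.of_forall fun t => (by have := hpm t; fun_prop : Measurable _).aestronglyMeasurable)
    ?_ ?_ ?_ (hint.const_mul _) ?_
  · have heq : ∀ t ∈ {t : ℝ | |t| * L ≤ 1 / 4}, _ := fun t ht =>
      toReal_interaction_push hK hnn hν h hL (t := t) ht hA hB hAB
    refine (key.2.congr_of_eventuallyEq (eventually_of_mem hS heq)).congr_deriv ?_
    refine setIntegral_congr_fun (hA.prod hB) fun p _ => ?_
    simp [firstVar, push]
    ring
  · refine Integrable.mono' (hint.const_mul lam)
      (by have := hpm 0; fun_prop : Measurable _).aestronglyMeasurable ?_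
    filter_upwards [hmem] with p hp
    simpa [push] using hK.abs_le _ (sub_ne_zero.2 (hne p hp))
  · have h0 := (measurable_firstVar hKm (ν := ν) h).aestronglyMeasurable
      (μ := volume.restrict (A ×ˢ B))
    refine h0.congr (.of_forall fun p => ?_)
    simp [firstVar, push]
    ring
  · filter_upwards [hmem] with p hp t ht
    exact abs_deriv_kernel_push_le hn hs hK hν hd hL ht (hne p hp)
  · filter_upwards [hmem] with p hp t ht
    exact hasDerivAt_kernel_push hK hν hd hL ht (hne p hp)

end

/-! ### Admissible deformations -/

section

variable {ν : Eu n} {ξ : Eu n → ℝ} {t L : ℝ}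

/-- A perturbation of the identity with Lipschitz constant `1/4 < 1` is a homeomorphism of the whole
space. -/
lemma exists_homeomorph_push (hn : 0 < n) (hν : ‖ν‖ = 1) (h : Differentiable ℝ ξ)
    (hL : ∀ x, ‖fderiv ℝ ξ x‖ ≤ L) (htL : |t| * L ≤ 1 / 4) :
    ∃ Φ : Eu n ≃ₜ Eu n, ⇑Φ = push ν ξ t := by
  have : Nonempty (Fin n) := ⟨⟨0, hn⟩⟩
  have h1 : ApproximatesLinearOn (push ν ξ t)
      ((ContinuousLinearEquiv.refl ℝ (Eu n) : Eu n ≃L[ℝ] Eu n) : Eu n →L[ℝ] Eu n) univ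
      (1 / 4 : ℝ≥0) := by
    intro x _ y _
    have h2 := norm_smul_sub_le hν h hL htL x y
    rw [push_sub_push]
    simp only [ContinuousLinearEquiv.coe_refl, ContinuousLinearMap.id_apply, add_sub_cancel_left]
    refine h2.trans (le_of_eq ?_)
    push_cast; ring
  refine ⟨h1.toHomeomorph _ (.inr ?_), rfl⟩
  have : ‖((ContinuousLinearEquiv.refl ℝ (Eu n)).symm : Eu n →L[ℝ] Eu n)‖₊ = 1 := by
    simp
  rw [this, ← NNReal.coe_lt_coe]
  norm_num

lemma push_bijective (hn : 0 < n) (hν : ‖ν‖ = 1) (h : Differentiable ℝ ξ)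
    (hL : ∀ x, ‖fderiv ℝ ξ x‖ ≤ L) (htL : |t| * L ≤ 1 / 4) : Function.Bijective (push ν ξ t) := by
  obtain ⟨Φ, hΦ⟩ := exists_homeomorph_push hn hν h hL htL
  exact hΦ ▸ Φ.bijective

lemma push_eq_self {x : Eu n} (hx : x ∉ tsupport ξ) : push ν ξ t x = x := by
  simp [push, image_eq_zero_of_notMem_tsupport hx]

lemma exists_smooth_inverse_push (hn : 0 < n) (hν : ‖ν‖ = 1) (h : ContDiff ℝ (⊤ : ℕ∞) ξ)
    (hL : ∀ x, ‖fderiv ℝ ξ x‖ ≤ L) (htL : |t| * L ≤ 1 / 4) :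
    ∃ g : Eu n → Eu n, ContDiff ℝ (⊤ : ℕ∞) g ∧ Function.LeftInverse g (push ν ξ t) ∧
      Function.RightInverse g (push ν ξ t) := by
  have hd : Differentiable ℝ ξ := h.differentiable (by simp)
  obtain ⟨Φ, hΦ⟩ := exists_homeomorph_push hn hν hd hL htL
  have hdet (x : Eu n) :
      (ContinuousLinearMap.id ℝ (Eu n) + (t • fderiv ℝ ξ x).smulRight ν).det ≠ 0 := by
    rw [det_push]
    have := abs_le.1 (abs_mul_fderiv_le hν hL htL x)
    linarith
  refine ⟨Φ.symm, Φ.contDiff_symm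
    (f₀' := fun x => ContinuousLinearMap.toContinuousLinearEquivOfDetNeZero _ (hdet x)) ?_ ?_,
    ?_, ?_⟩
  · intro x
    rw [hΦ]
    exact hasFDerivAt_push hd x
  · rw [hΦ]
    unfold push
    fun_prop
  · rw [← hΦ]; exact Φ.symm_apply_apply
  · rw [← hΦ]; exact Φ.apply_symm_apply

lemma push_image_compl {Ω : Set (Eu n)} (hξ : tsupport ξ ⊆ Ω) : push ν ξ t '' Ωᶜ = Ωᶜ := by
  have : ∀ x ∈ Ωᶜ, push ν ξ t x = id x := fun x hx => push_eq_self fun h => hx (hξ h)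
  rw [image_congr this, image_id]

lemma push_image_eq (hb : Function.Bijective (push ν ξ t)) {Ω : Set (Eu n)}
    (hξ : tsupport ξ ⊆ Ω) : push ν ξ t '' Ω = Ω := by
  rw [← compl_inj_iff, ← image_compl_eq hb, push_image_compl hξ]

lemma push_image_compl_inter (hb : Function.Bijective (push ν ξ t)) {Ω E : Set (Eu n)}
    (hξ : tsupport ξ ⊆ Ω) : push ν ξ t '' (Eᶜ ∩ Ω) = (push ν ξ t '' E)ᶜ ∩ Ω := by
  rw [image_inter hb.1, image_compl_eq hb, push_image_eq hb hξ]

/-- The volume of the image is `∫_E (1 + t ∂_ν ξ)`; being affine in `t`, it is constant once its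
derivative vanishes. -/
lemma volume_push_image (hν : ‖ν‖ = 1) (h : ContDiff ℝ 1 ξ)
    (hL : ∀ x, ‖fderiv ℝ ξ x‖ ≤ L) (htL : |t| * L ≤ 1 / 4) {E : Set (Eu n)}
    (hE : MeasurableSet E) (hEf : volume E ≠ ∞) (h0 : ∫ x in E, fderiv ℝ ξ x ν = 0) :
    volume (push ν ξ t '' E) = volume E := by
  have hd : Differentiable ℝ ξ := h.differentiable one_ne_zero
  have h1 := lintegral_push_image hν hd hL htL hE (fun _ => 1)
  simp only [mul_one, lintegral_one, Measure.restrict_apply_univ] at h1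
  have hfm : Measurable (fun x => fderiv ℝ ξ x ν) := measurable_fderiv_apply_const ℝ ξ ν
  have : IsFiniteMeasure (volume.restrict E) := ⟨by simpa using hEf.lt_top⟩
  have hint : Integrable (fun x => fderiv ℝ ξ x ν) (volume.restrict E) :=
    Integrable.of_bound hfm.aestronglyMeasurable L
      (.of_forall fun x => abs_fderiv_apply_le hL hν x)
  rw [h1, ← ofReal_integral_eq_lintegral_ofReal, integral_add (integrable_const _)
    (hint.const_mul t), integral_const_mul, h0]
  · simp [Measure.real, hEf]
  · exact (integrable_const _).add (hint.const_mul t)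
  · refine .of_forall fun x => ?_
    have := abs_le.1 (abs_mul_fderiv_le hν hL htL x)
    simp only [Pi.zero_apply]
    linarith

/-- The denominator contains `L + 1` in place of `L` so that `L = 0` is allowed. -/
lemma abs_mul_le_quarter (hL0 : 0 ≤ L) (ht : t ∈ Ioo (-(1 / (4 * (L + 1)))) (1 / (4 * (L + 1)))) :
    |t| * L ≤ 1 / 4 := by
  have h1 : |t| ≤ 1 / (4 * (L + 1)) := (abs_lt.2 ⟨ht.1, ht.2⟩).le
  calc |t| * L ≤ 1 / (4 * (L + 1)) * (L + 1) := by gcongr; linarith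
    _ = 1 / 4 := by field_simp

lemma isAdmissibleFamily_push (hn : 0 < n) (hν : ‖ν‖ = 1) (h : ContDiff ℝ (⊤ : ℕ∞) ξ)
    (hc : HasCompactSupport ξ)
    (hL : ∀ x, ‖fderiv ℝ ξ x‖ ≤ L) {Ω E : Set (Eu n)} (hξ : tsupport ξ ⊆ Ω)
    (hE : MeasurableSet E) (hEf : volume E ≠ ∞) (h0 : ∫ x in E, fderiv ℝ ξ x ν = 0) :
    IsAdmissibleFamily Ω E (1 / (4 * (L + 1))) (push ν ξ) := by
  have hL0 : 0 ≤ L := (norm_nonneg _).trans (hL 0)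
  have hd : Differentiable ℝ ξ := h.differentiable (by simp)
  exact
  { pos := by positivity
    smooth := by
      have h1 : ContDiff ℝ (⊤ : ℕ∞) (fun p : ℝ × Eu n => ξ p.2) := h.comp contDiff_snd
      have : ContDiff ℝ (⊤ : ℕ∞) (fun p : ℝ × Eu n => push ν ξ p.1 p.2) := by
        unfold push
        exact contDiff_snd.add ((contDiff_fst.mul h1).smul contDiff_const)
      exact this.contDiffOn
    diffeo := fun t ht => exists_smooth_inverse_push hn hν h hL (abs_mul_le_quarter hL0 ht)
    zero := fun x => by simp [push]
    compact := ⟨tsupport ξ, hc, fun t _ x hx => push_eq_self hx⟩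
    domain := fun t ht =>
      push_image_eq (push_bijective hn hν hd hL (abs_mul_le_quarter hL0 ht)) hξ
    volume_eq := fun t ht => volume_push_image hν (h.of_le (by simp)) hL
      (abs_mul_le_quarter hL0 ht) hE hEf h0 }

lemma hasDerivAt_integral_push (hν : ‖ν‖ = 1) (h : ContDiff ℝ 1 ξ) (hc : HasCompactSupport ξ)
    (hL : ∀ x, ‖fderiv ℝ ξ x‖ ≤ L) {E : Set (Eu n)} (hE : MeasurableSet E)
    (hEb : Bornology.IsBounded E) {g : Eu n → ℝ} (hg : ContDiff ℝ 1 g) :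
    HasDerivAt (fun t => ∫ x in push ν ξ t '' E, g x)
      (∫ x in E, (fderiv ℝ g x ν * ξ x + g x * fderiv ℝ ξ x ν)) 0 := by
  have hd : Differentiable ℝ ξ := h.differentiable one_ne_zero
  have hdg : Differentiable ℝ g := hg.differentiable one_ne_zero
  have hL0 : 0 ≤ L := (norm_nonneg _).trans (hL 0)
  have hfm : Measurable (fun x => fderiv ℝ ξ x ν) := measurable_fderiv_apply_const ℝ ξ ν
  have hgm : Measurable (fun x => fderiv ℝ g x ν) := measurable_fderiv_apply_const ℝ g ν
  have hgm' := hg.continuous.measurable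
  have hξm := h.continuous.measurable
  have hpm (t : ℝ) : Measurable (push ν ξ t) := by
    unfold push; fun_prop
  obtain ⟨C, hC⟩ := hc.exists_bound_of_continuous h.continuous
  have hC0 : 0 ≤ C := (norm_nonneg _).trans (hC 0)
  obtain ⟨R, hR⟩ := hEb.subset_closedBall 0
  obtain ⟨M, hM⟩ := (isCompact_closedBall (0 : Eu n) (R + C)).exists_bound_of_continuousOn
    hg.continuous.continuousOn
  obtain ⟨M', hM'⟩ := (isCompact_closedBall (0 : Eu n) (R + C)).exists_bound_of_continuousOn
    (hg.continuous_fderiv one_ne_zero).continuousOn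
  -- For `|t| ≤ 1` the images of `E` stay in one ball, on which `g` and its differential are
  -- bounded.
  have hpush (t : ℝ) (ht : |t| ≤ 1) (x : Eu n) (hx : x ∈ E) :
      push ν ξ t x ∈ Metric.closedBall (0 : Eu n) (R + C) := by
    have h1 : ‖x‖ ≤ R := by simpa using hR hx
    have h2 : ‖(t * ξ x) • ν‖ ≤ C := by
      rw [norm_smul, hν, mul_one, norm_mul, Real.norm_eq_abs]
      nlinarith [hC x, norm_nonneg (ξ x), abs_nonneg t]
    simpa [push] using (norm_add_le _ _).trans (add_le_add h1 h2)
  have hS : {t : ℝ | |t| * L ≤ 1 / 4 ∧ |t| ≤ 1} ∈ 𝓝 (0 : ℝ) := by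
    have hc1 : ContinuousAt (fun t : ℝ => |t| * L) 0 := by fun_prop
    have hc2 : ContinuousAt (fun t : ℝ => |t|) 0 := by fun_prop
    filter_upwards [hc1.eventually_le_const (by norm_num : |(0 : ℝ)| * L < 1 / 4),
      hc2.eventually_le_const (by norm_num : |(0 : ℝ)| < 1)] with t ht ht' using ⟨ht, ht'⟩
  have hmem := ae_restrict_mem (μ := (volume : Measure (Eu n))) hE
  have : IsFiniteMeasure (volume.restrict E) := ⟨by simpa using hEb.measure_lt_top⟩
  have h0mem : ∀ x ∈ E, x ∈ Metric.closedBall (0 : Eu n) (R + C) := fun x hx => by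
    simpa [push] using hpush 0 (by simp) x hx
  have hjac {t : ℝ} (ht : |t| * L ≤ 1 / 4) (x : Eu n) : |1 + t * fderiv ℝ ξ x ν| ≤ 2 := by
    have := abs_le.1 (abs_mul_fderiv_le hν hL ht x)
    exact abs_le.2 ⟨by linarith, by linarith⟩
  have key := hasDerivAt_integral_of_dominated_loc_of_deriv_le
    (μ := volume.restrict E) (x₀ := (0 : ℝ))
    (F := fun t x => (1 + t * fderiv ℝ ξ x ν) * g (push ν ξ t x))
    (F' := fun t x => fderiv ℝ ξ x ν * g (push ν ξ t x) +
      (1 + t * fderiv ℝ ξ x ν) * fderiv ℝ g (push ν ξ t x) (ξ x • ν))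
    (bound := fun _ => L * M + 2 * (M' * C))
    hS (.of_forall fun t => (by have := hpm t; fun_prop : Measurable _).aestronglyMeasurable)
    ?_ ?_ ?_ (integrable_const _) ?_
  · have heq : ∀ t ∈ {t : ℝ | |t| * L ≤ 1 / 4 ∧ |t| ≤ 1}, ∫ x in push ν ξ t '' E, g x =
        ∫ x in E, (1 + t * fderiv ℝ ξ x ν) * g (push ν ξ t x) := by
      intro t ht
      rw [integral_image_eq_integral_abs_det_fderiv_smul volume hE
        (fun x _ => (hasFDerivAt_push hd x).hasFDerivWithinAt)
        (push_injective hν hd hL ht.1).injOn]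
      refine integral_congr_ae (.of_forall fun x => ?_)
      have := abs_le.1 (abs_mul_fderiv_le hν hL ht.1 x)
      simp only [det_push, smul_eq_mul]
      rw [abs_of_nonneg (by linarith)]
    refine (key.2.congr_of_eventuallyEq (eventually_of_mem hS heq)).congr_deriv ?_
    refine setIntegral_congr_fun hE fun x _ => ?_
    simp [push]
    ring
  · refine Integrable.of_bound (by have := hpm 0; fun_prop : Measurable _).aestronglyMeasurable M ?_
    filter_upwards [hmem] with x hx
    simpa [push] using hM x (h0mem x hx)
  · have h0 : Measurable fun x => fderiv ℝ g x ν * ξ x + g x * fderiv ℝ ξ x ν := by fun_prop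
    refine h0.aestronglyMeasurable.congr (.of_forall fun x => ?_)
    simp [push]
    ring
  · filter_upwards [hmem] with x hx t ht
    have hp := hpush t ht.2 x hx
    have hM0 : 0 ≤ M := (norm_nonneg _).trans (hM _ hp)
    have hM0' : 0 ≤ M' := (norm_nonneg _).trans (hM' _ hp)
    have h1 : |fderiv ℝ g (push ν ξ t x) (ξ x • ν)| ≤ M' * C := by
      refine ((fderiv ℝ g (push ν ξ t x)).le_opNorm _).trans ?_
      rw [norm_smul, hν, mul_one]
      exact mul_le_mul (hM' _ hp) (hC x) (norm_nonneg _) hM0'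
    refine (norm_add_le _ _).trans ?_
    rw [norm_mul, norm_mul]
    exact add_le_add (mul_le_mul (abs_fderiv_apply_le hL hν x) (hM _ hp) (norm_nonneg _) hL0)
      (mul_le_mul (hjac ht.1 x) h1 (norm_nonneg _) (by norm_num))
  · filter_upwards with x t ht
    have h1 : HasDerivAt (fun t => push ν ξ t x) (ξ x • ν) t := by
      have := (((hasDerivAt_id t).mul_const (ξ x)).smul_const ν).const_add x
      simpa [push] using this
    have h2 := ((hdg (push ν ξ t x)).hasFDerivAt).comp_hasDerivAt t h1
    have h3 : HasDerivAt (fun t : ℝ => 1 + t * fderiv ℝ ξ x ν) (fderiv ℝ ξ x ν) t := by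
      simpa using ((hasDerivAt_id t).mul_const (fderiv ℝ ξ x ν)).const_add 1
    exact h3.mul h2

end

/-! ### Integrability away from the diagonal -/

/-- The integrand is that of the convolution of the indicator of `S` with the truncated power, and
both factors are integrable. -/
lemma integrableOn_far {s ε : ℝ} (hs : 0 < s) (hε : 0 < ε) {S : Set (Eu n)}
    (hS : MeasurableSet S) (hSf : volume S ≠ ∞) :
    IntegrableOn (fun p : Eu n × Eu n => ‖p.1 - p.2‖ ^ (-(n + s)))
      ((S ×ˢ univ) ∩ {p | ε ≤ ‖p.1 - p.2‖}) := by
  have h1 : Integrable (S.indicator (fun _ => (1 : ℝ))) :=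
    (integrable_indicator_iff hS).2 (integrableOn_const hSf)
  have hfar : MeasurableSet {z : Eu n | ε ≤ ‖z‖} := measurableSet_le measurable_const measurable_norm
  have h2 := (integrable_indicator_iff hfar).2 (integrableOn_norm_rpow_far (n := n) hs hε)
  have h3 := (h1.convolution_integrand (ContinuousLinearMap.mul ℝ ℝ) h2).swap
  have hm : MeasurableSet ((S ×ˢ (univ : Set (Eu n))) ∩ {p | ε ≤ ‖p.1 - p.2‖}) :=
    (hS.prod .univ).inter (measurableSet_le measurable_const (by fun_prop))
  rw [← integrable_indicator_iff hm]
  refine h3.congr (.of_forall fun p => ?_)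
  by_cases hp : p.1 ∈ S <;> by_cases hq : ε ≤ ‖p.1 - p.2‖ <;>
    simp [indicator, hp, hq, norm_sub_rev p.2 p.1]

lemma integrableOn_far_swap {s ε : ℝ} (hs : 0 < s) (hε : 0 < ε) {S : Set (Eu n)}
    (hS : MeasurableSet S) (hSf : volume S ≠ ∞) :
    IntegrableOn (fun p : Eu n × Eu n => ‖p.1 - p.2‖ ^ (-(n + s)))
      ((univ ×ˢ S) ∩ {p | ε ≤ ‖p.1 - p.2‖}) := by
  have hm : MeasurableSet ((S ×ˢ (univ : Set (Eu n))) ∩ {p | ε ≤ ‖p.1 - p.2‖}) :=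
    (hS.prod .univ).inter (measurableSet_le measurable_const (by fun_prop))
  have hm' : MeasurableSet (((univ : Set (Eu n)) ×ˢ S) ∩ {p | ε ≤ ‖p.1 - p.2‖}) :=
    (MeasurableSet.univ.prod hS).inter (measurableSet_le measurable_const (by fun_prop))
  have h1 := ((integrable_indicator_iff hm).2 (integrableOn_far hs hε hS hSf)).swap
  rw [← integrable_indicator_iff hm']
  refine h1.congr (.of_forall fun p => ?_)
  by_cases hp : p.2 ∈ S <;> by_cases hq : ε ≤ ‖p.1 - p.2‖ <;>
    simp [indicator, hp, hq, norm_sub_rev p.2 p.1]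

/-- Near the diagonal the lower bound on `K` turns finite energy into integrability of the pure
power; at distance at least `ε` the power is integrable because `A` has finite volume. -/
lemma IsKernel.integrableOn_of_interaction_lt_top {s lam : ℝ} {ϱ : ℝ≥0∞} {K : Eu n → ℝ}
    (hs : 0 < s) (hlam : 0 < lam) (hϱ : 0 < ϱ) (hK : IsKernel s lam ϱ K) (hKm : Measurable K)
    {A B : Set (Eu n)} (hA : MeasurableSet A) (hB : MeasurableSet B) (hAB : Disjoint A B)
    (hAf : volume A ≠ ∞) (hfin : interaction K A B < ∞) :
    IntegrableOn (fun p : Eu n × Eu n => ‖p.1 - p.2‖ ^ (-(n + s))) (A ×ˢ B) := by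
  obtain ⟨ε, hε, hεϱ⟩ : ∃ ε : ℝ, 0 < ε ∧ ENNReal.ofReal ε < ϱ := by
    obtain ⟨r, hr0, hr⟩ := ENNReal.lt_iff_exists_real_btwn.1 hϱ
    exact ⟨r, by simpa using hr.1, hr.2⟩
  have hne : ∀ p : Eu n × Eu n, p ∈ A ×ˢ B → p.1 - p.2 ≠ 0 :=
    fun p hp heq => disjoint_left.1 hAB hp.1 (sub_eq_zero.1 heq ▸ hp.2)
  have hKint : IntegrableOn (fun p : Eu n × Eu n => K (p.1 - p.2)) (A ×ˢ B) := by
    refine ⟨(by fun_prop : Measurable _).aestronglyMeasurable, ?_⟩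
    rw [hasFiniteIntegral_iff_norm]
    have : ∫⁻ p in A ×ˢ B, ENNReal.ofReal ‖K (p.1 - p.2)‖ = interaction K A B := by
      rw [interaction, Measure.volume_eq_prod,
        ← lintegral_prod (f := fun p : Eu n × Eu n => ENNReal.ofReal (K (p.1 - p.2)))
          (by fun_prop), Measure.prod_restrict]
      refine setLIntegral_congr_fun (hA.prod hB) fun p hp => ?_
      rw [Real.norm_of_nonneg (hK.nonneg _ (hne p hp))]
    rw [this]; exact hfin
  have hfar := integrableOn_far hs hε hA hAf
  have hmS : MeasurableSet {p : Eu n × Eu n | ε ≤ ‖p.1 - p.2‖} :=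
    measurableSet_le measurable_const (by fun_prop)
  have hmeas : Measurable (fun p : Eu n × Eu n => ‖p.1 - p.2‖ ^ (-((n : ℝ) + s))) := by
    fun_prop
  rw [← inter_union_compl (A ×ˢ B) {p : Eu n × Eu n | ε ≤ ‖p.1 - p.2‖}]
  refine IntegrableOn.union (hfar.mono_set
    (inter_subset_inter_left _ (prod_mono_right (subset_univ _)))) ?_
  refine Integrable.mono' ((hKint.mono_set inter_subset_left).const_mul lam)
    hmeas.aestronglyMeasurable ?_
  filter_upwards [ae_restrict_mem ((hA.prod hB).inter hmS.compl)] with p hp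
  have hp2 : ‖p.1 - p.2‖ < ε := by simpa using hp.2
  have h1 := hK.lower _ (hne p hp.1) ((ENNReal.ofReal_le_ofReal hp2.le).trans_lt hεϱ)
  rw [Real.norm_of_nonneg (by positivity), Real.rpow_neg (norm_nonneg _)]
  have h3 : 0 < ‖p.1 - p.2‖ ^ ((n : ℝ) + s) :=
    Real.rpow_pos_of_pos (norm_pos_iff.2 (hne p hp.1)) _
  calc (‖p.1 - p.2‖ ^ ((n : ℝ) + s))⁻¹ = lam * (1 / (lam * ‖p.1 - p.2‖ ^ ((n : ℝ) + s))) := by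
        field_simp
    _ ≤ _ := by gcongr

/-! ### The Euler–Lagrange equation -/

/-- The first variation of the capillarity functional along `ξ ν`. -/
noncomputable def energyVar (K₁ K₂ : Eu n → ℝ) (σ : ℝ) (g : Eu n → ℝ) (Ω E : Set (Eu n))
    (ν : Eu n) (ξ : Eu n → ℝ) : ℝ :=
  (∫ p in E ×ˢ (Eᶜ ∩ Ω), firstVar K₁ ν ξ p.1 p.2) +
    σ * (∫ p in E ×ˢ Ωᶜ, firstVar K₂ ν ξ p.1 p.2) +
    ∫ x in E, (fderiv ℝ g x ν * ξ x + g x * fderiv ℝ ξ x ν)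

/-- A smooth function with compact support in `Ω`. -/
structure IsTest (Ω : Set (Eu n)) (ξ : Eu n → ℝ) : Prop where
  contDiff : ContDiff ℝ (⊤ : ℕ∞) ξ
  compact : HasCompactSupport ξ
  subset : tsupport ξ ⊆ Ω

namespace IsTest

variable {Ω : Set (Eu n)} {ξ w : Eu n → ℝ}

lemma differentiable (h : IsTest Ω ξ) : Differentiable ℝ ξ := h.contDiff.differentiable (by simp)

lemma contDiff_one (h : IsTest Ω ξ) : ContDiff ℝ 1 ξ := h.contDiff.of_le (by simp)

lemma sub_const_mul (h : IsTest Ω ξ) (hw : IsTest Ω w) (κ : ℝ) :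
    IsTest Ω (fun x => ξ x - κ * w x) where
  contDiff := h.contDiff.sub (contDiff_const.mul hw.contDiff)
  compact := by
    refine HasCompactSupport.of_support_subset_isCompact (h.compact.isCompact.union hw.compact.isCompact) ?_
    intro x hx
    by_contra hcon
    rw [mem_union, not_or] at hcon
    exact hx (by simp [image_eq_zero_of_notMem_tsupport hcon.1,
      image_eq_zero_of_notMem_tsupport hcon.2])
  subset := by
    refine (closure_minimal ?_ ((isClosed_tsupport ξ).union (isClosed_tsupport w))).trans
      (union_subset h.subset hw.subset)
    intro x hx
    by_contra hcon
    rw [mem_union, not_or] at hcon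
    exact hx (by simp [image_eq_zero_of_notMem_tsupport hcon.1,
      image_eq_zero_of_notMem_tsupport hcon.2])

end IsTest

lemma fderiv_sub_const_mul {ξ w : Eu n → ℝ} (h : Differentiable ℝ ξ) (hw : Differentiable ℝ w)
    (κ : ℝ) (x ν : Eu n) :
    fderiv ℝ (fun x => ξ x - κ * w x) x ν = fderiv ℝ ξ x ν - κ * fderiv ℝ w x ν := by
  have := ((h x).hasFDerivAt.sub ((hw x).hasFDerivAt.const_mul κ)).fderiv
  rw [show (fun x => ξ x - κ * w x) = ξ - fun y => κ * w y from rfl, this]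
  simp

lemma integrableOn_firstVar {s lam : ℝ} {K : Eu n → ℝ} (hK : KernelBound s lam K) {ν : Eu n}
    (hν : ‖ν‖ = 1) {Ω : Set (Eu n)} {ξ : Eu n → ℝ} (h : IsTest Ω ξ) {S : Set (Eu n × Eu n)}
    (hS : MeasurableSet S) (hne : ∀ p ∈ S, p.1 ≠ p.2)
    (hint : IntegrableOn (fun p : Eu n × Eu n => ‖p.1 - p.2‖ ^ (-(n + s))) S) :
    IntegrableOn (fun p : Eu n × Eu n => firstVar K ν ξ p.1 p.2) S := by
  obtain ⟨L, -, hL⟩ := exists_norm_fderiv_le h.contDiff h.compact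
  refine Integrable.mono' (hint.const_mul (3 * lam * L))
    (measurable_firstVar hK.measurable h.contDiff_one).aestronglyMeasurable ?_
  filter_upwards [ae_restrict_mem hS] with p hp
  exact abs_firstVar_le hK hν h.differentiable hL (hne p hp)

lemma integral_firstVar_sub {s lam : ℝ} {K : Eu n → ℝ} (hK : KernelBound s lam K) {ν : Eu n}
    (hν : ‖ν‖ = 1) {Ω : Set (Eu n)} {ξ w : Eu n → ℝ} (h : IsTest Ω ξ) (hw : IsTest Ω w)
    {S : Set (Eu n × Eu n)} (hS : MeasurableSet S) (hne : ∀ p ∈ S, p.1 ≠ p.2)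
    (hint : IntegrableOn (fun p : Eu n × Eu n => ‖p.1 - p.2‖ ^ (-(n + s))) S) (κ : ℝ) :
    ∫ p in S, firstVar K ν (fun x => ξ x - κ * w x) p.1 p.2 =
      (∫ p in S, firstVar K ν ξ p.1 p.2) - κ * ∫ p in S, firstVar K ν w p.1 p.2 := by
  rw [← integral_const_mul, ← integral_sub (integrableOn_firstVar hK hν h hS hne hint)
    ((integrableOn_firstVar hK hν hw hS hne hint).const_mul κ)]
  refine integral_congr_ae (.of_forall fun p => ?_)
  simp only [firstVar, fderiv_sub_const_mul h.differentiable hw.differentiable]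
  ring

section

variable {s₁ s₂ lam σ : ℝ} {ϱ : ℝ≥0∞} {K₁ K₂ g : Eu n → ℝ} {Ω E : Set (Eu n)}

lemma IsCritical.integrableOn₁ (hE : IsCritical K₁ K₂ σ g Ω E) (hs₁ : 0 < s₁) (hlam : 0 < lam)
    (hϱ : 0 < ϱ) (hK₁ : IsKernelC 2 s₁ lam ϱ K₁) (hΩo : IsOpen Ω)
    (hΩb : Bornology.IsBounded Ω) :
    IntegrableOn (fun p : Eu n × Eu n => ‖p.1 - p.2‖ ^ (-(n + s₁))) (E ×ˢ (Eᶜ ∩ Ω)) :=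
  hK₁.toIsKernel.integrableOn_of_interaction_lt_top hs₁ hlam hϱ hK₁.kernelBound.measurable
    hE.measurableSet (hE.measurableSet.compl.inter hΩo.measurableSet)
    (disjoint_compl_right.mono_right inter_subset_left)
    (hΩb.subset hE.subset).measure_lt_top.ne hE.finite₁

lemma IsCritical.integrableOn₂ (hE : IsCritical K₁ K₂ σ g Ω E) (hs₂ : 0 < s₂) (hlam : 0 < lam)
    (hϱ : 0 < ϱ) (hK₂ : IsKernelC 2 s₂ lam ϱ K₂) (hΩo : IsOpen Ω)
    (hΩb : Bornology.IsBounded Ω) :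
    IntegrableOn (fun p : Eu n × Eu n => ‖p.1 - p.2‖ ^ (-(n + s₂))) (E ×ˢ Ωᶜ) :=
  hK₂.toIsKernel.integrableOn_of_interaction_lt_top hs₂ hlam hϱ hK₂.kernelBound.measurable
    hE.measurableSet hΩo.measurableSet.compl
    (disjoint_compl_right.mono_left hE.subset)
    (hΩb.subset hE.subset).measure_lt_top.ne hE.finite₂

theorem IsCritical.energyVar_eq_zero (hn : 0 < n) (hE : IsCritical K₁ K₂ σ g Ω E) (hs₁ : 0 < s₁)
    (hs₂ : 0 < s₂) (hlam : 0 < lam) (hϱ : 0 < ϱ) (hK₁ : IsKernelC 2 s₁ lam ϱ K₁)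
    (hK₂ : IsKernelC 2 s₂ lam ϱ K₂) (hg : ContDiff ℝ 1 g) (hΩo : IsOpen Ω)
    (hΩb : Bornology.IsBounded Ω) {ν : Eu n} (hν : ‖ν‖ = 1) {ξ : Eu n → ℝ} (h : IsTest Ω ξ)
    (h0 : ∫ x in E, fderiv ℝ ξ x ν = 0) : energyVar K₁ K₂ σ g Ω E ν ξ = 0 := by
  obtain ⟨L, hL0, hL⟩ := exists_norm_fderiv_le h.contDiff h.compact
  have hEb := hΩb.subset hE.subset
  have hcrit := hE.deriv_eq_zero _ _ (isAdmissibleFamily_push hn hν h.contDiff h.compact hL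
    h.subset hE.measurableSet hEb.measure_lt_top.ne h0)
  have d1 := hasDerivAt_interaction_push hn hs₁ hK₁.kernelBound hK₁.nonneg hν h.contDiff_one hL
    hE.measurableSet (hE.measurableSet.compl.inter hΩo.measurableSet)
    (disjoint_compl_right.mono_right inter_subset_left)
    (hE.integrableOn₁ hs₁ hlam hϱ hK₁ hΩo hΩb)
  have d2 := hasDerivAt_interaction_push hn hs₂ hK₂.kernelBound hK₂.nonneg hν h.contDiff_one hL
    hE.measurableSet hΩo.measurableSet.compl
    (disjoint_compl_right.mono_left hE.subset)
    (hE.integrableOn₂ hs₂ hlam hϱ hK₂ hΩo hΩb)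
  have d3 := hasDerivAt_integral_push hν h.contDiff_one h.compact hL hE.measurableSet hEb hg
  have d := (d1.add (d2.const_mul σ)).add d3
  refine (hcrit.unique (d.congr_of_eventuallyEq ?_)).symm
  have hδ : (0 : ℝ) < 1 / (4 * (L + 1)) := by positivity
  filter_upwards [Ioo_mem_nhds (neg_lt_zero.2 hδ) hδ] with t ht
  have hb := push_bijective hn hν h.differentiable hL (abs_mul_le_quarter hL0 ht)
  -- The deformation carries `Eᶜ ∩ Ω` to the complement in `Ω` of the image of `E` and fixes `Ωᶜ`,
  -- so each term of the energy is one of the three functions already differentiated.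
  simp only [capillarity, Pi.add_apply]
  rw [← push_image_compl_inter hb h.subset]
  have hcompl : push ν ξ t '' Ωᶜ = Ωᶜ := push_image_compl h.subset
  rw [hcompl]

/-- For a suitable `κ` the function `ξ - κ w` has zero flux, hence preserves volume to all orders;
the first variation is linear in the test function, which produces the multiplier. -/
theorem IsCritical.exists_multiplier (hn : 0 < n) (hE : IsCritical K₁ K₂ σ g Ω E) (hs₁ : 0 < s₁)
    (hs₂ : 0 < s₂) (hlam : 0 < lam) (hϱ : 0 < ϱ) (hK₁ : IsKernelC 2 s₁ lam ϱ K₁)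
    (hK₂ : IsKernelC 2 s₂ lam ϱ K₂) (hg : ContDiff ℝ 1 g) (hΩo : IsOpen Ω)
    (hΩb : Bornology.IsBounded Ω) {ν : Eu n} (hν : ‖ν‖ = 1) {w : Eu n → ℝ} (hw : IsTest Ω w)
    (hw0 : ∫ x in E, fderiv ℝ w x ν ≠ 0) :
    ∃ m : ℝ, ∀ ξ, IsTest Ω ξ → energyVar K₁ K₂ σ g Ω E ν ξ = m * ∫ x in E, fderiv ℝ ξ x ν := by
  refine ⟨energyVar K₁ K₂ σ g Ω E ν w / ∫ x in E, fderiv ℝ w x ν, fun ξ h => ?_⟩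
  set κ := (∫ x in E, fderiv ℝ ξ x ν) / ∫ x in E, fderiv ℝ w x ν with hκ
  have hloc {u : Eu n → ℝ} (hu : Continuous u) : IntegrableOn u E :=
    (hu.locallyIntegrable.integrableOn_isCompact
      (hΩb.subset hE.subset).isCompact_closure).mono_set subset_closure
  have hder {u : Eu n → ℝ} (hu : ContDiff ℝ 1 u) : Continuous fun x => fderiv ℝ u x ν :=
    (hu.continuous_fderiv one_ne_zero).clm_apply continuous_const
  have hvol {u : Eu n → ℝ} (hu : ContDiff ℝ 1 u) :
      IntegrableOn (fun x => fderiv ℝ g x ν * u x + g x * fderiv ℝ u x ν) E := by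
    have h1 := hder hu
    have h2 := hder hg
    have h3 := hu.continuous
    have h4 := hg.continuous
    exact hloc (by fun_prop)
  have hz := hE.energyVar_eq_zero hn hs₁ hs₂ hlam hϱ hK₁ hK₂ hg hΩo hΩb hν
    (h.sub_const_mul hw κ) (by
      simp only [fderiv_sub_const_mul h.differentiable hw.differentiable]
      rw [integral_sub (hloc (hder h.contDiff_one)) ((hloc (hder hw.contDiff_one)).const_mul κ),
        integral_const_mul, hκ, div_mul_cancel₀ _ hw0, sub_self])
  have e1 := integral_firstVar_sub hK₁.kernelBound hν h hw
    (hE.measurableSet.prod (hE.measurableSet.compl.inter hΩo.measurableSet))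
    (fun p hp heq => hp.2.1 (heq ▸ hp.1)) (hE.integrableOn₁ hs₁ hlam hϱ hK₁ hΩo hΩb) κ
  have e2 := integral_firstVar_sub hK₂.kernelBound hν h hw
    (hE.measurableSet.prod hΩo.measurableSet.compl)
    (fun p hp heq => hp.2 (heq ▸ hE.subset hp.1)) (hE.integrableOn₂ hs₂ hlam hϱ hK₂ hΩo hΩb) κ
  have e3 : ∫ x in E, (fderiv ℝ g x ν * (ξ x - κ * w x) +
      g x * fderiv ℝ (fun x => ξ x - κ * w x) x ν) =
      (∫ x in E, (fderiv ℝ g x ν * ξ x + g x * fderiv ℝ ξ x ν)) -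
        κ * ∫ x in E, (fderiv ℝ g x ν * w x + g x * fderiv ℝ w x ν) := by
    rw [← integral_const_mul, ← integral_sub (hvol h.contDiff_one)
      ((hvol hw.contDiff_one).const_mul κ)]
    refine integral_congr_ae (.of_forall fun x => ?_)
    simp only [fderiv_sub_const_mul h.differentiable hw.differentiable]
    ring
  rw [energyVar, e1, e2, e3] at hz
  have hfin : energyVar K₁ K₂ σ g Ω E ν ξ = κ * energyVar K₁ K₂ σ g Ω E ν w := by
    simp only [energyVar]
    linear_combination hz
  rw [hfin, hκ]
  ring

end

/-! ### Rescaling -/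

/-- The set `(F - c) / r`. -/
def zoom (F : Set (Eu n)) (c : Eu n) (r : ℝ) : Set (Eu n) := {y | c + r • y ∈ F}

lemma mem_zoom {F : Set (Eu n)} {c : Eu n} {r : ℝ} {y : Eu n} :
    y ∈ zoom F c r ↔ c + r • y ∈ F := Iff.rfl

lemma measurableSet_zoom {F : Set (Eu n)} (hF : MeasurableSet F) (c : Eu n) (r : ℝ) :
    MeasurableSet (zoom F c r) :=
  hF.preimage (by fun_prop : Measurable fun y : Eu n => c + r • y)

/-- The test function `ψ` transplanted to the point `c` at scale `r`. -/
noncomputable def testAt (ψ : Eu n → ℝ) (c : Eu n) (r : ℝ) (x : Eu n) : ℝ := ψ (r⁻¹ • (x - c))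

lemma testAt_apply (ψ : Eu n → ℝ) (c : Eu n) {r : ℝ} (hr : 0 < r) (y : Eu n) :
    testAt ψ c r (c + r • y) = ψ y := by
  simp [testAt, smul_smul, hr.ne']

lemma fderiv_testAt {ψ : Eu n → ℝ} (h : Differentiable ℝ ψ) (c : Eu n) {r : ℝ} (hr : 0 < r)
    (y ν : Eu n) : fderiv ℝ (testAt ψ c r) (c + r • y) ν = r⁻¹ * fderiv ℝ ψ y ν := by
  have h1 : HasFDerivAt (fun x : Eu n => r⁻¹ • (x - c))
      (r⁻¹ • ContinuousLinearMap.id ℝ (Eu n)) (c + r • y) :=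
    ((hasFDerivAt_id _).sub_const c).const_smul r⁻¹
  have h0 : r⁻¹ • (c + r • y - c) = y := by simp [smul_smul, hr.ne']
  have h2 : HasFDerivAt ψ (fderiv ℝ ψ y) (r⁻¹ • (c + r • y - c)) := by
    rw [h0]; exact (h y).hasFDerivAt
  have h3 := (h2.comp (c + r • y) h1).fderiv
  have h4 : fderiv ℝ (testAt ψ c r) (c + r • y) = _ := h3
  rw [h4]; simp

lemma isTest_testAt {ψ : Eu n → ℝ} {S Ω : Set (Eu n)} (h : IsTest S ψ) {c : Eu n} {r : ℝ}
    (hr : 0 < r) (hS : S ⊆ zoom Ω c r) : IsTest Ω (testAt ψ c r) where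
  contDiff := h.contDiff.comp (by fun_prop : ContDiff ℝ (⊤ : ℕ∞) fun x : Eu n => r⁻¹ • (x - c))
  compact := by
    have := h.compact.comp_homeomorph
      ((Homeomorph.subRight c).trans (Homeomorph.smulOfNeZero r⁻¹ (inv_ne_zero hr.ne')))
    exact this
  subset := by
    have h1 : tsupport (testAt ψ c r) ⊆ (fun x => r⁻¹ • (x - c)) ⁻¹' tsupport ψ :=
      tsupport_comp_subset_preimage ψ (by fun_prop)
    intro x hx
    have h2 := hS (h.subset (h1 hx))
    rw [mem_zoom] at h2
    simpa [smul_smul, hr.ne'] using h2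

/-- The kernel `ζ ↦ r^{n+s} K(rζ)`. -/
noncomputable def scaledKernel (s r : ℝ) (K : Eu n → ℝ) (z : Eu n) : ℝ := r ^ (n + s) * K (r • z)

lemma fderiv_scaledKernel {s lam r : ℝ} {K : Eu n → ℝ} (hK : KernelBound s lam K) (hr : 0 < r)
    {z : Eu n} (hz : z ≠ 0) :
    fderiv ℝ (scaledKernel s r K) z = (r ^ ((n : ℝ) + s) * r) • fderiv ℝ K (r • z) := by
  have h1 : HasFDerivAt (fun x : Eu n => r • x) (r • ContinuousLinearMap.id ℝ (Eu n)) z :=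
    (hasFDerivAt_id _).const_smul r
  have h2 := (hK.differentiableAt (smul_ne_zero hr.ne' hz)).hasFDerivAt
  have h3 := ((h2.comp z h1).const_mul (r ^ ((n : ℝ) + s))).fderiv
  have h4 : fderiv ℝ (scaledKernel s r K) z = _ := h3
  rw [h4]
  ext v
  simp [mul_assoc]

lemma KernelBound.scaled {s lam r : ℝ} {K : Eu n → ℝ} (hK : KernelBound s lam K) (hr : 0 < r) :
    KernelBound s lam (scaledKernel s r K) where
  contDiffOn := contDiffOn_const.mul (hK.contDiffOn.comp
    (by fun_prop : ContDiff ℝ 1 fun x : Eu n => r • x).contDiffOn fun z hz => smul_ne_zero hr.ne' hz)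
  abs_le z hz := by
    have h1 := hK.abs_le _ (smul_ne_zero hr.ne' hz)
    rw [norm_smul, Real.norm_of_nonneg hr.le, Real.mul_rpow hr.le (norm_nonneg _)] at h1
    have h2 : 0 < r ^ ((n : ℝ) + s) := Real.rpow_pos_of_pos hr _
    rw [scaledKernel, abs_mul, abs_of_pos h2]
    calc _ ≤ r ^ ((n : ℝ) + s) * (lam * (r ^ (-((n : ℝ) + s)) * ‖z‖ ^ (-((n : ℝ) + s)))) := by
          gcongr
      _ = _ := by rw [Real.rpow_neg hr.le]; field_simp
  norm_fderiv_le z hz := by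
    have h1 := hK.norm_fderiv_le _ (smul_ne_zero hr.ne' hz)
    rw [norm_smul, Real.norm_of_nonneg hr.le, Real.mul_rpow hr.le (norm_nonneg _)] at h1
    have h2 : 0 < r ^ ((n : ℝ) + s) := Real.rpow_pos_of_pos hr _
    rw [fderiv_scaledKernel hK hr hz, norm_smul, Real.norm_of_nonneg (by positivity)]
    calc _ ≤ r ^ ((n : ℝ) + s) * r *
          (lam * (r ^ (-((n : ℝ) + s) - 1) * ‖z‖ ^ (-((n : ℝ) + s) - 1))) := by
          gcongr
      _ = _ := by rw [Real.rpow_sub_one hr.ne', Real.rpow_neg hr.le]; field_simp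

lemma IsKernel.scaled_lower {s lam r : ℝ} {ϱ : ℝ≥0∞} {K : Eu n → ℝ} (hK : IsKernel s lam ϱ K)
    (hr : 0 < r) {z : Eu n} (hz : z ≠ 0) (hzϱ : ENNReal.ofReal (r * ‖z‖) < ϱ) :
    1 / (lam * ‖z‖ ^ ((n : ℝ) + s)) ≤ scaledKernel s r K z := by
  have h1 := hK.lower _ (smul_ne_zero hr.ne' hz) (by
    rwa [norm_smul, Real.norm_of_nonneg hr.le])
  rw [norm_smul, Real.norm_of_nonneg hr.le, Real.mul_rpow hr.le (norm_nonneg _)] at h1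
  have h2 : 0 < r ^ ((n : ℝ) + s) := Real.rpow_pos_of_pos hr _
  calc _ = r ^ ((n : ℝ) + s) * (1 / (lam * (r ^ ((n : ℝ) + s) * ‖z‖ ^ ((n : ℝ) + s)))) := by
        rw [mul_one_div, mul_left_comm, div_mul_cancel_left₀ h2.ne', one_div]
    _ ≤ _ := by
        rw [scaledKernel]; gcongr

lemma firstVar_scaledKernel {s lam r : ℝ} {K : Eu n → ℝ} (hK : KernelBound s lam K) (hr : 0 < r)
    {ψ : Eu n → ℝ} (h : Differentiable ℝ ψ) (c ν : Eu n) {x y : Eu n} (hxy : x ≠ y) :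
    firstVar (scaledKernel s r K) ν ψ x y =
      r ^ ((n : ℝ) + s) * r * firstVar K ν (testAt ψ c r) (c + r • x) (c + r • y) := by
  rw [firstVar, firstVar, fderiv_scaledKernel hK hr (sub_ne_zero.2 hxy), testAt_apply _ _ hr,
    testAt_apply _ _ hr, fderiv_testAt h c hr, fderiv_testAt h c hr, scaledKernel,
    add_sub_add_left_eq_sub, ← smul_sub]
  simp only [smul_apply, smul_eq_mul]
  field_simp

lemma setIntegral_zoom {E : Set (Eu n)} (hE : MeasurableSet E) (c : Eu n) {r : ℝ} (hr : 0 < r)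
    (G : Eu n → ℝ) :
    ∫ x in E, G x = r ^ (n : ℝ) * ∫ y in zoom E c r, G (c + r • y) := by
  rw [← integral_indicator hE, ← integral_indicator (measurableSet_zoom hE c r)]
  have h1 := Measure.integral_comp_smul (volume : Measure (Eu n))
    (fun z => E.indicator G (c + z)) r
  rw [integral_add_left_eq_self (E.indicator G) c] at h1
  have h2 : (fun y => (zoom E c r).indicator (fun y => G (c + r • y)) y) =
      fun y => E.indicator G (c + r • y) := by
    funext y; simp only [indicator, mem_zoom]; rfl
  rw [h2, h1, finrank_euclideanSpace_fin, Real.rpow_natCast, smul_eq_mul, abs_of_pos (by positivity)]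
  field_simp

lemma setIntegral_prod_zoom {A B : Set (Eu n)} (hA : MeasurableSet A) (hB : MeasurableSet B)
    (c : Eu n) {r : ℝ} (hr : 0 < r) (G : Eu n × Eu n → ℝ) :
    ∫ p in A ×ˢ B, G p = r ^ (n : ℝ) * r ^ (n : ℝ) *
      ∫ p in zoom A c r ×ˢ zoom B c r, G (c + r • p.1, c + r • p.2) := by
  rw [← integral_indicator (hA.prod hB),
    ← integral_indicator ((measurableSet_zoom hA c r).prod (measurableSet_zoom hB c r))]
  have h1 := Measure.integral_comp_smul ((volume : Measure (Eu n)).prod (volume : Measure (Eu n)))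
    (fun z => (A ×ˢ B).indicator G ((c, c) + z)) r
  rw [integral_add_left_eq_self ((A ×ˢ B).indicator G) (c, c)] at h1
  have h2 : (fun y => (zoom A c r ×ˢ zoom B c r).indicator
      (fun p => G (c + r • p.1, c + r • p.2)) y) =
      fun y => (A ×ˢ B).indicator G ((c, c) + r • y) := by
    funext y; simp only [indicator, mem_prod, mem_zoom]; rfl
  rw [h2, Measure.volume_eq_prod, h1, Module.finrank_prod, finrank_euclideanSpace_fin,
    Real.rpow_natCast, smul_eq_mul, abs_of_pos (by positivity), pow_add]
  field_simp

/-- The exponent counts `2n` from the change of variables, `-(n + s)` from the kernel and `-1` from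
the derivative. -/
lemma integral_firstVar_zoom {s lam r : ℝ} {K : Eu n → ℝ} (hK : KernelBound s lam K) (hr : 0 < r)
    {ψ : Eu n → ℝ} (h : Differentiable ℝ ψ) (c ν : Eu n) {A B : Set (Eu n)}
    (hA : MeasurableSet A) (hB : MeasurableSet B) (hAB : Disjoint A B) :
    ∫ p in A ×ˢ B, firstVar K ν (testAt ψ c r) p.1 p.2 = r ^ ((n : ℝ) - 1 - s) *
      ∫ p in zoom A c r ×ˢ zoom B c r, firstVar (scaledKernel s r K) ν ψ p.1 p.2 := by
  rw [setIntegral_prod_zoom hA hB c hr]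
  have h1 : ∫ p in zoom A c r ×ˢ zoom B c r, firstVar (scaledKernel s r K) ν ψ p.1 p.2 =
      r ^ ((n : ℝ) + s) * r * ∫ p in zoom A c r ×ˢ zoom B c r,
        firstVar K ν (testAt ψ c r) (c + r • p.1) (c + r • p.2) := by
    rw [← integral_const_mul]
    refine setIntegral_congr_fun ((measurableSet_zoom hA c r).prod (measurableSet_zoom hB c r))
      fun p hp => firstVar_scaledKernel hK hr h c ν ?_
    intro heq
    have h2 : c + r • p.1 ∈ B := by rw [heq]; exact hp.2
    exact disjoint_left.1 hAB hp.1 h2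
  rw [h1, Real.rpow_sub hr, Real.rpow_sub hr, Real.rpow_one, Real.rpow_add hr]
  have := Real.rpow_pos_of_pos hr (n : ℝ)
  have := Real.rpow_pos_of_pos hr s
  field_simp

/-! ### Slabs and the flux through a hyperplane -/

lemma measurable_inner_left (ν : Eu n) : Measurable fun x : Eu n => inner ℝ ν x := by fun_prop

lemma inner_add_smul_self {ν : Eu n} (hν : ‖ν‖ = 1) (x : Eu n) (t : ℝ) :
    inner ℝ ν (x + t • ν) = inner ℝ ν x + t := by
  rw [inner_add_right, inner_smul_right, real_inner_self_eq_norm_sq, hν]; ring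

/-- The part of a ball, centered on the hyperplane `ν^⊥`, in a slab of thickness `t` has volume
at least a fixed multiple of `t`. -/
lemma exists_slab_volume_ge {ν z₀ : Eu n} (hν : ‖ν‖ = 1) (hz₀ : inner ℝ ν z₀ = 0) {ρ : ℝ}
    (hρ : 0 < ρ) : ∃ c : ℝ, 0 < c ∧ ∀ t : ℝ, 0 < t → t ≤ ρ / 2 →
      c * t ≤ volume.real ({x | 0 ≤ inner ℝ ν x ∧ inner ℝ ν x < t} ∩ Metric.ball z₀ ρ) := by
  set HB : Set (Eu n) := {x | 0 < inner ℝ ν x} ∩ Metric.ball z₀ (ρ / 2) with hHB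
  have hHBo : IsOpen HB :=
    (isOpen_lt continuous_const (by fun_prop)).inter Metric.isOpen_ball
  have hHBn : HB.Nonempty := by
    refine ⟨z₀ + (ρ / 4) • ν, ?_, ?_⟩
    · rw [mem_ofPred_eq, inner_add_smul_self hν, hz₀]; linarith
    · rw [mem_ball_iff_norm, add_sub_cancel_left, norm_smul, hν, Real.norm_of_nonneg (by linarith)]
      linarith
  have hHBf : volume HB ≠ ∞ := ((measure_mono inter_subset_right).trans_lt
    Metric.isBounded_ball.measure_lt_top).ne
  have hHBp : 0 < volume.real HB := ENNReal.toReal_pos (hHBo.measure_pos _ hHBn).ne' hHBf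
  refine ⟨volume.real HB / ρ, by positivity, fun t ht htρ => ?_⟩
  set S : Set (Eu n) := {x | 0 ≤ inner ℝ ν x ∧ inner ℝ ν x < t} ∩ Metric.ball z₀ ρ with hS
  have hSf : volume S ≠ ∞ := ((measure_mono inter_subset_right).trans_lt
    Metric.isBounded_ball.measure_lt_top).ne
  -- The upper half of the smaller ball is covered by `N` translates of the slab `S` along `ν`:
  -- lowering a point by a multiple of `t` puts it in the slab, and the shift, less than `ρ / 2`,
  -- keeps it in the larger ball. As `t ≤ ρ / 2`, one has `N ≤ ρ / t`.
  set N : ℕ := ⌈ρ / 2 / t⌉₊ with hN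
  have hcover : HB ⊆ ⋃ j ∈ Finset.range N, {x | x + (-((j : ℝ) * t)) • ν ∈ S} := by
    intro x hx
    have hx1 : 0 < inner ℝ ν x := hx.1
    have hx2 : inner ℝ ν x < ρ / 2 := by
      have h1 : inner ℝ ν x = inner ℝ ν (x - z₀) := by rw [inner_sub_right, hz₀, sub_zero]
      have h2 := real_inner_le_norm ν (x - z₀)
      have h3 := mem_ball_iff_norm.1 hx.2
      rw [hν, one_mul] at h2
      linarith
    have hfl := Nat.floor_le (div_nonneg hx1.le ht.le)
    have hfl2 := Nat.lt_floor_add_one (inner ℝ ν x / t)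
    rw [le_div_iff₀ ht] at hfl
    rw [div_lt_iff₀ ht] at hfl2
    simp only [mem_iUnion, Finset.mem_range, exists_prop]
    refine ⟨⌊inner ℝ ν x / t⌋₊, ?_, ?_, ?_⟩
    · have h4 : inner ℝ ν x / t < ρ / 2 / t := div_lt_div_of_pos_right hx2 ht
      have h5 : (⌊inner ℝ ν x / t⌋₊ : ℝ) < N :=
        (Nat.floor_le (div_nonneg hx1.le ht.le)).trans_lt (h4.trans_le (Nat.le_ceil _))
      exact_mod_cast h5
    · rw [mem_ofPred_eq, inner_add_smul_self hν]
      constructor <;> linarith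
    · rw [mem_ball_iff_norm, add_sub_right_comm]
      have h3 := mem_ball_iff_norm.1 hx.2
      refine (norm_add_le _ _).trans_lt ?_
      rw [norm_smul, hν, mul_one, norm_neg, Real.norm_of_nonneg (by positivity)]
      linarith
  have h1 : volume HB ≤ N * volume S := by
    refine (measure_mono hcover).trans ((measure_biUnion_finset_le _ _).trans ?_)
    have h2 (j : ℕ) : volume {x | x + (-((j : ℝ) * t)) • ν ∈ S} = volume S :=
      measure_preimage_add_right volume _ S
    simp only [h2, Finset.sum_const, Finset.card_range, nsmul_eq_mul, le_refl]
  have h3 : volume.real HB ≤ N * volume.real S := by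
    have := ENNReal.toReal_mono (ENNReal.mul_ne_top (by simp) hSf) h1
    simpa [Measure.real] using this
  have h4 : (N : ℝ) ≤ ρ / t := by
    have h5 := (Nat.ceil_lt_add_one (by positivity : 0 ≤ ρ / 2 / t)).le
    have h6 : 1 ≤ ρ / 2 / t := (one_le_div ht).2 htρ
    have h7 : ρ / 2 / t + ρ / 2 / t = ρ / t := by field_simp; norm_num
    linarith
  calc volume.real HB / ρ * t ≤ (ρ / t * volume.real S) / ρ * t := by
        gcongr
        exact h3.trans (by gcongr)
    _ = volume.real S := by field_simp

/-- Meant for half-spaces: translating the function amounts to translating the half-space, so the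
integral of `∂_ν u` is the rate of change of an integral over a moving half-space. -/
lemma hasDerivAt_integral_translate {ν : Eu n} (hν : ‖ν‖ = 1) {u : Eu n → ℝ}
    (hu : ContDiff ℝ 1 u) (huc : HasCompactSupport u) (V : Set (Eu n)) :
    HasDerivAt (fun t : ℝ => ∫ x in V, u (x + t • ν)) (∫ x in V, fderiv ℝ u x ν) 0 := by
  have hdu : Differentiable ℝ u := hu.differentiable one_ne_zero
  obtain ⟨R, hR⟩ := huc.isCompact.isBounded.subset_closedBall 0
  obtain ⟨M, hM⟩ := (huc.fderiv (𝕜 := ℝ)).exists_bound_of_continuous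
    (hu.continuous_fderiv one_ne_zero)
  have hfc : Continuous fun x => fderiv ℝ u x ν :=
    (hu.continuous_fderiv one_ne_zero).clm_apply continuous_const
  have huc' := hu.continuous
  have key := hasDerivAt_integral_of_dominated_loc_of_deriv_le
    (μ := volume.restrict V) (x₀ := (0 : ℝ)) (s := Ioo (-1) 1)
    (F := fun t x => u (x + t • ν)) (F' := fun t x => fderiv ℝ u (x + t • ν) ν)
    (bound := (Metric.closedBall (0 : Eu n) (R + 1)).indicator fun _ => M)
    (Ioo_mem_nhds (by norm_num) (by norm_num))
    (.of_forall fun t => (by fun_prop : Continuous _).aestronglyMeasurable)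
    ?_ ?_ ?_ ?_ ?_
  · simpa using key.2
  · simpa using (huc'.integrable_of_hasCompactSupport huc).restrict
  · simpa using hfc.aestronglyMeasurable
  · filter_upwards with x t ht
    by_cases hx : x ∈ Metric.closedBall (0 : Eu n) (R + 1)
    · rw [indicator_of_mem hx]
      have := (fderiv ℝ u (x + t • ν)).le_opNorm ν
      rw [hν, mul_one] at this
      exact this.trans (hM _)
    · rw [indicator_of_notMem hx]
      have h1 : x + t • ν ∉ tsupport (fderiv ℝ u) := by
        intro hcon
        have h2 : ‖x + t • ν‖ ≤ R := by simpa using hR (tsupport_fderiv_subset ℝ hcon)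
        apply hx
        rw [mem_closedBall_zero_iff]
        have h3 := norm_sub_le (x + t • ν) (t • ν)
        rw [add_sub_cancel_right, norm_smul t ν, hν, mul_one] at h3
        have h4 : ‖t‖ ≤ 1 := (abs_lt.2 ⟨ht.1, ht.2⟩).le
        linarith
      rw [image_eq_zero_of_notMem_tsupport h1]
      simp
  · exact (integrable_indicator_iff Metric.isClosed_closedBall.measurableSet).2
      (integrableOn_const Metric.isBounded_closedBall.measure_lt_top.ne)
  · filter_upwards with x t _
    have h1 : HasDerivAt (fun t : ℝ => x + t • ν) ν t := by
      simpa using ((hasDerivAt_id t).smul_const ν).const_add x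
    exact (hdu _).hasFDerivAt.comp_hasDerivAt t h1

/-- Lower bound for the flux of a nonnegative function through the hyperplane `ν^⊥`. -/
lemma exists_flux_ge {ν z₀ : Eu n} (hν : ‖ν‖ = 1) (hz₀ : inner ℝ ν z₀ = 0) {ρ : ℝ}
    (hρ : 0 < ρ) : ∃ c : ℝ, 0 < c ∧ ∀ (u : Eu n → ℝ) (m : ℝ), ContDiff ℝ 1 u →
      HasCompactSupport u → (∀ x, 0 ≤ u x) → 0 ≤ m → (∀ x ∈ Metric.ball z₀ ρ, m ≤ u x) →
      c * m ≤ ∫ x in {x | inner ℝ ν x < 0}, fderiv ℝ u x ν := by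
  obtain ⟨c, hc, hslab⟩ := exists_slab_volume_ge hν hz₀ hρ
  refine ⟨c, hc, fun u m hu huc hnn hm hmu => ?_⟩
  have hui := hu.continuous.integrable_of_hasCompactSupport (μ := volume) huc
  have hder := (hasDerivAt_integral_translate hν hu huc {x | inner ℝ ν x < 0}).tendsto_slope
  -- For `t > 0` the increment is the integral of `u` over a slab of thickness `t`, and it is
  -- bounded below by `m` times the volume of the slab within the ball.
  have hder' := hder.mono_left (nhdsWithin_mono 0 (fun t (ht : t ∈ Ioi (0 : ℝ)) => ne_of_gt ht))
  refine ge_of_tendsto hder' ?_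
  filter_upwards [Ioc_mem_nhdsGT (by positivity : (0 : ℝ) < ρ / 2)] with t ht
  have hV (a : ℝ) : MeasurableSet {x : Eu n | inner ℝ ν x < a} :=
    measurableSet_lt (measurable_inner_left ν) measurable_const
  have h1 : ∫ x in {x | inner ℝ ν x < 0}, u (x + t • ν) = ∫ x in {x | inner ℝ ν x < t}, u x := by
    rw [← integral_indicator (hV 0), ← integral_indicator (hV t),
      ← integral_add_right_eq_self ({x | inner ℝ ν x < t}.indicator u) (t • ν)]
    congr 1; funext x
    simp [indicator, inner_add_smul_self hν]
  have h2 : {x : Eu n | inner ℝ ν x < t} =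
      {x | inner ℝ ν x < 0} ∪ {x | 0 ≤ inner ℝ ν x ∧ inner ℝ ν x < t} := by
    ext x
    simp only [mem_ofPred_eq, mem_union]
    constructor
    · intro h
      rcases lt_or_ge (inner ℝ ν x) 0 with h' | h'
      · exact .inl h'
      · exact .inr ⟨h', h⟩
    · rintro (h | h)
      · exact h.trans ht.1
      · exact h.2
  have hSm : MeasurableSet {x : Eu n | 0 ≤ inner ℝ ν x ∧ inner ℝ ν x < t} :=
    (measurableSet_le measurable_const (measurable_inner_left ν)).inter (hV t)
  have h3 : ∫ x in {x | inner ℝ ν x < t}, u x = (∫ x in {x | inner ℝ ν x < 0}, u x) +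
      ∫ x in {x | 0 ≤ inner ℝ ν x ∧ inner ℝ ν x < t}, u x := by
    rw [h2, setIntegral_union _ hSm hui.integrableOn hui.integrableOn]
    rw [disjoint_left]
    intro x hx hx'
    exact absurd hx (not_lt.2 hx'.1)
  have h4 : m * (c * t) ≤ ∫ x in {x | 0 ≤ inner ℝ ν x ∧ inner ℝ ν x < t}, u x := by
    calc m * (c * t)
        ≤ m * volume.real ({x | 0 ≤ inner ℝ ν x ∧ inner ℝ ν x < t} ∩ Metric.ball z₀ ρ) := by
          gcongr; exact hslab t ht.1 ht.2
      _ ≤ ∫ x in {x | 0 ≤ inner ℝ ν x ∧ inner ℝ ν x < t} ∩ Metric.ball z₀ ρ, u x := by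
          refine setIntegral_ge_of_const_le_real (hSm.inter Metric.isOpen_ball.measurableSet)
            ((measure_mono inter_subset_right).trans_lt
              Metric.isBounded_ball.measure_lt_top).ne (fun x hx => hmu x hx.2)
            hui.integrableOn
      _ ≤ _ := setIntegral_mono_set hui.integrableOn (.of_forall hnn)
          (.of_forall inter_subset_left)
  rw [slope_def_field, h1, h3]
  simp only [zero_smul, add_zero, sub_zero, add_sub_cancel_left]
  rw [le_div_iff₀ ht.1]
  linarith

/-! ### Estimates near and away from the diagonal -/

section

variable {s lam L ρ ε : ℝ} {K : Eu n → ℝ} {ν z₀ : Eu n} {ψ : Eu n → ℝ}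

lemma firstVar_eq_zero {S : Set (Eu n)} (h : IsTest S ψ) (K : Eu n → ℝ) (ν : Eu n) {x y : Eu n}
    (hx : x ∉ S) (hy : y ∉ S) : firstVar K ν ψ x y = 0 := by
  have h1 : ∀ z ∉ S, ψ z = 0 ∧ fderiv ℝ ψ z = 0 := fun z hz =>
    ⟨image_eq_zero_of_notMem_tsupport fun hc => hz (h.subset hc),
      image_eq_zero_of_notMem_tsupport fun hc => hz (h.subset (tsupport_fderiv_subset ℝ hc))⟩
  simp [firstVar, h1 x hx, h1 y hy]

/-- The pairs of points at distance at least `ε`. -/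
def farSet (n : ℕ) (ε : ℝ) : Set (Eu n × Eu n) := {p | ε ≤ ‖p.1 - p.2‖}

lemma measurableSet_farSet : MeasurableSet (farSet n ε) :=
  measurableSet_le measurable_const (by fun_prop)

/-- The density vanishes unless one of the points lies in the ball of radius `ρ`; at mutual distance
less than `ε ≤ ρ`, both then lie in the ball of radius `2ρ`. Writing `y = x + v` and integrating
first in `x`, the hypothesis `hper` supplies the factor `C ‖v‖`, which makes the singularity
integrable. -/
lemma integrableOn_and_abs_setIntegral_near_le (hn : 0 < n) (hs : s < 1) (hK : KernelBound s lam K) (hν : ‖ν‖ = 1)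
    (h : IsTest (Metric.ball z₀ ρ) ψ) (hL : ∀ x, ‖fderiv ℝ ψ x‖ ≤ L) {A B : Set (Eu n)}
    (hA : MeasurableSet A) (hB : MeasurableSet B) (hAB : Disjoint A B) {C : ℝ} (hC : 0 ≤ C)
    (hper : ∀ v : Eu n, volume {x | x ∈ Metric.ball z₀ (2 * ρ) ∧ x + v ∈ Metric.ball z₀ (2 * ρ) ∧
      x ∈ A ∧ x + v ∈ B} ≤ ENNReal.ofReal (C * ‖v‖)) (hε : ε ≤ ρ) :
    IntegrableOn (fun p : Eu n × Eu n => firstVar K ν ψ p.1 p.2) ((A ×ˢ B) ∩ (farSet n ε)ᶜ) ∧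
    |∫ p in (A ×ˢ B) ∩ (farSet n ε)ᶜ, firstVar K ν ψ p.1 p.2| ≤
      3 * lam * L * C * ∫ v in Metric.ball (0 : Eu n) ε, ‖v‖ ^ (-(n + s) + 1) := by
  have hlam := hK.lam_nonneg hn
  have hL0 : 0 ≤ L := (norm_nonneg _).trans (hL 0)
  set a : ℝ := -((n : ℝ) + s) with ha
  set c : ℝ := 3 * lam * L with hc
  have hc0 : 0 ≤ c := by positivity
  set T : Set (Eu n × Eu n) := {p | p.1 ∈ Metric.ball z₀ (2 * ρ) ∧ p.2 ∈ Metric.ball z₀ (2 * ρ) ∧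
      p.1 ∈ A ∧ p.2 ∈ B ∧ ‖p.1 - p.2‖ < ε} with hT
  have hTm : MeasurableSet T := by
    have hb : MeasurableSet (Metric.ball z₀ (2 * ρ)) := Metric.isOpen_ball.measurableSet
    exact (measurable_fst hb).inter ((measurable_snd hb).inter ((measurable_fst hA).inter
      ((measurable_snd hB).inter (measurableSet_lt
        (by fun_prop : Measurable fun p : Eu n × Eu n => ‖p.1 - p.2‖) measurable_const))))
  set G : Eu n × Eu n → ℝ≥0∞ := T.indicator fun p => ENNReal.ofReal (c * ‖p.1 - p.2‖ ^ a) with hG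
  have hGm : Measurable G := Measurable.indicator (by fun_prop) hTm
  have hSm : MeasurableSet ((A ×ˢ B) ∩ (farSet n ε)ᶜ) :=
    (hA.prod hB).inter measurableSet_farSet.compl
  have h1 : ∫⁻ p in (A ×ˢ B) ∩ (farSet n ε)ᶜ, ENNReal.ofReal ‖firstVar K ν ψ p.1 p.2‖ ≤
      ∫⁻ p, G p := by
    rw [← lintegral_indicator hSm]
    refine lintegral_mono fun p => ?_
    by_cases hp : p ∈ (A ×ˢ B) ∩ (farSet n ε)ᶜ
    swap
    · rw [indicator_of_notMem hp]; exact zero_le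
    rw [indicator_of_mem hp]
    have hlt : ‖p.1 - p.2‖ < ε := not_le.1 hp.2
    by_cases hpT : p ∈ T
    · rw [hG, indicator_of_mem hpT]
      refine ENNReal.ofReal_le_ofReal (abs_firstVar_le hK hν h.differentiable hL ?_)
      exact fun heq => disjoint_left.1 hAB hp.1.1 (heq ▸ hp.1.2)
    · rw [firstVar_eq_zero h K ν]
      · simp
      · intro hx
        refine hpT ⟨Metric.ball_subset_ball ?_ hx, ?_, hp.1.1, hp.1.2, hlt⟩
        · have := dist_nonneg.trans_lt (Metric.mem_ball.1 hx); linarith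
        · rw [mem_ball_iff_norm] at hx ⊢
          have := norm_sub_le (p.1 - z₀) (p.1 - p.2)
          rw [sub_sub_sub_cancel_left] at this
          linarith
      · intro hx
        refine hpT ⟨?_, Metric.ball_subset_ball ?_ hx, hp.1.1, hp.1.2, hlt⟩
        · rw [mem_ball_iff_norm] at hx ⊢
          have := norm_add_le (p.1 - p.2) (p.2 - z₀)
          rw [sub_add_sub_cancel] at this
          linarith
        · have := dist_nonneg.trans_lt (Metric.mem_ball.1 hx); linarith
  have h2 : ∫⁻ p, G p ≤ ∫⁻ v in Metric.ball (0 : Eu n) ε,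
      ENNReal.ofReal (c * C * ‖v‖ ^ (a + 1)) := by
    rw [Measure.volume_eq_prod, lintegral_prod _ hGm.aemeasurable,
      ← lintegral_indicator Metric.isOpen_ball.measurableSet]
    have h3 : ∀ x : Eu n, ∫⁻ y, G (x, y) = ∫⁻ v, G (x, x + v) := fun x =>
      (lintegral_add_left_eq_self (fun y => G (x, y)) x).symm
    simp_rw [h3]
    rw [lintegral_lintegral_swap (by fun_prop)]
    refine lintegral_mono fun v => ?_
    by_cases hv : v ∈ Metric.ball (0 : Eu n) ε
    · rw [indicator_of_mem hv]
      set P : Set (Eu n) := {x | x ∈ Metric.ball z₀ (2 * ρ) ∧ x + v ∈ Metric.ball z₀ (2 * ρ) ∧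
        x ∈ A ∧ x + v ∈ B}
      calc ∫⁻ x, G (x, x + v) ≤ ∫⁻ x, P.indicator (fun _ => ENNReal.ofReal (c * ‖v‖ ^ a)) x := by
            refine lintegral_mono fun x => ?_
            by_cases hx : (x, x + v) ∈ T
            · have hxP : x ∈ P := ⟨hx.1, hx.2.1, hx.2.2.1, hx.2.2.2.1⟩
              rw [hG, indicator_of_mem hx, indicator_of_mem hxP]
              simp
            · rw [hG, indicator_of_notMem hx]; exact zero_le
        _ ≤ ENNReal.ofReal (c * ‖v‖ ^ a) * volume P := lintegral_indicator_const_le _ _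
        _ ≤ ENNReal.ofReal (c * ‖v‖ ^ a) * ENNReal.ofReal (C * ‖v‖) := by gcongr; exact hper v
        _ = ENNReal.ofReal (c * ‖v‖ ^ a * (C * ‖v‖)) := (ENNReal.ofReal_mul (by positivity)).symm
        _ ≤ _ := by
            refine ENNReal.ofReal_le_ofReal ?_
            rcases (norm_nonneg v).eq_or_lt with h0 | h0
            · rw [← h0]; simp only [mul_zero]; positivity
            · rw [Real.rpow_add_one h0.ne']
              exact le_of_eq (by ring)
    · rw [indicator_of_notMem hv]
      refine le_of_eq (lintegral_eq_zero_of_ae_eq_zero (.of_forall fun x => ?_))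
      refine indicator_of_notMem (fun hx => hv ?_) _
      have := hx.2.2.2.2
      simpa using this
  have hint := (integrableOn_norm_rpow_near (R := ε) hn hs).const_mul (c * C)
  refine ⟨⟨(measurable_firstVar hK.measurable h.contDiff_one).aestronglyMeasurable, ?_⟩, ?_⟩
  · rw [hasFiniteIntegral_iff_norm]
    exact (h1.trans h2).trans_lt hint.lintegral_lt_top
  rw [← Real.norm_eq_abs]
  refine (norm_integral_le_lintegral_norm _).trans ?_
  refine ENNReal.toReal_le_of_le_ofReal ?_ ((h1.trans h2).trans (le_of_eq ?_))
  · exact mul_nonneg (by positivity) (integral_nonneg fun v => by positivity)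
  · rw [← ofReal_integral_eq_lintegral_ofReal hint (.of_forall fun v => by simp only [Pi.zero_apply]; positivity),
      integral_const_mul]

lemma tendsto_near_zero (hn : 0 < n) (hs : s < 1) :
    Tendsto (fun ε : ℝ => ∫ v in Metric.ball (0 : Eu n) ε, ‖v‖ ^ (-(n + s) + 1)) (𝓝[>] 0) (𝓝 0) := by
  have : Nonempty (Fin n) := ⟨⟨0, hn⟩⟩
  have h1 := integrableOn_norm_rpow_near (R := 1) hn hs
  rw [← integrable_indicator_iff Metric.isOpen_ball.measurableSet] at h1
  have h2 : Tendsto (fun ε : ℝ => volume (Metric.ball (0 : Eu n) ε)) (𝓝[>] 0) (𝓝 0) := by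
    have h3 : Tendsto (fun ε : ℝ => ENNReal.ofReal ε ^ n * volume (Metric.ball (0 : Eu n) 1))
        (𝓝[>] 0) (𝓝 (ENNReal.ofReal 0 ^ n * volume (Metric.ball (0 : Eu n) 1))) := by
      refine ENNReal.Tendsto.mul_const ?_ (.inr Metric.isBounded_ball.measure_lt_top.ne)
      exact (((ENNReal.continuous_pow n).comp ENNReal.continuous_ofReal).tendsto 0).mono_left nhdsWithin_le_nhds
    simp only [ENNReal.ofReal_zero, ne_eq, hn.ne', not_false_eq_true, zero_pow, zero_mul] at h3
    refine h3.congr' ?_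
    filter_upwards [self_mem_nhdsWithin] with ε hε
    rw [Measure.addHaar_ball volume (0 : Eu n) (le_of_lt hε), finrank_euclideanSpace_fin,
      ENNReal.ofReal_pow (le_of_lt hε)]
  have h3 := h1.tendsto_setIntegral_nhds_zero h2
  refine h3.congr' ?_
  filter_upwards [Ioc_mem_nhdsGT (zero_lt_one : (0 : ℝ) < 1)] with ε hε
  refine setIntegral_congr_fun Metric.isOpen_ball.measurableSet fun v hv => ?_
  exact indicator_of_mem (Metric.ball_subset_ball hε.2 hv) _

/-- A dominating function for the first variation away from the diagonal. -/
noncomputable def farBound (n : ℕ) (s ε ρ : ℝ) (z₀ : Eu n) (p : Eu n × Eu n) : ℝ :=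
  (((Metric.ball z₀ ρ ×ˢ univ) ∩ farSet n ε) ∪ ((univ ×ˢ Metric.ball z₀ ρ) ∩ farSet n ε)).indicator
    (fun p => ‖p.1 - p.2‖ ^ (-(n + s))) p

lemma integrable_farBound (hs : 0 < s) (hε : 0 < ε) (ρ : ℝ) (z₀ : Eu n) :
    Integrable (farBound n s ε ρ z₀) := by
  have hb : MeasurableSet (Metric.ball z₀ ρ) := Metric.isOpen_ball.measurableSet
  have hf : volume (Metric.ball z₀ ρ) ≠ ∞ := Metric.isBounded_ball.measure_lt_top.ne
  refine (integrable_indicator_iff (((hb.prod .univ).inter measurableSet_farSet).union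
    ((MeasurableSet.univ.prod hb).inter measurableSet_farSet))).2 ?_
  exact (integrableOn_far hs hε hb hf).union (integrableOn_far_swap hs hε hb hf)

lemma abs_firstVar_le_farBound (hn : 0 < n) (hε : 0 < ε) (hK : KernelBound s lam K) (hν : ‖ν‖ = 1)
    (h : IsTest (Metric.ball z₀ ρ) ψ) (hL : ∀ x, ‖fderiv ℝ ψ x‖ ≤ L) {p : Eu n × Eu n}
    (hp : p ∈ farSet n ε) :
    |firstVar K ν ψ p.1 p.2| ≤ 3 * lam * L * farBound n s ε ρ z₀ p := by
  have hlam := hK.lam_nonneg hn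
  have hL0 : 0 ≤ L := (norm_nonneg _).trans (hL 0)
  have hne : p.1 ≠ p.2 := by
    intro heq
    have h1 : ε ≤ ‖p.1 - p.2‖ := hp
    rw [heq, sub_self, norm_zero] at h1
    linarith
  by_cases hx : p.1 ∈ Metric.ball z₀ ρ ∨ p.2 ∈ Metric.ball z₀ ρ
  · rw [farBound, indicator_of_mem]
    · exact abs_firstVar_le hK hν h.differentiable hL hne
    · rcases hx with hx | hx
      · exact .inl ⟨⟨hx, mem_univ _⟩, hp⟩
      · exact .inr ⟨⟨mem_univ _, hx⟩, hp⟩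
  · rw [not_or] at hx
    rw [firstVar_eq_zero h K ν hx.1 hx.2, abs_zero]
    refine mul_nonneg (by positivity) (indicator_nonneg (fun _ _ => by positivity) _)

lemma integrableOn_firstVar_far (hn : 0 < n) (hs : 0 < s) (hε : 0 < ε) (hK : KernelBound s lam K)
    (hν : ‖ν‖ = 1) (h : IsTest (Metric.ball z₀ ρ) ψ) :
    IntegrableOn (fun p : Eu n × Eu n => firstVar K ν ψ p.1 p.2) (farSet n ε) := by
  obtain ⟨L, -, hL⟩ := exists_norm_fderiv_le h.contDiff h.compact
  refine Integrable.mono' ((integrable_farBound hs hε ρ z₀).const_mul (3 * lam * L)).integrableOn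
    (measurable_firstVar hK.measurable h.contDiff_one).aestronglyMeasurable ?_
  filter_upwards [ae_restrict_mem measurableSet_farSet] with p hp
  exact abs_firstVar_le_farBound hn hε hK hν h hL hp

lemma abs_setIntegral_far_le (hn : 0 < n) (hs : 0 < s) (hε : 0 < ε) (hK : KernelBound s lam K)
    (hν : ‖ν‖ = 1) (h : IsTest (Metric.ball z₀ ρ) ψ) (hL : ∀ x, ‖fderiv ℝ ψ x‖ ≤ L)
    {S : Set (Eu n × Eu n)} (hS : MeasurableSet S) :
    |∫ p in S ∩ farSet n ε, firstVar K ν ψ p.1 p.2| ≤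
      3 * lam * L * ∫ p, farBound n s ε ρ z₀ p := by
  have hlam := hK.lam_nonneg hn
  have hL0 : 0 ≤ L := (norm_nonneg _).trans (hL 0)
  have hi := (integrable_farBound (n := n) hs hε ρ z₀).const_mul (3 * lam * L)
  rw [← integral_const_mul, ← Real.norm_eq_abs]
  refine (norm_integral_le_of_norm_le hi.integrableOn ?_).trans
    (setIntegral_le_integral hi (.of_forall fun p => ?_))
  · filter_upwards [ae_restrict_mem (hS.inter measurableSet_farSet)] with p hp
    exact abs_firstVar_le_farBound hn hε hK hν h hL hp.2
  · exact mul_nonneg (by positivity) (indicator_nonneg (fun _ _ => by positivity) _)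

lemma ae_prod_of_ae {P Q : Eu n → Prop} (hP : ∀ᵐ x, P x) (hQ : ∀ᵐ x, Q x) :
    ∀ᵐ p : Eu n × Eu n, P p.1 ∧ Q p.2 := by
  rw [Measure.volume_eq_prod]
  exact (Measure.quasiMeasurePreserving_fst.ae hP).and (Measure.quasiMeasurePreserving_snd.ae hQ)

/-- Dominated convergence: `farBound` works for every `k`, since all the kernels obey the same
bounds. -/
lemma tendsto_setIntegral_far (hn : 0 < n) (hs : 0 < s) (hε : 0 < ε) {Ks : ℕ → Eu n → ℝ}
    (hK : ∀ k, KernelBound s lam (Ks k)) (hν : ‖ν‖ = 1) (h : IsTest (Metric.ball z₀ ρ) ψ)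
    {A B : ℕ → Set (Eu n)} {A' B' : Set (Eu n)} (hA : ∀ k, MeasurableSet (A k))
    (hB : ∀ k, MeasurableSet (B k)) (hA' : MeasurableSet A') (hB' : MeasurableSet B')
    (hAc : ∀ᵐ x, ∀ᶠ k in atTop, (x ∈ A k ↔ x ∈ A')) (hBc : ∀ᵐ x, ∀ᶠ k in atTop, (x ∈ B k ↔ x ∈ B'))
    {F : Eu n × Eu n → ℝ} (hF : ∀ p : Eu n × Eu n, p.1 ≠ p.2 →
      Tendsto (fun k => firstVar (Ks k) ν ψ p.1 p.2) atTop (𝓝 (F p))) :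
    Tendsto (fun k => ∫ p in (A k ×ˢ B k) ∩ farSet n ε, firstVar (Ks k) ν ψ p.1 p.2) atTop
      (𝓝 (∫ p in (A' ×ˢ B') ∩ farSet n ε, F p)) := by
  obtain ⟨L, hL0, hL⟩ := exists_norm_fderiv_le h.contDiff h.compact
  have hlam := (hK 0).lam_nonneg hn
  have hm (k : ℕ) : MeasurableSet ((A k ×ˢ B k) ∩ farSet n ε) :=
    ((hA k).prod (hB k)).inter measurableSet_farSet
  have hm' : MeasurableSet ((A' ×ˢ B') ∩ farSet n ε) := (hA'.prod hB').inter measurableSet_farSet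
  simp_rw [← integral_indicator (hm _)]
  rw [← integral_indicator hm']
  refine tendsto_integral_of_dominated_convergence (fun p => 3 * lam * L * farBound n s ε ρ z₀ p)
    (fun k => ((measurable_firstVar (hK k).measurable h.contDiff_one).indicator
      (hm k)).aestronglyMeasurable) ((integrable_farBound hs hε ρ z₀).const_mul _) ?_ ?_
  · refine fun k => .of_forall fun p => ?_
    by_cases hp : p ∈ (A k ×ˢ B k) ∩ farSet n ε
    · rw [indicator_of_mem hp]
      exact abs_firstVar_le_farBound hn hε (hK k) hν h hL hp.2
    · rw [indicator_of_notMem hp, norm_zero]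
      exact mul_nonneg (by positivity) (indicator_nonneg (fun _ _ => by positivity) _)
  · filter_upwards [ae_prod_of_ae hAc hBc] with p hp
    by_cases hp' : p ∈ (A' ×ˢ B') ∩ farSet n ε
    · rw [indicator_of_mem hp']
      have hne : p.1 ≠ p.2 := by
        intro heq
        have h1 : ε ≤ ‖p.1 - p.2‖ := hp'.2
        rw [heq, sub_self, norm_zero] at h1
        linarith
      refine (hF p hne).congr' ?_
      filter_upwards [hp.1, hp.2] with k h1 h2
      have hk : p ∈ (A k ×ˢ B k) ∩ farSet n ε := ⟨⟨h1.2 hp'.1.1, h2.2 hp'.1.2⟩, hp'.2⟩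
      rw [indicator_of_mem hk]
    · rw [indicator_of_notMem hp']
      refine tendsto_const_nhds.congr' ?_
      filter_upwards [hp.1, hp.2] with k h1 h2
      rw [indicator_of_notMem]
      exact fun hk => hp' ⟨⟨h1.1 hk.1.1, h2.1 hk.1.2⟩, hk.2⟩

/-- Replaces the first set by its limit while the kernels and the second set stay at level `k`;
uniform bounds on the kernels are enough, without any convergence of theirs. -/
lemma tendsto_setIntegral_far_sub (hn : 0 < n) (hs : 0 < s) (hε : 0 < ε) {Ks : ℕ → Eu n → ℝ}
    (hK : ∀ k, KernelBound s lam (Ks k)) (hν : ‖ν‖ = 1) (h : IsTest (Metric.ball z₀ ρ) ψ)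
    {A B : ℕ → Set (Eu n)} {A' : Set (Eu n)} (hA : ∀ k, MeasurableSet (A k))
    (hB : ∀ k, MeasurableSet (B k)) (hA' : MeasurableSet A')
    (hAc : ∀ᵐ x, ∀ᶠ k in atTop, (x ∈ A k ↔ x ∈ A')) :
    Tendsto (fun k => (∫ p in (A k ×ˢ B k) ∩ farSet n ε, firstVar (Ks k) ν ψ p.1 p.2) -
      ∫ p in (A' ×ˢ B k) ∩ farSet n ε, firstVar (Ks k) ν ψ p.1 p.2) atTop (𝓝 0) := by
  obtain ⟨L, hL0, hL⟩ := exists_norm_fderiv_le h.contDiff h.compact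
  have hlam := (hK 0).lam_nonneg hn
  have hm (k : ℕ) : MeasurableSet ((A k ×ˢ B k) ∩ farSet n ε) :=
    ((hA k).prod (hB k)).inter measurableSet_farSet
  have hm' (k : ℕ) : MeasurableSet ((A' ×ˢ B k) ∩ farSet n ε) :=
    (hA'.prod (hB k)).inter measurableSet_farSet
  have hint (k : ℕ) := integrableOn_firstVar_far hn hs hε (hK k) hν h
  have heq (k : ℕ) : (∫ p in (A k ×ˢ B k) ∩ farSet n ε, firstVar (Ks k) ν ψ p.1 p.2) -
      ∫ p in (A' ×ˢ B k) ∩ farSet n ε, firstVar (Ks k) ν ψ p.1 p.2 =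
      ∫ p, (((A k ×ˢ B k) ∩ farSet n ε).indicator (fun p => firstVar (Ks k) ν ψ p.1 p.2) p -
        ((A' ×ˢ B k) ∩ farSet n ε).indicator (fun p => firstVar (Ks k) ν ψ p.1 p.2) p) := by
    rw [integral_sub, integral_indicator (hm k), integral_indicator (hm' k)]
    · exact (integrable_indicator_iff (hm k)).2 ((hint k).mono_set inter_subset_right)
    · exact (integrable_indicator_iff (hm' k)).2 ((hint k).mono_set inter_subset_right)
  simp_rw [heq]
  rw [← integral_zero (Eu n × Eu n) ℝ (μ := volume)]
  have hb (S : Set (Eu n × Eu n)) (k : ℕ) (p : Eu n × Eu n) :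
      |(S ∩ farSet n ε).indicator (fun p => firstVar (Ks k) ν ψ p.1 p.2) p| ≤
        3 * lam * L * farBound n s ε ρ z₀ p := by
    by_cases hp : p ∈ S ∩ farSet n ε
    · rw [indicator_of_mem hp]
      exact abs_firstVar_le_farBound hn hε (hK k) hν h hL hp.2
    · rw [indicator_of_notMem hp, abs_zero]
      exact mul_nonneg (by positivity) (indicator_nonneg (fun _ _ => by positivity) _)
  refine tendsto_integral_of_dominated_convergence
    (fun p => 2 * (3 * lam * L * farBound n s ε ρ z₀ p)) (fun k => ?_)
    (((integrable_farBound hs hε ρ z₀).const_mul _).const_mul 2) ?_ ?_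
  · exact (((measurable_firstVar (hK k).measurable h.contDiff_one).indicator (hm k)).sub
      ((measurable_firstVar (hK k).measurable h.contDiff_one).indicator
      (hm' k))).aestronglyMeasurable
  · refine fun k => .of_forall fun p => ?_
    refine (norm_sub_le _ _).trans ?_
    have h1 := hb (A k ×ˢ B k) k p
    have h2 := hb (A' ×ˢ B k) k p
    rw [Real.norm_eq_abs, Real.norm_eq_abs]
    linarith
  · filter_upwards [ae_prod_of_ae hAc (.of_forall fun _ => trivial)] with p hp
    refine tendsto_const_nhds.congr' ?_
    filter_upwards [hp.1] with k h1
    have : p ∈ (A k ×ˢ B k) ∩ farSet n ε ↔ p ∈ (A' ×ˢ B k) ∩ farSet n ε := by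
      simp only [mem_inter_iff, mem_prod, h1]
    by_cases hp' : p ∈ (A k ×ˢ B k) ∩ farSet n ε
    · rw [indicator_of_mem hp', indicator_of_mem (this.1 hp'), sub_self]
    · rw [indicator_of_notMem hp', indicator_of_notMem (fun hc => hp' (this.2 hc)), sub_self]

end

/-! ### The rescaled Euler–Lagrange equation along a blow-up sequence -/

/-- A radial smooth bump at `z₀`, equal to `1` on the ball of radius `ρ / 2` and supported in the
ball of radius `ρ`. -/
noncomputable def bump (z₀ : Eu n) (ρ : ℝ) (x : Eu n) : ℝ :=
  Real.smoothTransition (2 - ‖x - z₀‖ ^ 2 / (ρ / 2) ^ 2)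

section bump

variable {z₀ : Eu n} {ρ : ℝ}

lemma bump_nonneg (x : Eu n) : 0 ≤ bump z₀ ρ x := Real.smoothTransition.nonneg _

lemma bump_eq_one (hρ : 0 < ρ) {x : Eu n} (hx : x ∈ Metric.ball z₀ (ρ / 2)) :
    bump z₀ ρ x = 1 := by
  refine Real.smoothTransition.one_of_one_le ?_
  have h1 : ‖x - z₀‖ ≤ ρ / 2 := (mem_ball_iff_norm.1 hx).le
  have h2 : ‖x - z₀‖ ^ 2 / (ρ / 2) ^ 2 ≤ 1 := by
    rw [div_le_one (by positivity)]; gcongr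
  linarith

/-- The transition ends at radius `ρ / √2`, which is smaller than `3ρ / 4`. -/
lemma tsupport_bump_subset (hρ : 0 < ρ) :
    tsupport (bump z₀ ρ) ⊆ Metric.closedBall z₀ (3 * ρ / 4) := by
  refine closure_minimal (fun x hx => ?_) Metric.isClosed_closedBall
  by_contra hcon
  rw [mem_closedBall_iff_norm, not_le] at hcon
  refine hx (Real.smoothTransition.zero_of_nonpos ?_)
  have h2 : 2 ≤ ‖x - z₀‖ ^ 2 / (ρ / 2) ^ 2 := by
    rw [le_div_iff₀ (by positivity)]
    nlinarith
  linarith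

lemma isTest_bump (hρ : 0 < ρ) : IsTest (Metric.ball z₀ ρ) (bump z₀ ρ) where
  contDiff := by
    have h1 : ContDiff ℝ (⊤ : ℕ∞) fun x : Eu n => 2 - ‖x - z₀‖ ^ 2 / (ρ / 2) ^ 2 :=
      contDiff_const.sub (((contDiff_id.sub contDiff_const).norm_sq ℝ).div_const _)
    exact Real.smoothTransition.contDiff.comp h1
  compact := (isCompact_closedBall z₀ (3 * ρ / 4)).of_isClosed_subset (isClosed_tsupport _)
    (tsupport_bump_subset hρ)
  subset := (tsupport_bump_subset hρ).trans (Metric.closedBall_subset_ball (by linarith))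

end bump

/-- The standing assumptions on the functional and on its critical set. -/
structure CriticalSetting (n : ℕ) (s₁ s₂ lam σ : ℝ) (ϱ : ℝ≥0∞) (K₁ K₂ g : Eu n → ℝ)
    (Ω E : Set (Eu n)) : Prop where
  n_pos : 0 < n
  hs₁ : s₁ ∈ Ioo (0 : ℝ) 1
  hs₂ : s₂ ∈ Ioo (0 : ℝ) 1
  lam_pos : 0 < lam
  ϱ_pos : 0 < ϱ
  hK₁ : IsKernelC 2 s₁ lam ϱ K₁
  hK₂ : IsKernelC 2 s₂ lam ϱ K₂
  hg : ContDiff ℝ 1 g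
  hΩo : IsOpen Ω
  hΩb : Bornology.IsBounded Ω
  hE : IsCritical K₁ K₂ σ g Ω E

/-- `(Ω - c_k) / r_k → Ω'` and `(E - c_k) / r_k → E'` pointwise almost everywhere, with a uniform
perimeter bound for the rescalings of `E` in a ball contained in those of `Ω`. -/
structure IsBlowUp (Ω E Ω' E' : Set (Eu n)) (c : ℕ → Eu n) (r : ℕ → ℝ) (z₀ : Eu n) (ρ C : ℝ) :
    Prop where
  r_pos : ∀ k, 0 < r k
  r_tendsto : Tendsto r atTop (𝓝 0)
  c_bdd : ∃ R, ∀ k, ‖c k‖ ≤ R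
  ρ_pos : 0 < ρ
  C_nonneg : 0 ≤ C
  measΩ' : MeasurableSet Ω'
  measE' : MeasurableSet E'
  mem_Ω : ∀ᵐ y, ∀ᶠ k in atTop, (y ∈ zoom Ω (c k) (r k) ↔ y ∈ Ω')
  mem_E : ∀ᵐ y, ∀ᶠ k in atTop, (y ∈ zoom E (c k) (r k) ↔ y ∈ E')
  ball_subset : ∀ k, Metric.ball z₀ (2 * ρ) ⊆ zoom Ω (c k) (r k)
  perimeter : ∀ k (v : Eu n), volume {x | x ∈ Metric.ball z₀ (2 * ρ) ∧
    x + v ∈ Metric.ball z₀ (2 * ρ) ∧ x ∈ zoom E (c k) (r k) ∧ x + v ∉ zoom E (c k) (r k)} ≤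
      ENNReal.ofReal (C * ‖v‖)

/-! ### The rescaled equation and its limit -/

section

variable {s₁ s₂ lam σ : ℝ} {ϱ : ℝ≥0∞} {K₁ K₂ g : Eu n → ℝ} {Ω E Ω' E' : Set (Eu n)}
  {c : ℕ → Eu n} {r : ℕ → ℝ} {ν z₀ : Eu n} {ρ C L : ℝ} {ψ : Eu n → ℝ}

/-- The equation for the transplanted test function is divided by `r^(n-1-s₁)`, the scale of the
first interaction. The second interaction keeps `r^(s₁-s₂)`, and the volume terms, of order
`r^(n-1)`, keep `r^s₁`. -/
lemma CriticalSetting.rescaled_eq (hC : CriticalSetting n s₁ s₂ lam σ ϱ K₁ K₂ g Ω E)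
    {m : ℝ} (hm : ∀ ξ, IsTest Ω ξ → energyVar K₁ K₂ σ g Ω E ν ξ = m * ∫ x in E, fderiv ℝ ξ x ν)
    {S : Set (Eu n)} (h : IsTest S ψ) {c : Eu n} {r : ℝ} (hr : 0 < r)
    (hS : S ⊆ zoom Ω c r) :
    (∫ p in zoom E c r ×ˢ zoom (Eᶜ ∩ Ω) c r, firstVar (scaledKernel s₁ r K₁) ν ψ p.1 p.2) +
      σ * r ^ (s₁ - s₂) *
        (∫ p in zoom E c r ×ˢ zoom Ωᶜ c r, firstVar (scaledKernel s₂ r K₂) ν ψ p.1 p.2) =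
    r ^ s₁ * (m * (∫ y in zoom E c r, fderiv ℝ ψ y ν) -
      ∫ y in zoom E c r, (r * fderiv ℝ g (c + r • y) ν * ψ y +
        g (c + r • y) * fderiv ℝ ψ y ν)) := by
  have hEm := hC.hE.measurableSet
  have hΩm := hC.hΩo.measurableSet
  have h0 := hm _ (isTest_testAt h hr hS)
  rw [energyVar, integral_firstVar_zoom hC.hK₁.kernelBound hr h.differentiable c ν hEm
      (hEm.compl.inter hΩm) (disjoint_compl_right.mono_right inter_subset_left),
    integral_firstVar_zoom hC.hK₂.kernelBound hr h.differentiable c ν hEm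
      hΩm.compl (disjoint_compl_right.mono_left hC.hE.subset),
    setIntegral_zoom hEm c hr, setIntegral_zoom hEm c hr] at h0
  simp only [fderiv_testAt h.differentiable c hr, testAt_apply ψ c hr] at h0
  have h1 : ∫ y in zoom E c r, (r * fderiv ℝ g (c + r • y) ν * ψ y +
        g (c + r • y) * fderiv ℝ ψ y ν) = r * ∫ y in zoom E c r,
        (fderiv ℝ g (c + r • y) ν * ψ y + g (c + r • y) * (r⁻¹ * fderiv ℝ ψ y ν)) := by
    rw [← integral_const_mul]
    refine integral_congr_ae (.of_forall fun y => ?_)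
    field_simp
  rw [integral_const_mul] at h0
  rw [h1]
  have e1 : r ^ ((n : ℝ) - 1 - s₂) = r ^ ((n : ℝ) - 1 - s₁) * r ^ (s₁ - s₂) := by
    rw [← Real.rpow_add hr]; congr 1; ring
  have e2 : r ^ (n : ℝ) = r ^ ((n : ℝ) - 1 - s₁) * r ^ s₁ * r := by
    rw [← Real.rpow_add hr, ← Real.rpow_add_one hr.ne']; congr 1; ring
  rw [e1, e2] at h0
  have hp : r ^ ((n : ℝ) - 1 - s₁) ≠ 0 := (Real.rpow_pos_of_pos hr _).ne'
  refine mul_left_cancel₀ hp ?_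
  have hri : r * r⁻¹ = 1 := mul_inv_cancel₀ hr.ne'
  linear_combination h0 + r ^ ((n : ℝ) - 1 - s₁) * r ^ s₁ * m *
    (∫ y in zoom E c r, fderiv ℝ ψ y ν) * hri

lemma IsBlowUp.tendsto_setIntegral_fderiv (hB : IsBlowUp Ω E Ω' E' c r z₀ ρ C)
    (hEm : MeasurableSet E) {S : Set (Eu n)} (h : IsTest S ψ) :
    Tendsto (fun k => ∫ y in zoom E (c k) (r k), fderiv ℝ ψ y ν) atTop
      (𝓝 (∫ y in E', fderiv ℝ ψ y ν)) := by
  have hc : Continuous fun y => fderiv ℝ ψ y ν :=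
    (h.contDiff_one.continuous_fderiv one_ne_zero).clm_apply continuous_const
  have hcs : HasCompactSupport fun y => fderiv ℝ ψ y ν := h.compact.fderiv_apply (𝕜 := ℝ) ν
  have hi := hc.integrable_of_hasCompactSupport (μ := volume) hcs
  have hm (k : ℕ) := measurableSet_zoom hEm (c k) (r k)
  simp_rw [← integral_indicator (hm _)]
  rw [← integral_indicator hB.measE']
  refine tendsto_integral_of_dominated_convergence (fun y => ‖fderiv ℝ ψ y ν‖)
    (fun k => (hc.measurable.indicator (hm k)).aestronglyMeasurable) hi.norm
    (fun k => .of_forall fun y => norm_indicator_le_norm_self _ _) ?_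
  filter_upwards [hB.mem_E] with y hy
  refine tendsto_const_nhds.congr' ?_
  filter_upwards [hy] with k hk
  by_cases hy' : y ∈ E'
  · rw [indicator_of_mem hy', indicator_of_mem (hk.2 hy')]
  · rw [indicator_of_notMem hy', indicator_of_notMem fun hc => hy' (hk.1 hc)]

/-- The right-hand side of the rescaled equation is `r^s₁` times a bounded quantity: the multiplier
is the same for all `k`, and `g` is only evaluated in a fixed ball. -/
lemma IsBlowUp.tendsto_rescaled (hB : IsBlowUp Ω E Ω' E' c r z₀ ρ C)
    (hC : CriticalSetting n s₁ s₂ lam σ ϱ K₁ K₂ g Ω E) (hν : ‖ν‖ = 1)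
    {w : Eu n → ℝ} (hw : IsTest Ω w) (hw0 : ∫ x in E, fderiv ℝ w x ν ≠ 0)
    (h : IsTest (Metric.ball z₀ ρ) ψ) :
    Tendsto (fun k =>
      (∫ p in zoom E (c k) (r k) ×ˢ zoom (Eᶜ ∩ Ω) (c k) (r k),
        firstVar (scaledKernel s₁ (r k) K₁) ν ψ p.1 p.2) +
      σ * (r k) ^ (s₁ - s₂) *
        (∫ p in zoom E (c k) (r k) ×ˢ zoom Ωᶜ (c k) (r k),
          firstVar (scaledKernel s₂ (r k) K₂) ν ψ p.1 p.2)) atTop (𝓝 0) := by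
  have hEm := hC.hE.measurableSet
  obtain ⟨m, hm⟩ := hC.hE.exists_multiplier hC.n_pos hC.hs₁.1 hC.hs₂.1 hC.lam_pos hC.ϱ_pos hC.hK₁
    hC.hK₂ hC.hg hC.hΩo hC.hΩb hν hw hw0
  have hsub (k : ℕ) : Metric.ball z₀ ρ ⊆ zoom Ω (c k) (r k) :=
    (Metric.ball_subset_ball (by linarith [hB.ρ_pos])).trans (hB.ball_subset k)
  simp_rw [fun k => hC.rescaled_eq hm h (hB.r_pos k) (hsub k)]
  have hr1 : Tendsto (fun k => (r k) ^ s₁) atTop (𝓝 0) := by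
    have := hB.r_tendsto.rpow_const (p := s₁) (.inr hC.hs₁.1.le)
    rwa [Real.zero_rpow hC.hs₁.1.ne'] at this
  refine hr1.zero_mul_isBoundedUnder_le ?_
  have hW := (hB.tendsto_setIntegral_fderiv (ν := ν) hEm h).const_mul m
  have hWb := hW.norm.isBoundedUnder_le
  obtain ⟨L, hL0, hL⟩ := exists_norm_fderiv_le h.contDiff h.compact
  obtain ⟨P, hP⟩ := h.compact.exists_bound_of_continuous h.contDiff_one.continuous
  have hP0 : 0 ≤ P := (norm_nonneg _).trans (hP 0)
  obtain ⟨R, hR⟩ := hB.c_bdd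
  obtain ⟨M, hM⟩ := (isCompact_closedBall (0 : Eu n) (R + (‖z₀‖ + ρ))).exists_bound_of_continuousOn
    hC.hg.continuous.continuousOn
  obtain ⟨M', hM'⟩ := (isCompact_closedBall (0 : Eu n) (R + (‖z₀‖ + ρ))).exists_bound_of_continuousOn
    (hC.hg.continuous_fderiv one_ne_zero).continuousOn
  have hr2 : ∀ᶠ k in atTop, r k ≤ 1 := hB.r_tendsto.eventually_le_const (by norm_num)
  have hG : ∀ᶠ k in atTop, ‖∫ y in zoom E (c k) (r k), (r k * fderiv ℝ g (c k + r k • y) ν * ψ y +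
        g (c k + r k • y) * fderiv ℝ ψ y ν)‖ ≤
        ∫ y, (Metric.ball z₀ ρ).indicator (fun _ => M' * P + M * L) y := by
    filter_upwards [hr2] with k hk
    have hint : Integrable ((Metric.ball z₀ ρ).indicator (fun _ : Eu n => M' * P + M * L)) :=
      (integrable_indicator_iff Metric.isOpen_ball.measurableSet).2
        (integrableOn_const Metric.isBounded_ball.measure_lt_top.ne)
    have hball : ∀ y ∈ Metric.ball z₀ ρ, c k + r k • y ∈ Metric.closedBall (0 : Eu n) (R + (‖z₀‖ + ρ)) := by
      intro y hy
      rw [mem_closedBall_zero_iff]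
      have h1 : ‖y‖ ≤ ‖z₀‖ + ρ := by
        have := norm_add_le z₀ (y - z₀)
        rw [add_sub_cancel] at this
        linarith [mem_ball_iff_norm.1 hy]
      refine (norm_add_le _ _).trans (add_le_add (hR k) ?_)
      rw [norm_smul, Real.norm_of_nonneg (hB.r_pos k).le]
      exact (mul_le_of_le_one_left (norm_nonneg _) hk).trans h1
    have hnn : ∀ y, 0 ≤ (Metric.ball z₀ ρ).indicator (fun _ : Eu n => M' * P + M * L) y := by
      refine fun y => indicator_nonneg (fun x hx => ?_) y
      have h1 := (norm_nonneg _).trans (hM _ (hball x hx))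
      have h2 := (norm_nonneg _).trans (hM' _ (hball x hx))
      positivity
    refine (norm_integral_le_of_norm_le hint.integrableOn (.of_forall fun y => ?_)).trans
      (setIntegral_le_integral hint (.of_forall hnn))
    by_cases hy : y ∈ Metric.ball z₀ ρ
    · rw [indicator_of_mem hy]
      have hb := hball y hy
      have hM0 := (norm_nonneg _).trans (hM _ hb)
      have hM0' := (norm_nonneg _).trans (hM' _ hb)
      have h1 : ‖fderiv ℝ g (c k + r k • y) ν‖ ≤ M' := by
        have := (fderiv ℝ g (c k + r k • y)).le_opNorm ν
        rw [hν, mul_one] at this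
        exact this.trans (hM' _ hb)
      refine (norm_add_le _ _).trans (add_le_add ?_ ?_)
      · rw [norm_mul, norm_mul, Real.norm_of_nonneg (hB.r_pos k).le]
        exact mul_le_mul ((mul_le_of_le_one_left (norm_nonneg _) hk).trans h1) (hP y)
          (norm_nonneg _) hM0'
      · rw [norm_mul]
        exact mul_le_mul (hM _ hb) (abs_fderiv_apply_le hL hν y) (norm_nonneg _) hM0
    · have h1 : y ∉ tsupport ψ := fun hc => hy (h.subset hc)
      have h2 : y ∉ tsupport (fderiv ℝ ψ) := fun hc => h1 (tsupport_fderiv_subset ℝ hc)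
      rw [indicator_of_notMem hy, image_eq_zero_of_notMem_tsupport h1,
        image_eq_zero_of_notMem_tsupport h2]
      simp
  have hGb := isBoundedUnder_of_eventually_le hG
  obtain ⟨b1, hb1⟩ := hWb
  obtain ⟨b2, hb2⟩ := hGb
  rw [eventually_map] at hb1 hb2
  refine ⟨b1 + b2, ?_⟩
  rw [eventually_map]
  filter_upwards [hb1, hb2] with k h1 h2
  exact (norm_sub_le _ _).trans (add_le_add h1 h2)

lemma IsBlowUp.setIntegral_near_far (hB : IsBlowUp Ω E Ω' E' c r z₀ ρ C) (hn : 0 < n)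
    {s : ℝ} (hs : s ∈ Ioo (0 : ℝ) 1) {K : Eu n → ℝ} (hK : KernelBound s lam K)
    (hEm : MeasurableSet E) (hΩm : MeasurableSet Ω) (hν : ‖ν‖ = 1)
    (h : IsTest (Metric.ball z₀ ρ) ψ) (hL : ∀ x, ‖fderiv ℝ ψ x‖ ≤ L) {ε : ℝ} (hε : 0 < ε)
    (hερ : ε ≤ ρ) (k : ℕ) :
    |(∫ p in zoom E (c k) (r k) ×ˢ zoom (Eᶜ ∩ Ω) (c k) (r k), firstVar K ν ψ p.1 p.2) -
      ∫ p in (zoom E (c k) (r k) ×ˢ zoom (Eᶜ ∩ Ω) (c k) (r k)) ∩ farSet n ε,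
        firstVar K ν ψ p.1 p.2| ≤
      3 * lam * L * C * ∫ v in Metric.ball (0 : Eu n) ε, ‖v‖ ^ (-(n + s) + 1) := by
  have hA := measurableSet_zoom hEm (c k) (r k)
  have hB' := measurableSet_zoom (hEm.compl.inter hΩm) (c k) (r k)
  have hdisj : Disjoint (zoom E (c k) (r k)) (zoom (Eᶜ ∩ Ω) (c k) (r k)) :=
    disjoint_left.2 fun x hx hx' => hx'.1 hx
  obtain ⟨hint, hle⟩ := integrableOn_and_abs_setIntegral_near_le hn hs.2 hK hν h hL hA hB' hdisj
    hB.C_nonneg (fun v => by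
      refine le_trans (measure_mono fun x hx => ?_) (hB.perimeter k v)
      exact ⟨hx.1, hx.2.1, hx.2.2.1, fun hc => hx.2.2.2.1 hc⟩) hερ
  have hfar : IntegrableOn (fun p : Eu n × Eu n => firstVar K ν ψ p.1 p.2)
      ((zoom E (c k) (r k) ×ˢ zoom (Eᶜ ∩ Ω) (c k) (r k)) ∩ farSet n ε) :=
    (integrableOn_firstVar_far hn hs.1 hε hK hν h).mono_set inter_subset_right
  have hall := hfar.union hint
  rw [inter_union_compl] at hall
  rw [← integral_inter_add_sdiff measurableSet_farSet hall, add_sub_cancel_left, sdiff_eq]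
  exact hle

/-- Points of the rescaled complement of the container are far from the support of `ψ`. -/
lemma setIntegral_eq_far (h : IsTest (Metric.ball z₀ ρ) ψ) {A D : Set (Eu n)}
    (hA : MeasurableSet A) (hD : MeasurableSet D)
    (hρ : 0 < ρ) (hDb : Disjoint (Metric.ball z₀ (2 * ρ)) D) {ε : ℝ} (hερ : ε ≤ ρ)
    (F : Eu n → ℝ) :
    ∫ p in (A ×ˢ D) ∩ farSet n ε, firstVar F ν ψ p.1 p.2 =
      ∫ p in A ×ˢ D, firstVar F ν ψ p.1 p.2 := by
  refine (setIntegral_eq_of_subset_of_forall_sdiff_eq_zero (hA.prod hD) inter_subset_left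
    fun p hp => ?_).symm
  have hp2 : p.2 ∉ Metric.ball z₀ (2 * ρ) := fun hc => disjoint_left.1 hDb hc hp.1.2
  have hlt : ‖p.1 - p.2‖ < ε := not_le.1 fun hc => hp.2 ⟨hp.1, hc⟩
  refine firstVar_eq_zero h F ν (fun hc => hp2 ?_)
    (fun hc => hp2 (Metric.ball_subset_ball (by linarith) hc))
  rw [mem_ball_iff_norm] at hc ⊢
  have := norm_sub_le (p.1 - z₀) (p.1 - p.2)
  rw [sub_sub_sub_cancel_left] at this
  linarith

end

/-! ### Flux of the kernels and exclusion of dominant adhesion -/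

section

variable {s lam ρ ε : ℝ} {K ψ : Eu n → ℝ} {ν z₀ : Eu n} {E' D : Set (Eu n)}

lemma setIntegral_eq_halfSpace (hE'm : MeasurableSet E')
    (hE' : ∀ x ∈ Metric.ball z₀ (2 * ρ), x ∈ E' ↔ inner ℝ ν x < 0) {f : Eu n → ℝ}
    (hf : ∀ x ∉ Metric.ball z₀ (2 * ρ), f x = 0) :
    ∫ x in E', f x = ∫ x in {x | inner ℝ ν x < 0}, f x := by
  rw [← integral_indicator hE'm, ← integral_indicator
    (measurableSet_lt (measurable_inner_left ν) measurable_const)]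
  congr 1; funext x
  by_cases hx : x ∈ Metric.ball z₀ (2 * ρ)
  · by_cases hx' : x ∈ E'
    · have h1 : x ∈ {x | inner ℝ ν x < 0} := (hE' x hx).1 hx'
      rw [indicator_of_mem hx', indicator_of_mem h1]
    · have h1 : x ∉ {x | inner ℝ ν x < 0} := fun hc => hx' ((hE' x hx).2 hc)
      rw [indicator_of_notMem hx', indicator_of_notMem h1]
  · simp [indicator, hf x hx]

lemma contDiff_kernel_mul (hK : KernelBound s lam K) {S : Set (Eu n)} (h : IsTest S ψ) {y : Eu n}
    (hy : y ∉ tsupport ψ) : ContDiff ℝ 1 fun x => K (x - y) * ψ x := by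
  refine contDiff_iff_contDiffAt.2 fun x => ?_
  by_cases hx : x ∈ tsupport ψ
  · have hne : x - y ≠ 0 := sub_ne_zero.2 fun heq => hy (heq ▸ hx)
    have h1 : ContDiffAt ℝ 1 K (x - y) :=
      hK.contDiffOn.contDiffAt (isOpen_compl_singleton.mem_nhds hne)
    exact (h1.comp x (contDiffAt_id.sub contDiffAt_const)).mul h.contDiff_one.contDiffAt
  · refine (contDiffAt_const (c := (0 : ℝ))).congr_of_eventuallyEq ?_
    filter_upwards [(notMem_tsupport_iff_eventuallyEq.1 hx)] with z hz
    simp [hz]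

/-- When `y` is off the support of `ψ`, the terms in `ψ y` drop out and the density is an exact
derivative in `x`. Its integral over a half-space is therefore a flux through the boundary plane. -/
lemma fderiv_kernel_mul (hK : KernelBound s lam K) {S : Set (Eu n)} (h : IsTest S ψ) {y : Eu n}
    (hy : y ∉ tsupport ψ) (x : Eu n) :
    fderiv ℝ (fun x => K (x - y) * ψ x) x ν = firstVar K ν ψ x y := by
  by_cases hx : x ∈ tsupport ψ
  · have hne : x - y ≠ 0 := sub_ne_zero.2 fun heq => hy (heq ▸ hx)
    have h1 : HasFDerivAt (fun x => K (x - y)) (fderiv ℝ K (x - y)) x :=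
      (hK.differentiableAt hne).hasFDerivAt.comp x ((hasFDerivAt_id x).sub_const y)
    have h2 := (h1.mul (h.differentiable x).hasFDerivAt).fderiv
    have h3 : fderiv ℝ (fun x => K (x - y) * ψ x) x = _ := h2
    have h4 : y ∉ tsupport (fderiv ℝ ψ) := fun hc => hy (tsupport_fderiv_subset ℝ hc)
    rw [h3, firstVar, image_eq_zero_of_notMem_tsupport hy, image_eq_zero_of_notMem_tsupport h4]
    simp
    ring
  · have h1 : (fun x => K (x - y) * ψ x) =ᶠ[𝓝 x] fun _ => (0 : ℝ) := by
      filter_upwards [(notMem_tsupport_iff_eventuallyEq.1 hx)] with z hz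
      simp [hz]
    rw [h1.fderiv_eq, firstVar_eq_zero (S := tsupport ψ) ⟨h.contDiff, h.compact, subset_rfl⟩ K ν hx hy]
    simp

/-- Lower bound for the interaction between the flux through a hyperplane and a far set. -/
lemma exists_flux_interaction_ge (hn : 0 < n) (hs : 0 < s) (hν : ‖ν‖ = 1)
    (hz₀ : inner ℝ ν z₀ = 0) (hρ : 0 < ρ) :
    ∃ c₀ : ℝ, 0 < c₀ ∧ ∀ (lam ε M κ : ℝ) (K : Eu n → ℝ) (E' D : Set (Eu n)),
      KernelBound s lam K → (∀ z, z ≠ 0 → 0 ≤ K z) → 0 < ε → ε ≤ ρ → 0 ≤ κ →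
      MeasurableSet E' → MeasurableSet D → Disjoint (Metric.ball z₀ (2 * ρ)) D →
      (∀ x ∈ Metric.ball z₀ (2 * ρ), x ∈ E' ↔ inner ℝ ν x < 0) →
      (∀ z, z ≠ 0 → ‖z‖ ≤ ‖z₀‖ + ρ + M → κ ≤ K z) →
      c₀ * κ * volume.real (D ∩ Metric.ball 0 M) ≤
        ∫ p in (E' ×ˢ D) ∩ farSet n ε, firstVar K ν (bump z₀ ρ) p.1 p.2 := by
  obtain ⟨c₀, hc₀, hflux⟩ := exists_flux_ge hν hz₀ (half_pos hρ)
  refine ⟨c₀, hc₀, fun lam ε M κ K E' D hK hnn hε hερ hκ hE'm hDm hdisj hE' hKκ => ?_⟩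
  have h : IsTest (Metric.ball z₀ ρ) (bump z₀ ρ) := isTest_bump hρ
  have hρ2 : Metric.ball z₀ ρ ⊆ Metric.ball z₀ (2 * ρ) := Metric.ball_subset_ball (by linarith)
  have hm : MeasurableSet ((E' ×ˢ D) ∩ farSet n ε) := (hE'm.prod hDm).inter measurableSet_farSet
  set f : Eu n × Eu n → ℝ := ((E' ×ˢ D) ∩ farSet n ε).indicator
    fun p => firstVar K ν (bump z₀ ρ) p.1 p.2 with hf
  have hint : Integrable f := (integrable_indicator_iff hm).2
    ((integrableOn_firstVar_far hn hs hε hK hν h).mono_set inter_subset_right)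
  have hyD : ∀ y ∈ D, y ∉ Metric.ball z₀ (2 * ρ) := fun y hy hc => disjoint_left.1 hdisj hc hy
  -- Points of the ball of radius `ρ` are at distance at least `ρ ≥ ε` from `y ∈ D`, so the
  -- truncation is not felt and the inner integral is the whole flux.
  have hinner : ∀ y ∈ D, ∫ x, f (x, y) =
      ∫ x in {x | inner ℝ ν x < 0}, fderiv ℝ (fun x => K (x - y) * bump z₀ ρ x) x ν := by
    intro y hy
    have hyS : y ∉ tsupport (bump z₀ ρ) := fun hc => hyD y hy (hρ2 (h.subset hc))
    simp_rw [fderiv_kernel_mul hK h hyS]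
    rw [← setIntegral_eq_halfSpace hE'm hE', ← integral_indicator hE'm]
    · congr 1; funext x
      by_cases hx : x ∈ Metric.ball z₀ ρ
      · have hfar : ε ≤ ‖x - y‖ := by
          have h1 := mem_ball_iff_norm.1 hx
          have h2 : 2 * ρ ≤ ‖y - z₀‖ := not_lt.1 fun hc => hyD y hy (mem_ball_iff_norm.2 hc)
          have h3 := norm_sub_le (x - z₀) (x - y)
          rw [sub_sub_sub_cancel_left] at h3
          linarith
        by_cases hxE : x ∈ E'
        · have hmem : (x, y) ∈ (E' ×ˢ D) ∩ farSet n ε := ⟨⟨hxE, hy⟩, hfar⟩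
          rw [hf, indicator_of_mem hmem, indicator_of_mem hxE]
        · have hmem : (x, y) ∉ (E' ×ˢ D) ∩ farSet n ε := fun hc => hxE hc.1.1
          rw [hf, indicator_of_notMem hmem, indicator_of_notMem hxE]
      · have h0 : firstVar K ν (bump z₀ ρ) x y = 0 :=
          firstVar_eq_zero h K ν hx fun hc => hyD y hy (hρ2 hc)
        simp [hf, indicator, h0]
    · exact fun x hx => firstVar_eq_zero h K ν (fun hc => hx (hρ2 hc)) fun hc => hyD y hy (hρ2 hc)
  have hu : ∀ y ∈ D, ∀ m : ℝ, 0 ≤ m → (∀ x ∈ Metric.ball z₀ (ρ / 2), m ≤ K (x - y)) →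
      c₀ * m ≤ ∫ x, f (x, y) := by
    intro y hy m hm0 hmK
    have hyS : y ∉ tsupport (bump z₀ ρ) := fun hc => hyD y hy (hρ2 (h.subset hc))
    rw [hinner y hy]
    refine hflux _ m (contDiff_kernel_mul hK h hyS) (h.compact.mul_left) (fun x => ?_) hm0
      fun x hx => ?_
    · by_cases hx : x = y
      · rw [hx, image_eq_zero_of_notMem_tsupport hyS, mul_zero]
      · exact mul_nonneg (hnn _ (sub_ne_zero.2 hx)) (bump_nonneg x)
    · rw [bump_eq_one hρ hx, mul_one]
      exact hmK x hx
  rw [← integral_indicator hm, Measure.volume_eq_prod, integral_prod_symm _ hint]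
  have hbM : MeasurableSet (D ∩ Metric.ball (0 : Eu n) M) :=
    hDm.inter Metric.isOpen_ball.measurableSet
  have hfin : volume (D ∩ Metric.ball (0 : Eu n) M) ≠ ∞ :=
    ((measure_mono inter_subset_right).trans_lt Metric.isBounded_ball.measure_lt_top).ne
  have hbound : ∀ y, (D ∩ Metric.ball (0 : Eu n) M).indicator (fun _ => c₀ * κ) y ≤
      ∫ x, f (x, y) := by
    intro y
    by_cases hy : y ∈ D
    · by_cases hyM : y ∈ Metric.ball (0 : Eu n) M
      · have hyDM : y ∈ D ∩ Metric.ball (0 : Eu n) M := ⟨hy, hyM⟩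
        rw [indicator_of_mem hyDM]
        refine hu y hy κ hκ fun x hx => hKκ _ ?_ ?_
        · rw [sub_ne_zero]
          rintro rfl
          exact hyD x hy (Metric.ball_subset_ball (by linarith) hx)
        · have h1 := mem_ball_iff_norm.1 hx
          have h2 := mem_ball_zero_iff.1 hyM
          have h3 : x - y = z₀ + (x - z₀) - y := by abel
          rw [h3]
          refine (norm_sub_le _ _).trans ?_
          have h4 := norm_add_le z₀ (x - z₀)
          linarith
      · rw [indicator_of_notMem fun hc => hyM hc.2]
        -- Far points of `D` contribute with a sign only, which is the flux bound with `m = 0`.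
        have := hu y hy 0 le_rfl fun x hx => hnn _ (by
          rw [sub_ne_zero]
          rintro rfl
          exact hyD x hy (Metric.ball_subset_ball (by linarith) hx))
        simpa using this
    · rw [indicator_of_notMem fun hc => hy hc.1]
      refine le_of_eq ?_
      rw [← integral_zero (Eu n) ℝ (μ := volume)]
      congr 1; funext x
      have hmem : (x, y) ∉ (E' ×ˢ D) ∩ farSet n ε := fun hc => hy hc.1.2
      rw [hf, indicator_of_notMem hmem]
  have hmono := integral_mono ((integrable_indicator_iff hbM).2 (integrableOn_const hfin))
    hint.integral_prod_right hbound
  rw [integral_indicator hbM, setIntegral_const, smul_eq_mul, mul_comm] at hmono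
  exact hmono

end

/-! ### Exclusion of dominant adhesion -/

section

variable {s₁ s₂ lam σ : ℝ} {ϱ : ℝ≥0∞} {K₁ K₂ g : Eu n → ℝ} {Ω E Ω' E' : Set (Eu n)}
  {c : ℕ → Eu n} {r : ℕ → ℝ} {ν z₀ : Eu n} {ρ C : ℝ}

/-- The volume of `E` is not stationary. -/
lemma IsBlowUp.exists_test_ne_zero (hB : IsBlowUp Ω E Ω' E' c r z₀ ρ C) (hEm : MeasurableSet E)
    (hν : ‖ν‖ = 1) (hz₀ : inner ℝ ν z₀ = 0)
    (hE' : ∀ x ∈ Metric.ball z₀ (2 * ρ), x ∈ E' ↔ inner ℝ ν x < 0) :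
    ∃ w, IsTest Ω w ∧ ∫ x in E, fderiv ℝ w x ν ≠ 0 := by
  have hρ := hB.ρ_pos
  have h : IsTest (Metric.ball z₀ ρ) (bump z₀ ρ) := isTest_bump hρ
  have hρ2 : Metric.ball z₀ ρ ⊆ Metric.ball z₀ (2 * ρ) := Metric.ball_subset_ball (by linarith)
  obtain ⟨c₀, hc₀, hflux⟩ := exists_flux_ge hν hz₀ (half_pos hρ)
  have h1 := hflux (bump z₀ ρ) 1 h.contDiff_one h.compact bump_nonneg zero_le_one
    fun x hx => (bump_eq_one hρ hx).ge
  rw [← setIntegral_eq_halfSpace hB.measE' hE'] at h1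
  swap
  · intro x hx
    have h2 : x ∉ tsupport (fderiv ℝ (bump z₀ ρ)) := fun hc =>
      hx (hρ2 (h.subset (tsupport_fderiv_subset ℝ hc)))
    rw [image_eq_zero_of_notMem_tsupport h2]; simp
  have h2 := hB.tendsto_setIntegral_fderiv (ν := ν) hEm h
  obtain ⟨k, hk⟩ := (h2.eventually_const_lt (by linarith : 0 < ∫ y in E', fderiv ℝ (bump z₀ ρ) y ν)).exists
  refine ⟨testAt (bump z₀ ρ) (c k) (r k), isTest_testAt h (hB.r_pos k)
    (hρ2.trans (hB.ball_subset k)), ?_⟩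
  rw [setIntegral_zoom hEm (c k) (hB.r_pos k)]
  simp only [fderiv_testAt h.differentiable (c k) (hB.r_pos k)]
  rw [integral_const_mul]
  have h3 := hB.r_pos k
  have h4 := Real.rpow_pos_of_pos h3 (n : ℝ)
  positivity

/-- Dominant adhesion is incompatible with a nontrivial blow-up. -/
theorem IsBlowUp.false_of_adhesion_dominant (hB : IsBlowUp Ω E Ω' E' c r z₀ ρ C)
    (hC : CriticalSetting n s₁ s₂ lam σ ϱ K₁ K₂ g Ω E) (hν : ‖ν‖ = 1)
    (hz₀ : inner ℝ ν z₀ = 0)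
    (hE' : ∀ x ∈ Metric.ball z₀ (2 * ρ), x ∈ E' ↔ inner ℝ ν x < 0)
    {M : ℝ} (hM : 0 < volume (Ω'ᶜ ∩ Metric.ball 0 M)) (hs : s₁ < s₂) (hσ : σ ≠ 0) : False := by
  have hEm := hC.hE.measurableSet
  have hΩm := hC.hΩo.measurableSet
  have hρ := hB.ρ_pos
  have hn := hC.n_pos
  have h : IsTest (Metric.ball z₀ ρ) (bump z₀ ρ) := isTest_bump hρ
  obtain ⟨L, hL0, hL⟩ := exists_norm_fderiv_le h.contDiff h.compact
  obtain ⟨w, hw, hw0⟩ := hB.exists_test_ne_zero hEm hν hz₀ hE'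
  have hlim := hB.tendsto_rescaled hC hν hw hw0 h
  set V₁ : ℕ → ℝ := fun k => ∫ p in zoom E (c k) (r k) ×ˢ zoom (Eᶜ ∩ Ω) (c k) (r k),
    firstVar (scaledKernel s₁ (r k) K₁) ν (bump z₀ ρ) p.1 p.2 with hV₁
  set V₂ : ℕ → ℝ := fun k => ∫ p in zoom E (c k) (r k) ×ˢ zoom Ωᶜ (c k) (r k),
    firstVar (scaledKernel s₂ (r k) K₂) ν (bump z₀ ρ) p.1 p.2 with hV₂
  have hmA (k : ℕ) := measurableSet_zoom hEm (c k) (r k)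
  have hmB (k : ℕ) := measurableSet_zoom (hEm.compl.inter hΩm) (c k) (r k)
  have hmD (k : ℕ) := measurableSet_zoom hΩm.compl (c k) (r k)
  have hK₁ (k : ℕ) := hC.hK₁.kernelBound.scaled (hB.r_pos k)
  have hK₂ (k : ℕ) := hC.hK₂.kernelBound.scaled (hB.r_pos k)
  -- Splitting at distance `ρ`, the near part is bounded by the perimeter estimate and the far part
  -- by `farBound`, both uniformly in `k`.
  have hV₁b : ∃ b, ∀ k, |V₁ k| ≤ b := by
    refine ⟨3 * lam * L * C * (∫ v in Metric.ball (0 : Eu n) ρ, ‖v‖ ^ (-(n + s₁) + 1)) +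
      3 * lam * L * ∫ p, farBound n s₁ ρ ρ z₀ p, fun k => ?_⟩
    have h1 := hB.setIntegral_near_far hn hC.hs₁ (hK₁ k) hEm hΩm hν h hL hρ le_rfl k
    have h2 := abs_setIntegral_far_le hn hC.hs₁.1 hρ (hK₁ k) hν h hL ((hmA k).prod (hmB k))
    have h3 := abs_sub_abs_le_abs_sub (V₁ k)
      (∫ p in (zoom E (c k) (r k) ×ˢ zoom (Eᶜ ∩ Ω) (c k) (r k)) ∩ farSet n ρ,
        firstVar (scaledKernel s₁ (r k) K₁) ν (bump z₀ ρ) p.1 p.2)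
    exact (sub_le_iff_le_add.1 (h3.trans h1)).trans (add_le_add le_rfl h2)
  obtain ⟨b, hb⟩ := hV₁b
  have hr0 : Tendsto (fun k => (r k) ^ (s₂ - s₁)) atTop (𝓝 0) := by
    have := hB.r_tendsto.rpow_const (p := s₂ - s₁) (.inr (sub_pos.2 hs).le)
    rwa [Real.zero_rpow (sub_pos.2 hs).ne'] at this
  -- Multiplying the equation by `r^(s₂-s₁)` makes `V₁` vanish in the limit and isolates `σ V₂`.
  have hV₂lim : Tendsto V₂ atTop (𝓝 0) := by
    have h1 : Tendsto (fun k => (r k) ^ (s₂ - s₁) * V₁ k) atTop (𝓝 0) :=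
      hr0.zero_mul_isBoundedUnder_le ⟨b, by
        rw [eventually_map]; exact .of_forall fun k => hb k⟩
    have h2 := ((hr0.mul hlim).sub h1).const_mul σ⁻¹
    simp only [mul_zero, sub_zero] at h2
    refine h2.congr fun k => ?_
    have h3 : (r k) ^ (s₂ - s₁) * (r k) ^ (s₁ - s₂) = 1 := by
      rw [← Real.rpow_add (hB.r_pos k)]; simp
    have h4 : σ⁻¹ * σ = 1 := inv_mul_cancel₀ hσ
    change σ⁻¹ * ((r k) ^ (s₂ - s₁) * (V₁ k + σ * (r k) ^ (s₁ - s₂) * V₂ k) -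
      (r k) ^ (s₂ - s₁) * V₁ k) = V₂ k
    linear_combination σ⁻¹ * σ * V₂ k * h3 + V₂ k * h4
  have hdisj (k : ℕ) : Disjoint (Metric.ball z₀ (2 * ρ)) (zoom Ωᶜ (c k) (r k)) :=
    disjoint_left.2 fun x hx hx' => hx' (hB.ball_subset k hx)
  -- Only `E` is replaced by its limit: the flux estimate asks for a half-space near the bump and
  -- for a lower bound on the kernel, both available at each large `k`.
  have hsub := tendsto_setIntegral_far_sub hn hC.hs₂.1 hρ hK₂ hν h hmA hmD hB.measE' hB.mem_E
  have hlim2 : Tendsto (fun k => ∫ p in (E' ×ˢ zoom Ωᶜ (c k) (r k)) ∩ farSet n ρ,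
      firstVar (scaledKernel s₂ (r k) K₂) ν (bump z₀ ρ) p.1 p.2) atTop (𝓝 0) := by
    have h1 := hV₂lim.sub hsub
    rw [sub_zero] at h1
    refine h1.congr fun k => ?_
    rw [setIntegral_eq_far h (hmA k) (hmD k) hρ (hdisj k) le_rfl]
    simp [hV₂]
  obtain ⟨c₀, hc₀, hflux⟩ := exists_flux_interaction_ge hn hC.hs₂.1 hν hz₀ hρ
  -- a uniform lower bound for the rescaled kernels at bounded distance
  set M' : ℝ := ‖z₀‖ + ρ + |M| with hM'
  have hM'0 : 0 < M' := by positivity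
  set κ : ℝ := 1 / (lam * M' ^ ((n : ℝ) + s₂)) with hκ
  have hκ0 : 0 < κ := by
    have := hC.lam_pos
    have := Real.rpow_pos_of_pos hM'0 ((n : ℝ) + s₂)
    positivity
  obtain ⟨η, hη, hηϱ⟩ : ∃ η : ℝ, 0 < η ∧ ENNReal.ofReal η < ϱ := by
    obtain ⟨t, ht0, ht⟩ := ENNReal.lt_iff_exists_real_btwn.1 hC.ϱ_pos
    exact ⟨t, by simpa using ht.1, ht.2⟩
  have hrM : ∀ᶠ k in atTop, r k * M' ≤ η := by
    have h1 : Tendsto (fun k => r k * M') atTop (𝓝 (0 * M')) := hB.r_tendsto.mul_const _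
    rw [zero_mul] at h1
    exact h1.eventually_le_const hη
  have hlow : ∀ᶠ k in atTop, c₀ * κ * volume.real (zoom Ωᶜ (c k) (r k) ∩ Metric.ball 0 |M|) ≤
      ∫ p in (E' ×ˢ zoom Ωᶜ (c k) (r k)) ∩ farSet n ρ,
      firstVar (scaledKernel s₂ (r k) K₂) ν (bump z₀ ρ) p.1 p.2 := by
    filter_upwards [hrM] with k hk
    refine hflux lam ρ |M| κ _ _ _ (hK₂ k) (fun z hz => ?_) hρ le_rfl hκ0.le hB.measE' (hmD k)
      (hdisj k) hE' fun z hz hzM => ?_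
    · exact mul_nonneg (Real.rpow_nonneg (hB.r_pos k).le _)
        (hC.hK₂.nonneg _ (smul_ne_zero (hB.r_pos k).ne' hz))
    · refine le_trans ?_ (hC.hK₂.toIsKernel.scaled_lower (hB.r_pos k) hz
        ((ENNReal.ofReal_le_ofReal ?_).trans_lt hηϱ))
      · have h1 : 0 < ‖z‖ := norm_pos_iff.2 hz
        have h2 := hC.lam_pos
        have h3 := Real.rpow_pos_of_pos h1 ((n : ℝ) + s₂)
        have h4 := hC.hs₂.1
        rw [hκ]
        gcongr
      · exact (mul_le_mul_of_nonneg_left hzM (hB.r_pos k).le).trans hk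
  -- the volume of the rescaled complement converges
  have hvol : Tendsto (fun k => volume.real (zoom Ωᶜ (c k) (r k) ∩ Metric.ball (0 : Eu n) |M|)) atTop
      (𝓝 (volume.real (Ω'ᶜ ∩ Metric.ball (0 : Eu n) |M|))) := by
    have hb : MeasurableSet (Metric.ball (0 : Eu n) |M|) := Metric.isOpen_ball.measurableSet
    rw [← integral_indicator_one (hB.measΩ'.compl.inter hb)]
    refine Tendsto.congr (fun k => integral_indicator_one ((hmD k).inter hb)) ?_
    refine tendsto_integral_of_dominated_convergence
      ((Metric.ball (0 : Eu n) |M|).indicator fun _ => (1 : ℝ))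
      (fun k => (measurable_one.indicator ((hmD k).inter hb)).aestronglyMeasurable)
      ((integrable_indicator_iff hb).2 (integrableOn_const Metric.isBounded_ball.measure_lt_top.ne))
      (fun k => .of_forall fun x => ?_) ?_
    · by_cases hx : x ∈ Metric.ball (0 : Eu n) |M|
      · rw [indicator_of_mem hx]
        exact (norm_indicator_le_norm_self _ _).trans (by simp)
      · rw [indicator_of_notMem hx, indicator_of_notMem fun hc => hx hc.2]; simp
    · filter_upwards [hB.mem_Ω] with x hx
      refine tendsto_const_nhds.congr' ?_
      filter_upwards [hx] with k hk
      have : x ∈ Ω'ᶜ ∩ Metric.ball (0 : Eu n) |M| ↔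
          x ∈ zoom Ωᶜ (c k) (r k) ∩ Metric.ball (0 : Eu n) |M| :=
        and_congr_left fun _ => (not_congr hk).symm
      by_cases hx' : x ∈ Ω'ᶜ ∩ Metric.ball (0 : Eu n) |M|
      · rw [indicator_of_mem hx', indicator_of_mem (this.1 hx')]
      · rw [indicator_of_notMem hx', indicator_of_notMem fun hc => hx' (this.2 hc)]
  have hle := le_of_tendsto_of_tendsto (hvol.const_mul (c₀ * κ)) hlim2 hlow
  have hpos : 0 < volume.real (Ω'ᶜ ∩ Metric.ball (0 : Eu n) |M|) := by
    refine ENNReal.toReal_pos (hM.trans_le (measure_mono (inter_subset_inter_right _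
      (Metric.ball_subset_ball (le_abs_self M))))).ne' ?_
    exact ((measure_mono inter_subset_right).trans_lt Metric.isBounded_ball.measure_lt_top).ne
  have := mul_pos (mul_pos hc₀ hκ0) hpos
  linarith

end

/-! ### The blow-up limit of the kernels -/

/-- The isotropic kernel `c |ζ|^{-(n+s)}`. -/
noncomputable def isoKernel (n : ℕ) (s c : ℝ) (z : Eu n) : ℝ := c * ‖z‖ ^ (-((n : ℝ) + s))

lemma hasFDerivAt_norm_rpow_of_ne {q : ℝ} {z : Eu n} (hz : z ≠ 0) :
    HasFDerivAt (fun z : Eu n => ‖z‖ ^ q) ((q * ‖z‖ ^ (q - 1) * ‖z‖⁻¹) • innerSL ℝ z) z := by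
  have hp : 0 < ‖z‖ := norm_pos_iff.2 hz
  have h1 : HasFDerivAt (fun z : Eu n => ‖z‖ ^ 2) (2 • innerSL ℝ z) z :=
    (hasStrictFDerivAt_norm_sq z).hasFDerivAt
  have h2 := h1.rpow_const (p := q / 2) (.inl (by positivity))
  have h3 : (fun z : Eu n => (‖z‖ ^ 2) ^ (q / 2)) = fun z => ‖z‖ ^ q := by
    funext w
    rw [← Real.rpow_natCast, ← Real.rpow_mul (norm_nonneg _)]
    congr 1; push_cast; ring
  rw [h3] at h2
  refine h2.congr_fderiv ?_
  have h4 : (‖z‖ ^ 2) ^ (q / 2 - 1) = ‖z‖ ^ (q - 1) * ‖z‖⁻¹ := by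
    rw [← Real.rpow_natCast, ← Real.rpow_mul (norm_nonneg _), ← Real.rpow_neg_one,
      ← Real.rpow_add hp]
    congr 1; push_cast; ring
  rw [h4]
  ext v
  simp
  ring

/-- The constant `c * (n + s + 1)` dominates both `c`, needed for the size, and `c * (n + s)`,
needed for the gradient. -/
lemma kernelBound_isoKernel {s c : ℝ} (hs : 0 < s) (hc : 0 < c) :
    KernelBound s (c * (n + s + 1)) (isoKernel n s c) where
  contDiffOn := by
    intro z hz
    have h1 : ContDiffAt ℝ 1 (fun z : Eu n => ‖z‖) z := contDiffAt_norm ℝ hz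
    exact (contDiffAt_const.mul (h1.rpow_const_of_ne (norm_ne_zero_iff.2 hz))).contDiffWithinAt
  abs_le z _ := by
    have hn : (0 : ℝ) ≤ n := by positivity
    rw [isoKernel, abs_of_nonneg (by positivity)]
    gcongr
    nlinarith
  norm_fderiv_le z hz := by
    have hp : 0 < ‖z‖ := norm_pos_iff.2 hz
    have hn : (0 : ℝ) ≤ n := by positivity
    have h1 := ((hasFDerivAt_norm_rpow_of_ne (q := -((n : ℝ) + s)) hz).const_mul c).fderiv
    have h2 : fderiv ℝ (isoKernel n s c) z = _ := h1
    rw [h2, norm_smul, norm_smul, innerSL_apply_norm, Real.norm_of_nonneg hc.le, norm_mul, norm_mul,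
      norm_neg, Real.norm_of_nonneg (by positivity : 0 ≤ (n : ℝ) + s),
      Real.norm_of_nonneg (by positivity : 0 ≤ ‖z‖ ^ (-((n : ℝ) + s) - 1)), norm_inv, norm_norm]
    have h3 : c * ((n + s) * ‖z‖ ^ (-((n : ℝ) + s) - 1) * ‖z‖⁻¹ * ‖z‖) =
        c * (n + s) * ‖z‖ ^ (-((n : ℝ) + s) - 1) := by field_simp
    rw [h3]
    exact mul_le_mul_of_nonneg_right (mul_le_mul_of_nonneg_left (by linarith) hc.le) (by positivity)

/-! ### Convergence of the gradients of the rescaled kernels -/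

section

variable {s lam c : ℝ} {ϱ : ℝ≥0∞} {K : Eu n → ℝ}

lemma IsKernelC.norm_fderiv_sub_le (hs : 0 < s) (hlam : 0 ≤ lam) (hK : IsKernelC 2 s lam ϱ K)
    {z w : Eu n} (hz : z ≠ 0) (hw : w ∈ Metric.ball z (‖z‖ / 2)) :
    ‖fderiv ℝ K w - fderiv ℝ K z‖ ≤ lam * (‖z‖ / 2) ^ (-(n + s + 2)) * ‖w - z‖ := by
  have hp : 0 < ‖z‖ := norm_pos_iff.2 hz
  have hn : (0 : ℝ) ≤ n := by positivity
  have hball : ∀ v ∈ Metric.ball z (‖z‖ / 2), ‖z‖ / 2 ≤ ‖v‖ := by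
    intro v hv
    have h1 := mem_ball_iff_norm.1 hv
    have h2 := norm_sub_norm_le z v
    rw [norm_sub_rev] at h2
    linarith
  have hne : ∀ v ∈ Metric.ball z (‖z‖ / 2), v ≠ 0 := fun v hv =>
    norm_pos_iff.1 (by linarith [hball v hv])
  have hd : ContDiffOn ℝ 1 (fderiv ℝ K) {0}ᶜ :=
    hK.contDiffOn.fderiv_of_isOpen isOpen_compl_singleton (by norm_num)
  refine (convex_ball z (‖z‖ / 2)).norm_image_sub_le_of_norm_fderiv_le (𝕜 := ℝ)
    (fun v hv => ?_) (fun v hv => ?_) (Metric.mem_ball_self (by positivity)) hw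
  · exact ((hd.differentiableOn one_ne_zero) v (hne v hv)).differentiableAt
      (isOpen_compl_singleton.mem_nhds (hne v hv))
  · have h1 := hK.deriv_le 2 (by norm_num) le_rfl v (hne v hv)
    rw [← norm_iteratedFDeriv_fderiv (n := 1), norm_iteratedFDeriv_one] at h1
    refine h1.trans ?_
    rw [div_eq_mul_inv, ← Real.rpow_neg (norm_nonneg _)]
    gcongr lam * ?_
    exact Real.rpow_le_rpow_of_nonpos (by positivity) (hball v hv) (by
      push_cast; linarith)

/-- The bound on `D²K` has degree `-(n + s + 2)`, so the powers of `r` cancel and the Taylor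
remainder is uniform in the scale. -/
lemma abs_scaledKernel_sub_le (hs : 0 < s) (hlam : 0 ≤ lam) (hK : IsKernelC 2 s lam ϱ K) {r : ℝ}
    (hr : 0 < r) {z : Eu n} (hz : z ≠ 0) {ν : Eu n} (hν : ‖ν‖ = 1) {h : ℝ} (hh : 0 < h)
    (hhz : h < ‖z‖ / 2) :
    |scaledKernel s r K (z + h • ν) - scaledKernel s r K z - h * fderiv ℝ (scaledKernel s r K) z ν|
      ≤ lam * (‖z‖ / 2) ^ (-(n + s + 2)) * h * h := by
  have hp : 0 < ‖z‖ := norm_pos_iff.2 hz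
  have hS := hK.kernelBound.scaled hr
  have hball : Metric.closedBall z h ⊆ Metric.ball z (‖z‖ / 2) :=
    Metric.closedBall_subset_ball hhz
  have hne : ∀ v ∈ Metric.closedBall z h, v ≠ 0 := by
    intro v hv
    have h1 := mem_ball_iff_norm.1 (hball hv)
    have h2 := norm_sub_norm_le z v
    rw [norm_sub_rev] at h2
    exact norm_pos_iff.1 (by linarith)
  have key := (convex_closedBall z h).norm_image_sub_le_of_norm_fderiv_le' (𝕜 := ℝ)
    (f := scaledKernel s r K) (φ := fderiv ℝ (scaledKernel s r K) z)
    (C := lam * (‖z‖ / 2) ^ (-((n : ℝ) + s + 2)) * h) (x := z) (y := z + h • ν)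
    (fun v hv => hS.differentiableAt (hne v hv)) (fun v hv => ?_)
    (Metric.mem_closedBall_self hh.le) ?_
  · rw [add_sub_cancel_left, norm_smul, hν, mul_one, Real.norm_of_nonneg hh.le] at key
    simpa using key
  · rw [fderiv_scaledKernel hK.kernelBound hr (hne v hv),
      fderiv_scaledKernel hK.kernelBound hr hz, ← smul_sub, norm_smul]
    have h1 : r • v ∈ Metric.ball (r • z) (‖r • z‖ / 2) := by
      rw [mem_ball_iff_norm, ← smul_sub, norm_smul, norm_smul, mul_div_assoc]
      have := mem_ball_iff_norm.1 (hball hv)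
      have h0 : 0 < ‖r‖ := norm_pos_iff.2 hr.ne'
      gcongr
    have h2 := hK.norm_fderiv_sub_le hs hlam (smul_ne_zero hr.ne' hz) h1
    rw [← smul_sub, norm_smul, norm_smul, Real.norm_of_nonneg hr.le, mul_div_assoc,
      Real.mul_rpow hr.le (by positivity)] at h2
    rw [Real.norm_of_nonneg (by positivity)]
    have h3 : r ^ ((n : ℝ) + s) * r * (r ^ (-((n : ℝ) + s + 2)) * r) = 1 := by
      have h4 : r * (r ^ (-((n : ℝ) + s + 2)) * r) = r ^ (-((n : ℝ) + s)) := by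
        rw [show -((n : ℝ) + s) = 1 + (-((n : ℝ) + s + 2) + 1) by ring, Real.rpow_add hr,
          Real.rpow_add hr, Real.rpow_one]
      rw [mul_assoc, h4, ← Real.rpow_add hr]; simp
    have h5 : ‖v - z‖ ≤ h := mem_closedBall_iff_norm.1 hv
    calc r ^ ((n : ℝ) + s) * r * ‖fderiv ℝ K (r • v) - fderiv ℝ K (r • z)‖
        ≤ r ^ ((n : ℝ) + s) * r * (lam * (r ^ (-((n : ℝ) + s + 2)) *
          (‖z‖ / 2) ^ (-((n : ℝ) + s + 2))) * (r * ‖v - z‖)) := by gcongr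
      _ = (r ^ ((n : ℝ) + s) * r * (r ^ (-((n : ℝ) + s + 2)) * r)) *
          (lam * (‖z‖ / 2) ^ (-((n : ℝ) + s + 2)) * ‖v - z‖) := by ring
      _ ≤ _ := by rw [h3, one_mul]; gcongr
  · rw [mem_closedBall_iff_norm, add_sub_cancel_left, norm_smul, hν, mul_one,
      Real.norm_of_nonneg hh.le]

/-- Pointwise convergence passes to gradients because the difference quotient of step `h` differs
from the derivative by at most `Λ h` for every `k`: `h` is fixed first, and then `k → ∞`. -/
lemma tendsto_fderiv_scaledKernel (hs : 0 < s) (hlam : 0 ≤ lam) (hK : IsKernelC 2 s lam ϱ K)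
    {r : ℕ → ℝ} (hr : ∀ k, 0 < r k) {K' : Eu n → ℝ}
    (hlim : ∀ z, z ≠ 0 → Tendsto (fun k => scaledKernel s (r k) K z) atTop (𝓝 (K' z)))
    {z : Eu n} (hz : z ≠ 0) (hK' : DifferentiableAt ℝ K' z) {ν : Eu n} (hν : ‖ν‖ = 1) :
    Tendsto (fun k => fderiv ℝ (scaledKernel s (r k) K) z ν) atTop (𝓝 (fderiv ℝ K' z ν)) := by
  have hp : 0 < ‖z‖ := norm_pos_iff.2 hz
  set Λ := lam * (‖z‖ / 2) ^ (-((n : ℝ) + s + 2)) with hΛ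
  have hΛ0 : 0 ≤ Λ := by positivity
  have hder : HasDerivAt (fun h : ℝ => K' (z + h • ν)) (fderiv ℝ K' z ν) 0 := by
    have h1 : HasDerivAt (fun h : ℝ => z + h • ν) ν 0 := by
      simpa using ((hasDerivAt_id (0 : ℝ)).smul_const ν).const_add z
    have h2 : HasFDerivAt K' (fderiv ℝ K' z) (z + (0 : ℝ) • ν) := by
      simpa using hK'.hasFDerivAt
    exact h2.comp_hasDerivAt 0 h1
  have hslope := hder.tendsto_slope.mono_left
    (nhdsWithin_mono 0 (fun t (ht : t ∈ Ioi (0 : ℝ)) => ne_of_gt ht))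
  rw [Metric.tendsto_atTop]
  intro δ hδ
  have e1 : ∀ᶠ h : ℝ in 𝓝[>] 0, |slope (fun h : ℝ => K' (z + h • ν)) 0 h - fderiv ℝ K' z ν| < δ / 3 :=
    (Metric.tendsto_nhds.1 hslope) (δ / 3) (by positivity)
  have e2 : ∀ᶠ h : ℝ in 𝓝[>] 0, h < ‖z‖ / 2 :=
    (eventually_lt_nhds (by positivity)).filter_mono nhdsWithin_le_nhds
  have e3 : ∀ᶠ h : ℝ in 𝓝[>] 0, Λ * h < δ / 3 := by
    have h1 : Tendsto (fun h : ℝ => Λ * h) (𝓝 0) (𝓝 (Λ * 0)) := tendsto_id.const_mul Λ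
    rw [mul_zero] at h1
    exact (h1.mono_left nhdsWithin_le_nhds).eventually_lt_const (by positivity)
  obtain ⟨h, ⟨⟨h1, h2⟩, h3⟩, hh⟩ := (((e1.and e2).and e3).and self_mem_nhdsWithin).exists
  have hh' : 0 < h := hh
  have hzh : z + h • ν ≠ 0 := by
    intro hcon
    have h4 : z = -(h • ν) := eq_neg_of_add_eq_zero_left hcon
    have h5 : ‖z‖ = h := by
      rw [h4, norm_neg, norm_smul, hν, mul_one, Real.norm_of_nonneg hh'.le]
    linarith
  have hq := ((hlim _ hzh).sub (hlim z hz)).div_const h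
  have e4 := (Metric.tendsto_nhds.1 hq) (δ / 3) (by positivity)
  obtain ⟨N, hN⟩ := eventually_atTop.1 e4
  refine ⟨N, fun k hk => ?_⟩
  have h4 := hN k hk
  have h5 := abs_scaledKernel_sub_le hs hlam hK (hr k) hz hν hh' h2
  rw [slope_def_field] at h1
  simp only [zero_smul, add_zero, sub_zero] at h1
  rw [Real.dist_eq] at h4 ⊢
  have h6 : |(scaledKernel s (r k) K (z + h • ν) - scaledKernel s (r k) K z) / h -
      fderiv ℝ (scaledKernel s (r k) K) z ν| ≤ Λ * h := by
    have h7 : (scaledKernel s (r k) K (z + h • ν) - scaledKernel s (r k) K z) / h -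
      fderiv ℝ (scaledKernel s (r k) K) z ν = (scaledKernel s (r k) K (z + h • ν) -
        scaledKernel s (r k) K z - h * fderiv ℝ (scaledKernel s (r k) K) z ν) / h := by
      field_simp
    rw [h7, abs_div, abs_of_pos hh', div_le_iff₀ hh']
    exact h5
  rw [abs_lt] at h1 h4 ⊢
  rw [abs_le] at h6
  constructor <;> linarith

end

/-! ### Reflections and exclusion of asymmetric wedges -/

/-- Constancy of `a` on the sphere makes the limit kernel isotropic, hence invariant under every
reflection. -/
lemma HasBlowUp.tendsto_scaledKernel {s c : ℝ} {a K : Eu n → ℝ} (ha : HasBlowUp s a K)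
    (hc : ∀ w ∈ Metric.sphere (0 : Eu n) 1, a w = c) {r : ℕ → ℝ} (hr : ∀ k, 0 < r k)
    (hr0 : Tendsto r atTop (𝓝 0)) {z : Eu n} (hz : z ≠ 0) :
    Tendsto (fun k => scaledKernel s (r k) K z) atTop (𝓝 (isoKernel n s c z)) := by
  have h1 : Tendsto r atTop (𝓝[>] 0) :=
    tendsto_nhdsWithin_iff.2 ⟨hr0, .of_forall hr⟩
  have h2 := (ha.tendsto z hz).comp h1
  rw [hc _ (by simp [norm_smul, hz]), div_eq_mul_inv, ← Real.rpow_neg (norm_nonneg _)] at h2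
  exact h2

/-- The reflection across the hyperplane `ν^⊥`. -/
noncomputable def mirror (ν : Eu n) : Eu n ≃ₗᵢ[ℝ] Eu n := (ℝ ∙ ν)ᗮ.reflection

section

variable {ν e z₀ : Eu n} {s c ρ ε : ℝ}

lemma mirror_apply (hν : ‖ν‖ = 1) (x : Eu n) : mirror ν x = x - (2 * inner ℝ ν x) • ν := by
  rw [mirror, Submodule.reflection_orthogonal_apply, Submodule.reflection_singleton_apply, hν]
  simp only [RCLike.ofReal_one, one_pow, div_one, neg_sub]
  rw [← Nat.cast_smul_eq_nsmul ℝ, smul_smul]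
  norm_num

lemma mirror_mirror (x : Eu n) : mirror ν (mirror ν x) = x := Submodule.reflection_reflection _ x

lemma mirror_self (hν : ‖ν‖ = 1) : mirror ν ν = -ν := by
  rw [mirror_apply hν, real_inner_self_eq_norm_sq, hν]
  module

lemma inner_mirror_self (hν : ‖ν‖ = 1) (x : Eu n) : inner ℝ ν (mirror ν x) = -inner ℝ ν x := by
  rw [mirror_apply hν, inner_sub_right, inner_smul_right, real_inner_self_eq_norm_sq, hν]
  ring

lemma fderiv_mirror {f : Eu n → ℝ} (hν : ‖ν‖ = 1) (hf : ∀ x, f (mirror ν x) = f x) (x : Eu n) :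
    fderiv ℝ f (mirror ν x) ν = -fderiv ℝ f x ν := by
  have h1 : f ∘ (mirror ν).toContinuousLinearEquiv = f := funext hf
  have h2 := (mirror ν).toContinuousLinearEquiv.comp_right_fderiv (f := f) (x := x)
  rw [h1] at h2
  have h3 : fderiv ℝ f x ν = fderiv ℝ f (mirror ν x) (mirror ν ν) := by
    rw [h2]; rfl
  rw [h3, mirror_self hν, map_neg, neg_neg]

lemma fderiv_isoKernel_neg (z : Eu n) :
    fderiv ℝ (isoKernel n s c) (-z) ν = -fderiv ℝ (isoKernel n s c) z ν := by
  have h1 : isoKernel n s c ∘ ContinuousLinearEquiv.neg ℝ (M := Eu n) = isoKernel n s c := by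
    funext x; simp [isoKernel]
  have h2 := (ContinuousLinearEquiv.neg ℝ (M := Eu n)).comp_right_fderiv
    (f := isoKernel n s c) (x := z)
  rw [h1] at h2
  have h3 : fderiv ℝ (isoKernel n s c) z ν = fderiv ℝ (isoKernel n s c) (-z) (-ν) := by
    rw [h2]; rfl
  rw [h3, map_neg, neg_neg]

lemma firstVar_isoKernel_swap (ψ : Eu n → ℝ) (x y : Eu n) :
    firstVar (isoKernel n s c) ν ψ y x = firstVar (isoKernel n s c) ν ψ x y := by
  have h1 : y - x = -(x - y) := (neg_sub x y).symm
  have h2 : isoKernel n s c (-(x - y)) = isoKernel n s c (x - y) := by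
    rw [isoKernel, isoKernel, norm_neg]
  rw [firstVar, firstVar, h1, fderiv_isoKernel_neg, h2]
  ring

/-- The reflection preserves the kernel and `ψ` but reverses `∂_ν`, while exchanging the two points
changes nothing because the kernel is even. -/
lemma firstVar_isoKernel_mirror (hν : ‖ν‖ = 1) {ψ : Eu n → ℝ} (hψ : ∀ x, ψ (mirror ν x) = ψ x)
    (x y : Eu n) : firstVar (isoKernel n s c) ν ψ (mirror ν y) (mirror ν x) =
      -firstVar (isoKernel n s c) ν ψ x y := by
  have h0 : ∀ z, isoKernel n s c (mirror ν z) = isoKernel n s c z := fun z => by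
    simp [isoKernel]
  rw [← firstVar_isoKernel_swap ψ x y, firstVar, firstVar, ← map_sub, h0, fderiv_mirror hν h0,
    fderiv_mirror hν hψ, fderiv_mirror hν hψ, hψ, hψ]
  ring

lemma bump_mirror (hν : ‖ν‖ = 1) (hz₀ : inner ℝ ν z₀ = 0) (x : Eu n) :
    bump z₀ ρ (mirror ν x) = bump z₀ ρ x := by
  have h1 : mirror ν z₀ = z₀ := by rw [mirror_apply hν, hz₀]; simp
  have h2 : ‖mirror ν x - z₀‖ = ‖x - z₀‖ := by
    conv_lhs => rw [← h1, ← map_sub, LinearIsometryEquiv.norm_map]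
  rw [bump, bump, h2]

/-- The map `(x, y) ↦ (mirror y, mirror x)` preserves the measure and the domain and changes the
sign of the integrand. -/
lemma setIntegral_mirror_eq_zero (hν : ‖ν‖ = 1) {ψ : Eu n → ℝ} (hψ : ∀ x, ψ (mirror ν x) = ψ x)
    (A : Set (Eu n)) :
    ∫ p in (A ×ˢ (mirror ν ⁻¹' A)) ∩ farSet n ε, firstVar (isoKernel n s c) ν ψ p.1 p.2 = 0 := by
  set Θ : Eu n × Eu n ≃ᵐ Eu n × Eu n := MeasurableEquiv.prodComm.trans
    ((mirror ν).toMeasurableEquiv.prodCongr (mirror ν).toMeasurableEquiv) with hΘ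
  have hΘa : ∀ p, Θ p = (mirror ν p.2, mirror ν p.1) := fun p => rfl
  have hmp : MeasurePreserving Θ := by
    have h1 : MeasurePreserving (Prod.map (mirror ν) (mirror ν))
        (volume : Measure (Eu n × Eu n)) volume :=
      (mirror ν).measurePreserving.prod (mirror ν).measurePreserving
    have h2 : MeasurePreserving (Prod.swap : Eu n × Eu n → Eu n × Eu n) volume volume :=
      Measure.measurePreserving_swap
    exact h1.comp h2
  have hpre : Θ ⁻¹' ((A ×ˢ (mirror ν ⁻¹' A)) ∩ farSet n ε) =
      (A ×ˢ (mirror ν ⁻¹' A)) ∩ farSet n ε := by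
    ext p
    simp only [mem_preimage, hΘa, mem_inter_iff, mem_prod, mirror_mirror, farSet, mem_ofPred_eq,
      ← map_sub, LinearIsometryEquiv.norm_map, norm_sub_rev p.2 p.1]
    tauto
  have h1 := hmp.setIntegral_preimage_emb Θ.measurableEmbedding
    (fun p => firstVar (isoKernel n s c) ν ψ p.1 p.2) ((A ×ˢ (mirror ν ⁻¹' A)) ∩ farSet n ε)
  rw [hpre] at h1
  simp only [hΘa, firstVar_isoKernel_mirror hν hψ, integral_neg] at h1
  linarith

lemma setIntegral_swap (A B : Set (Eu n)) (ψ : Eu n → ℝ) :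
    ∫ p in (A ×ˢ B) ∩ farSet n ε, firstVar (isoKernel n s c) ν ψ p.1 p.2 =
      ∫ p in (B ×ˢ A) ∩ farSet n ε, firstVar (isoKernel n s c) ν ψ p.1 p.2 := by
  have hmp : MeasurePreserving (MeasurableEquiv.prodComm : Eu n × Eu n ≃ᵐ Eu n × Eu n)
      volume volume := Measure.measurePreserving_swap
  have hpre : (MeasurableEquiv.prodComm : Eu n × Eu n ≃ᵐ Eu n × Eu n) ⁻¹'
      ((B ×ˢ A) ∩ farSet n ε) = (A ×ˢ B) ∩ farSet n ε := by
    ext p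
    have hpc : MeasurableEquiv.prodComm p = (p.2, p.1) := rfl
    simp only [mem_preimage, hpc, mem_inter_iff, mem_prod, farSet, mem_ofPred_eq,
      norm_sub_rev p.2 p.1]
    tauto
  have h1 := hmp.setIntegral_preimage_emb MeasurableEquiv.prodComm.measurableEmbedding
    (fun p => firstVar (isoKernel n s c) ν ψ p.1 p.2) ((B ×ˢ A) ∩ farSet n ε)
  rw [hpre] at h1
  rw [← h1]
  refine integral_congr_ae (.of_forall fun p => ?_)
  exact (firstVar_isoKernel_swap ψ p.1 p.2).symm

lemma volume_hyperplane (hν : ‖ν‖ = 1) : volume {x : Eu n | inner ℝ ν x = 0} = 0 := by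
  have h1 : {x : Eu n | inner ℝ ν x = 0} = ((ℝ ∙ ν)ᗮ : Submodule ℝ (Eu n)) := by
    ext x
    simp [Submodule.mem_orthogonal_singleton_iff_inner_right]
  rw [h1]
  refine Measure.addHaar_submodule _ _ fun htop => ?_
  have h2 : ν ∈ (ℝ ∙ ν)ᗮ := htop ▸ Submodule.mem_top
  rw [Submodule.mem_orthogonal_singleton_iff_inner_right, real_inner_self_eq_norm_sq, hν] at h2
  norm_num at h2

/-- The truncated first variation of a wedge, or of a strip, that is not symmetric with respect to
the hyperplane `ν^⊥` is bounded away from zero. -/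
lemma exists_wedge_firstVar_ge (hn : 0 < n) (hs : 0 < s) (hc : 0 < c) (hν : ‖ν‖ = 1)
    (hz₀ : inner ℝ ν z₀ = 0) (heν : 0 < inner ℝ e ν) {b : ℝ} (hb : 0 ≤ b) (hρ : 0 < ρ)
    (hball : ∀ x ∈ Metric.ball z₀ (2 * ρ), -b < inner ℝ e x ∧ -b < inner ℝ e (mirror ν x)) :
    ∃ δ : ℝ, 0 < δ ∧ ∀ ε, 0 < ε → ε ≤ ρ →
      δ ≤ ∫ p in ({x | -b < inner ℝ e x ∧ inner ℝ ν x < 0} ×ˢ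
        {x | -b < inner ℝ e x ∧ 0 < inner ℝ ν x}) ∩ farSet n ε,
        firstVar (isoKernel n s c) ν (bump z₀ ρ) p.1 p.2 := by
  set A : Set (Eu n) := {x | -b < inner ℝ e x ∧ inner ℝ ν x < 0} with hA
  -- `W` is the asymmetric part: points of the container beyond the plane whose mirror image is
  -- outside the container.
  set W : Set (Eu n) := {x | -b < inner ℝ e x ∧ 0 < inner ℝ ν x ∧ inner ℝ e (mirror ν x) ≤ -b}
    with hW
  have hmc : Continuous (mirror ν) := (mirror ν).continuous
  have hAm : MeasurableSet A :=
    (measurableSet_lt measurable_const (measurable_inner_left e)).inter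
      (measurableSet_lt (measurable_inner_left ν) measurable_const)
  have hWm : MeasurableSet W :=
    (measurableSet_lt measurable_const (measurable_inner_left e)).inter
      ((measurableSet_lt measurable_const (measurable_inner_left ν)).inter
        (measurableSet_le ((measurable_inner_left e).comp hmc.measurable) measurable_const))
  have hmir : ∀ x, inner ℝ e (mirror ν x) = inner ℝ e x - 2 * inner ℝ ν x * inner ℝ e ν := by
    intro x
    rw [mirror_apply hν, inner_sub_right, inner_smul_right]
  -- As `⟪e, ν⟫ > 0`, reflecting `A` to the side `⟪ν, x⟫ > 0` increases `⟪e, x⟫`; the mirror image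
  -- of `A` thus stays in the container, and `W` is what it leaves uncovered.
  have hsplit : {x | -b < inner ℝ e x ∧ 0 < inner ℝ ν x} = (mirror ν ⁻¹' A) ∪ W := by
    ext x
    simp only [mem_ofPred_eq, mem_union, mem_preimage, hA, hW, inner_mirror_self hν, Left.neg_neg_iff]
    constructor
    · rintro ⟨h1, h2⟩
      rcases lt_or_ge (-b) (inner ℝ e (mirror ν x)) with h | h
      · exact .inl ⟨h, h2⟩
      · exact .inr ⟨h1, h2, h⟩
    · rintro (⟨h1, h2⟩ | ⟨h1, h2, -⟩)
      · refine ⟨?_, h2⟩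
        rw [hmir] at h1
        have := mul_pos h2 heν
        linarith
      · exact ⟨h1, h2⟩
  have hdisj : Disjoint (mirror ν ⁻¹' A) W := by
    rw [disjoint_left]
    rintro x ⟨h1, -⟩ ⟨-, -, h2⟩
    linarith
  have hWb : Disjoint (Metric.ball z₀ (2 * ρ)) W := by
    rw [disjoint_left]
    rintro x hx ⟨-, -, h2⟩
    linarith [(hball x hx).2]
  have hA' : ∀ x ∈ Metric.ball z₀ (2 * ρ), x ∈ A ↔ inner ℝ ν x < 0 := fun x hx =>
    ⟨fun h => h.2, fun h => ⟨(hball x hx).1, h⟩⟩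
  -- `W` contains an open ball around a large multiple of `ν`
  set t : ℝ := (b + 1) / inner ℝ e ν with ht
  have ht0 : 0 < t := by positivity
  set O : Set (Eu n) := {x | -b < inner ℝ e x ∧ 0 < inner ℝ ν x ∧ inner ℝ e (mirror ν x) < -b}
    with hO
  have hc₁ : Continuous fun x : Eu n => inner ℝ e x := by fun_prop
  have hc₂ : Continuous fun x : Eu n => inner ℝ ν x := by fun_prop
  have hOo : IsOpen O := (isOpen_lt continuous_const hc₁).inter
    ((isOpen_lt continuous_const hc₂).inter (isOpen_lt (hc₁.comp hmc) continuous_const))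
  have htO : t • ν ∈ O := by
    -- With this `t`, the mirror image of `t • ν` is at height `-(b + 1)`, strictly outside the
    -- container.
    have h1 : t * inner ℝ e ν = b + 1 := div_mul_cancel₀ _ heν.ne'
    refine ⟨?_, ?_, ?_⟩
    · rw [inner_smul_right, h1]; linarith
    · rw [inner_smul_right, real_inner_self_eq_norm_sq, hν]; linarith
    · rw [map_smul, mirror_self hν, smul_neg, inner_neg_right, inner_smul_right, h1]; linarith
  have hpos : 0 < volume.real (W ∩ Metric.ball 0 (t + 1)) := by
    have h1 : 0 < volume (O ∩ Metric.ball 0 (t + 1)) := by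
      refine (hOo.inter Metric.isOpen_ball).measure_pos _ ⟨t • ν, htO, ?_⟩
      rw [mem_ball_zero_iff, norm_smul, hν, Real.norm_of_nonneg ht0.le]
      linarith
    have hOW : O ⊆ W := fun x hx => ⟨hx.1, hx.2.1, hx.2.2.le⟩
    refine ENNReal.toReal_pos (h1.trans_le (measure_mono (inter_subset_inter_left _ hOW))).ne' ?_
    exact ((measure_mono inter_subset_right).trans_lt Metric.isBounded_ball.measure_lt_top).ne
  obtain ⟨c₀, hc₀, hflux⟩ := exists_flux_interaction_ge hn hs hν hz₀ hρ
  have hKB := kernelBound_isoKernel (n := n) hs hc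
  set M' : ℝ := ‖z₀‖ + ρ + (t + 1) with hM'
  have hM'0 : 0 < M' := by positivity
  set κ : ℝ := c * M' ^ (-((n : ℝ) + s)) with hκ
  have hκ0 : 0 < κ := mul_pos hc (Real.rpow_pos_of_pos hM'0 _)
  refine ⟨c₀ * κ * volume.real (W ∩ Metric.ball 0 (t + 1)), by positivity, fun ε hε hερ => ?_⟩
  have h := isTest_bump (z₀ := z₀) hρ
  have hint := integrableOn_firstVar_far hn hs hε hKB hν h
  have hu : (A ×ˢ ((mirror ν ⁻¹' A) ∪ W)) ∩ farSet n ε =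
      ((A ×ˢ (mirror ν ⁻¹' A)) ∩ farSet n ε) ∪ ((A ×ˢ W) ∩ farSet n ε) := by
    rw [prod_union, union_inter_distrib_right]
  -- The symmetric part integrates to zero. `W` avoids the ball of radius `2ρ` around `z₀`, so its
  -- contribution is a positive flux with a lower bound independent of `ε`.
  rw [hsplit, hu, setIntegral_union _ ((hAm.prod hWm).inter measurableSet_farSet)
    (hint.mono_set inter_subset_right) (hint.mono_set inter_subset_right),
    setIntegral_mirror_eq_zero hν (bump_mirror hν hz₀), zero_add]
  · refine hflux _ ε (t + 1) κ _ A W hKB (fun z _ => ?_) hε hερ hκ0.le hAm hWm hWb hA'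
      fun z hz hzM => ?_
    · exact mul_nonneg hc.le (Real.rpow_nonneg (norm_nonneg _) _)
    · rw [hκ, isoKernel]
      refine mul_le_mul_of_nonneg_left (Real.rpow_le_rpow_of_nonpos (norm_pos_iff.2 hz) hzM ?_) hc.le
      have : (0 : ℝ) ≤ n := by positivity
      linarith
  · rw [disjoint_left]
    rintro p ⟨⟨-, h1⟩, -⟩ ⟨⟨-, h2⟩, -⟩
    exact disjoint_left.1 hdisj h1 h2

end

/-! ### Exclusion of asymmetric limits when adhesion is negligible -/

section

variable {s₁ s₂ lam σ : ℝ} {ϱ : ℝ≥0∞} {K₁ K₂ g : Eu n → ℝ} {Ω E Ω' E' : Set (Eu n)}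
  {c : ℕ → Eu n} {r : ℕ → ℝ} {ν e z₀ : Eu n} {ρ C : ℝ}

/-- When adhesion is negligible, the truncated first variation of the blow-up limit is small. -/
lemma IsBlowUp.tendsto_truncated_zero (hB : IsBlowUp Ω E Ω' E' c r z₀ ρ C)
    (hC : CriticalSetting n s₁ s₂ lam σ ϱ K₁ K₂ g Ω E) (hν : ‖ν‖ = 1)
    {w : Eu n → ℝ} (hw : IsTest Ω w) (hw0 : ∫ x in E, fderiv ℝ w x ν ≠ 0)
    {a₁ : Eu n → ℝ} (ha₁ : HasBlowUp s₁ a₁ K₁) {a : ℝ} (ha : 0 < a)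
    (hconst : ∀ w ∈ Metric.sphere (0 : Eu n) 1, a₁ w = a) (hs : σ = 0 ∨ s₂ < s₁)
    {B' : Set (Eu n)} (hB'm : MeasurableSet B')
    (hB' : ∀ᵐ x, ∀ᶠ k in atTop, (x ∈ zoom (Eᶜ ∩ Ω) (c k) (r k) ↔ x ∈ B')) :
    Tendsto (fun ε => ∫ p in (E' ×ˢ B') ∩ farSet n ε,
      firstVar (isoKernel n s₁ a) ν (bump z₀ ρ) p.1 p.2) (𝓝[>] 0) (𝓝 0) := by
  have hEm := hC.hE.measurableSet
  have hΩm := hC.hΩo.measurableSet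
  have hρ := hB.ρ_pos
  have hn := hC.n_pos
  have h : IsTest (Metric.ball z₀ ρ) (bump z₀ ρ) := isTest_bump hρ
  obtain ⟨L, hL0, hL⟩ := exists_norm_fderiv_le h.contDiff h.compact
  have hlim := hB.tendsto_rescaled hC hν hw hw0 h
  set V₁ : ℕ → ℝ := fun k => ∫ p in zoom E (c k) (r k) ×ˢ zoom (Eᶜ ∩ Ω) (c k) (r k),
    firstVar (scaledKernel s₁ (r k) K₁) ν (bump z₀ ρ) p.1 p.2 with hV₁
  set V₂ : ℕ → ℝ := fun k => ∫ p in zoom E (c k) (r k) ×ˢ zoom Ωᶜ (c k) (r k),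
    firstVar (scaledKernel s₂ (r k) K₂) ν (bump z₀ ρ) p.1 p.2 with hV₂
  have hmA (k : ℕ) := measurableSet_zoom hEm (c k) (r k)
  have hmB (k : ℕ) := measurableSet_zoom (hEm.compl.inter hΩm) (c k) (r k)
  have hmD (k : ℕ) := measurableSet_zoom hΩm.compl (c k) (r k)
  have hK₁ (k : ℕ) := hC.hK₁.kernelBound.scaled (hB.r_pos k)
  have hK₂ (k : ℕ) := hC.hK₂.kernelBound.scaled (hB.r_pos k)
  have hdisj (k : ℕ) : Disjoint (Metric.ball z₀ (2 * ρ)) (zoom Ωᶜ (c k) (r k)) :=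
    disjoint_left.2 fun x hx hx' => hx' (hB.ball_subset k hx)
  have hV₂lim : Tendsto (fun k => σ * (r k) ^ (s₁ - s₂) * V₂ k) atTop (𝓝 0) := by
    rcases hs with rfl | hs
    · simp
    · have hr0 : Tendsto (fun k => σ * (r k) ^ (s₁ - s₂)) atTop (𝓝 0) := by
        have := (hB.r_tendsto.rpow_const (p := s₁ - s₂) (.inr (sub_pos.2 hs).le)).const_mul σ
        rwa [Real.zero_rpow (sub_pos.2 hs).ne', mul_zero] at this
      refine hr0.zero_mul_isBoundedUnder_le ⟨3 * lam * L * ∫ p, farBound n s₂ ρ ρ z₀ p, ?_⟩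
      rw [eventually_map]
      refine .of_forall fun k => ?_
      have h1 := abs_setIntegral_far_le hn hC.hs₂.1 hρ (hK₂ k) hν h hL ((hmA k).prod (hmD k))
      rwa [setIntegral_eq_far h (hmA k) (hmD k) hρ (hdisj k) le_rfl] at h1
  have hV₁lim : Tendsto V₁ atTop (𝓝 0) := by
    have := hlim.sub hV₂lim
    rw [sub_zero] at this
    exact this.congr fun k => add_sub_cancel_right _ _
  -- For fixed `ε`, `V₁` differs from its truncation by an error uniform in `k`. Letting `k → ∞`,
  -- the truncation converges and `V₁ → 0`, so the truncated limit is bounded by that same error,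
  -- which vanishes with `ε`.
  have hbound : ∀ ε, 0 < ε → ε ≤ ρ → |∫ p in (E' ×ˢ B') ∩ farSet n ε,
      firstVar (isoKernel n s₁ a) ν (bump z₀ ρ) p.1 p.2| ≤
      3 * lam * L * C * ∫ v in Metric.ball (0 : Eu n) ε, ‖v‖ ^ (-(n + s₁) + 1) := by
    intro ε hε hερ
    have hker : ∀ z : Eu n, z ≠ 0 → Tendsto (fun k => scaledKernel s₁ (r k) K₁ z) atTop
        (𝓝 (isoKernel n s₁ a z)) := fun z hz =>
      ha₁.tendsto_scaledKernel hconst hB.r_pos hB.r_tendsto hz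
    have hfar := tendsto_setIntegral_far hn hC.hs₁.1 hε hK₁ hν h hmA hmB hB.measE' hB'm hB.mem_E
      hB' (F := fun p => firstVar (isoKernel n s₁ a) ν (bump z₀ ρ) p.1 p.2) (fun p hp => by
        have hne : p.1 - p.2 ≠ 0 := sub_ne_zero.2 hp
        refine ((tendsto_fderiv_scaledKernel hC.hs₁.1 hC.lam_pos.le hC.hK₁ hB.r_pos hker hne
          ((kernelBound_isoKernel hC.hs₁.1 ha).differentiableAt hne) hν).mul_const _).add
          ((hker _ hne).mul_const _))
    have h1 := (hV₁lim.sub hfar).abs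
    rw [zero_sub, abs_neg] at h1
    exact le_of_tendsto h1 (.of_forall fun k =>
      hB.setIntegral_near_far hn hC.hs₁ (hK₁ k) hEm hΩm hν h hL hε hερ k)
  have hz := (tendsto_near_zero hn hC.hs₁.2).const_mul (3 * lam * L * C)
  rw [mul_zero] at hz
  refine squeeze_zero_norm' ?_ hz
  filter_upwards [Ioc_mem_nhdsGT hρ] with ε hε
  exact hbound ε hε.1 hε.2

/-- When adhesion is negligible, the blow-up limit cannot be an asymmetric wedge or strip. -/
theorem IsBlowUp.false_of_asymmetric (hB : IsBlowUp Ω E Ω' E' c r z₀ ρ C)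
    (hC : CriticalSetting n s₁ s₂ lam σ ϱ K₁ K₂ g Ω E) (hν : ‖ν‖ = 1)
    (hz₀ : inner ℝ ν z₀ = 0) (heν : 0 < inner ℝ e ν) {b : ℝ} (hb : 0 ≤ b)
    (hball : ∀ x ∈ Metric.ball z₀ (2 * ρ), -b < inner ℝ e x ∧ -b < inner ℝ e (mirror ν x))
    (hΩ' : Ω' = {x | -b < inner ℝ e x})
    (hE' : E' = {x | -b < inner ℝ e x ∧ inner ℝ ν x < 0} ∨
      E' = {x | -b < inner ℝ e x ∧ 0 < inner ℝ ν x})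
    {a₁ : Eu n → ℝ} (ha₁ : HasBlowUp s₁ a₁ K₁)
    (hconst : ∃ a : ℝ, ∀ w ∈ Metric.sphere (0 : Eu n) 1, a₁ w = a)
    (hs : σ = 0 ∨ s₂ < s₁) : False := by
  have hEm := hC.hE.measurableSet
  have hn := hC.n_pos
  obtain ⟨a, hconst⟩ := hconst
  have ha : 0 < a := by
    obtain ⟨l, _, hl, hbd⟩ := ha₁.bounds
    have hνs : ν ∈ Metric.sphere (0 : Eu n) 1 := by simpa using hν
    have := (hbd ν hνs).1
    rw [hconst ν hνs] at this
    linarith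
  obtain ⟨δ, hδ, hwedge⟩ := exists_wedge_firstVar_ge (c := a) hn hC.hs₁.1 ha hν hz₀ heν hb hB.ρ_pos hball
  have hν' : ‖-ν‖ = 1 := by rwa [norm_neg]
  have hplane : ∀ᵐ x : Eu n, inner ℝ ν x ≠ 0 := by
    rw [ae_iff]; simpa using volume_hyperplane hν
  have hzoom : ∀ k x, x ∈ zoom (Eᶜ ∩ Ω) (c k) (r k) ↔
      x ∈ zoom Ω (c k) (r k) ∧ x ∉ zoom E (c k) (r k) := fun k x => and_comm
  have hmeas (s : Set ℝ) (hs : MeasurableSet s) : MeasurableSet {x | -b < inner ℝ e x ∧ inner ℝ ν x ∈ s} :=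
    (measurableSet_lt measurable_const (measurable_inner_left e)).inter (measurable_inner_left ν hs)
  have hcontra : ∀ J : ℝ → ℝ, Tendsto J (𝓝[>] 0) (𝓝 0) →
      (∀ ε, 0 < ε → ε ≤ ρ → δ ≤ J ε) → False := by
    intro J hJ hJδ
    have h1 := ge_of_tendsto hJ (b := δ) (by
      filter_upwards [Ioc_mem_nhdsGT hB.ρ_pos] with ε hε using hJδ ε hε.1 hε.2)
    linarith
  rcases hE' with rfl | rfl
  · obtain ⟨w, hw, hw0⟩ := hB.exists_test_ne_zero hEm hν hz₀ fun x hx =>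
      ⟨fun h => h.2, fun h => ⟨(hball x hx).1, h⟩⟩
    refine hcontra _ (hB.tendsto_truncated_zero hC hν hw hw0 ha₁ ha hconst hs
      (B' := {x | -b < inner ℝ e x ∧ 0 < inner ℝ ν x}) (hmeas (Ioi 0) measurableSet_Ioi) ?_) hwedge
    filter_upwards [hB.mem_Ω, hB.mem_E, hplane] with x h1 h2 h3
    filter_upwards [h1, h2] with k h1 h2
    rw [hzoom, h1, h2, hΩ']
    simp only [mem_ofPred_eq, not_and, not_lt]
    exact ⟨fun h => ⟨h.1, (h.2 h.1).lt_of_ne' h3⟩, fun h => ⟨h.1, fun _ => h.2.le⟩⟩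
  · obtain ⟨w, hw, hw0⟩ := hB.exists_test_ne_zero hEm hν' (by rw [inner_neg_left, hz₀, neg_zero])
      fun x hx => ⟨fun h => by rw [inner_neg_left]; linarith [h.2],
        fun h => ⟨(hball x hx).1, by rw [inner_neg_left] at h; linarith⟩⟩
    have hw0' : ∫ x in E, fderiv ℝ w x ν ≠ 0 := by
      simp only [map_neg, integral_neg] at hw0
      simpa using hw0
    refine hcontra _ (hB.tendsto_truncated_zero hC hν hw hw0' ha₁ ha hconst hs
      (B' := {x | -b < inner ℝ e x ∧ inner ℝ ν x < 0}) (hmeas (Iio 0) measurableSet_Iio) ?_)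
      (fun ε hε hερ => ?_)
    · filter_upwards [hB.mem_Ω, hB.mem_E, hplane] with x h1 h2 h3
      filter_upwards [h1, h2] with k h1 h2
      rw [hzoom, h1, h2, hΩ']
      simp only [mem_ofPred_eq, not_and, not_lt]
      exact ⟨fun h => ⟨h.1, (h.2 h.1).lt_of_ne h3⟩, fun h => ⟨h.1, fun _ => h.2.le⟩⟩
    -- The first variation is symmetric in the two sets, so exchanging the roles of `E'` and its
    -- complement in the container leaves the integral unchanged.
    · rw [setIntegral_swap]
      exact hwedge ε hε hερ

end

/-! ### Level sets of strictly differentiable functions -/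

section

variable {f : Eu n → ℝ} {f' : Eu n →L[ℝ] ℝ} {ε : ℝ≥0} {u x₀ : Eu n}

/-- A packing argument: the sublevel sets of `|f|` have small measure. -/
lemma volume_abs_le_le {S T : Set (Eu n)} (h : ApproximatesLinearOn f f' S ε) (hu : f' u = 1)
    (hεu : ε * ‖u‖ ≤ 1 / 2) (hT : IsOpen T) {s : ℝ} (hs : 0 < s)
    (hTS : ∀ x ∈ T, ∀ τ ∈ Icc 0 s, x + τ • u ∈ S) {t : ℝ} (ht : 0 < t) :
    volume {x ∈ T | |f x| ≤ t} ≤ ENNReal.ofReal (10 * t / s) * volume S := by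
  have hTS₀ : T ⊆ S := fun x hx => by simpa using hTS x hx 0 ⟨le_rfl, hs.le⟩
  set A : Set (Eu n) := {x ∈ T | |f x| ≤ t} with hA
  have hAm : MeasurableSet A := by
    have h1 : IsOpen (T ∩ (fun x => |f x|) ⁻¹' Ioi t) :=
      (h.continuousOn.mono hTS₀).abs.isOpen_inter_preimage hT isOpen_Ioi
    have h2 : A = T \ (T ∩ (fun x => |f x|) ⁻¹' Ioi t) := by
      ext x
      simp only [hA, mem_ofPred_eq, Set.mem_sdiff, mem_inter_iff, mem_preimage, mem_Ioi, not_and, not_lt]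
      tauto
    rw [h2]
    exact hT.measurableSet.diff h1.measurableSet
  -- The translates of `A` by `0, 5t, 10t, …` along `u`, up to length `s`, stay in `S`. They are
  -- disjoint: `f` grows along `u` at rate at least `1/2`, so a shift by `5t` changes it by at least
  -- `5t/2`, more than the width `2t` of the band. The `+ 1` counts the zero shift.
  set N : ℕ := ⌊s / (5 * t)⌋₊ + 1 with hN
  have hN1 : s / (5 * t) < N := by rw [hN]; push_cast; exact Nat.lt_floor_add_one _
  have hNs : ∀ j ∈ Finset.range N, (j : ℝ) * (5 * t) ∈ Icc 0 s := fun j hj => by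
    have h1 : (j : ℝ) ≤ ⌊s / (5 * t)⌋₊ := by
      exact_mod_cast Nat.lt_succ_iff.1 (Finset.mem_range.1 hj)
    have h2 := h1.trans (Nat.floor_le (by positivity))
    exact ⟨by positivity, (le_div_iff₀ (by positivity)).1 h2⟩
  set P : ℕ → Set (Eu n) := fun j => (fun x => x - ((j : ℝ) * (5 * t)) • u) ⁻¹' A with hP
  have hPm (j : ℕ) : MeasurableSet (P j) := hAm.preimage (by fun_prop)
  have hPv (j : ℕ) : volume (P j) = volume A := by
    simp only [hP, sub_eq_add_neg]
    exact measure_preimage_add_right _ _ _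
  have hPS : ⋃ j ∈ Finset.range N, P j ⊆ S := by
    intro x hx
    simp only [mem_iUnion] at hx
    obtain ⟨j, hj, hx⟩ := hx
    have := hTS _ hx.1 _ (hNs j hj)
    rwa [sub_add_cancel] at this
  have hdisj' : ∀ i ∈ Finset.range N, ∀ j ∈ Finset.range N, i < j → Disjoint (P i) (P j) := by
    intro i hi j hj hij
    rw [disjoint_left]
    intro x hxi hxj
    have h1 := h _ (hTS₀ hxi.1) _ (hTS₀ hxj.1)
    have hij1 : (1 : ℝ) ≤ j - i := by
      have : ((i + 1 : ℕ) : ℝ) ≤ j := by exact_mod_cast hij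
      push_cast at this; linarith
    have h2 : x - ((i : ℝ) * (5 * t)) • u - (x - ((j : ℝ) * (5 * t)) • u) =
        (((j : ℝ) - i) * (5 * t)) • u := by module
    have hm : 0 ≤ ((j : ℝ) - i) * (5 * t) := by positivity
    rw [h2, map_smul, hu, norm_smul, Real.norm_eq_abs, Real.norm_of_nonneg hm, smul_eq_mul,
      mul_one] at h1
    have h3 := (abs_le.1 h1).1
    have h4 := abs_le.1 hxi.2
    have h5 := abs_le.1 hxj.2
    have h6 : (ε : ℝ) * (((j : ℝ) - i) * (5 * t) * ‖u‖) ≤ 1 / 2 * (((j : ℝ) - i) * (5 * t)) := by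
      nlinarith
    nlinarith [h4.1, h4.2, h5.1, h5.2]
  have hdisj : Set.PairwiseDisjoint (Finset.range N : Set ℕ) P := by
    intro i hi j hj hij
    rcases hij.lt_or_gt with h | h
    · exact hdisj' i hi j hj h
    · exact (hdisj' j hj i hi h).symm
  have hsum : (N : ℝ≥0∞) * volume A ≤ volume S := by
    have h1 := measure_biUnion_finset (μ := volume) hdisj fun j _ => hPm j
    simp only [hPv, Finset.sum_const, Finset.card_range, nsmul_eq_mul] at h1
    rw [← h1]
    exact measure_mono hPS
  have h1 : 1 ≤ ENNReal.ofReal (10 * t / s) * N := by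
    rw [← ENNReal.ofReal_natCast, ← ENNReal.ofReal_mul (by positivity), ENNReal.one_le_ofReal]
    have : 10 * t / s * (s / (5 * t)) = 2 := by field_simp; norm_num
    nlinarith [mul_lt_mul_of_pos_left hN1 (by positivity : 0 < 10 * t / s)]
  calc volume A = 1 * volume A := (one_mul _).symm
    _ ≤ ENNReal.ofReal (10 * t / s) * N * volume A := by gcongr
    _ = ENNReal.ofReal (10 * t / s) * (N * volume A) := mul_assoc _ _ _
    _ ≤ _ := by gcongr

/-- A connected set that misses the frontier lies entirely in the interior or entirely in the
exterior. -/
lemma mem_iff_of_segment {F : Set (Eu n)} {a b : Eu n} (h : ∀ x ∈ segment ℝ a b, x ∉ frontier F) :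
    a ∈ F ↔ b ∈ F := by
  have hconn := (convex_segment (𝕜 := ℝ) a b).isPreconnected
  have key : ∀ x ∈ segment ℝ a b, ∀ y ∈ segment ℝ a b, x ∈ F → y ∈ F := fun x hx y hy hxF => by
    by_contra hyF
    have hmem : ∀ z ∈ segment ℝ a b, z ∈ closure F → z ∈ interior F := fun z hz hzc => by
      by_contra hzi
      exact h z hz ⟨hzc, hzi⟩
    obtain ⟨z, -, hz₁, hz₂⟩ := hconn _ _ isOpen_interior isClosed_closure.isOpen_compl
      (fun z hz => (em (z ∈ closure F)).imp (hmem z hz) id) ⟨x, hx, hmem x hx (subset_closure hxF)⟩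
      ⟨y, hy, fun hyc => hyF (interior_subset (hmem y hy hyc))⟩
    exact hz₂ (subset_closure (interior_subset hz₁))
  exact ⟨key _ (left_mem_segment _ _ _) _ (right_mem_segment _ _ _),
    key _ (right_mem_segment _ _ _) _ (left_mem_segment _ _ _)⟩

/-- A perimeter bound for a set whose boundary lies in a level set of a `C¹` function. -/
lemma volume_exit_le {S F : Set (Eu n)} {z₀ : Eu n} {R : ℝ} (hS : volume S ≠ ∞)
    (h : ApproximatesLinearOn f f' S ε) (hu : f' u = 1) (hεu : ε * ‖u‖ ≤ 1 / 2)
    (hTS : ∀ x ∈ Metric.ball z₀ R, ∀ τ ∈ Icc (0 : ℝ) 1, x + τ • u ∈ S)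
    (hF : ∀ x ∈ Metric.ball z₀ R, x ∈ frontier F → f x = 0) (v : Eu n) :
    volume {x | x ∈ Metric.ball z₀ R ∧ x + v ∈ Metric.ball z₀ R ∧ x ∈ F ∧ x + v ∉ F} ≤
      ENNReal.ofReal (10 * (‖f'‖ + ε) * volume.real S * ‖v‖) := by
  have hBS : Metric.ball z₀ R ⊆ S := fun x hx => by simpa using hTS x hx 0 ⟨le_rfl, zero_le_one⟩
  have hf' : 0 < ‖f'‖ := norm_pos_iff.2 fun h0 => by simp [h0] at hu
  rcases eq_or_ne v 0 with rfl | hv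
  · have : {x | x ∈ Metric.ball z₀ R ∧ x + 0 ∈ Metric.ball z₀ R ∧ x ∈ F ∧ x + 0 ∉ F} = ∅ := by
      ext x; simp only [add_zero, mem_ofPred_eq, mem_empty_iff_false, iff_false]; tauto
    rw [this]; simp
  have hv0 : 0 < ‖v‖ := norm_pos_iff.2 hv
  have ht : 0 < (‖f'‖ + ε) * ‖v‖ := by positivity
  have hsub : {x | x ∈ Metric.ball z₀ R ∧ x + v ∈ Metric.ball z₀ R ∧ x ∈ F ∧ x + v ∉ F} ⊆
      {x ∈ Metric.ball z₀ R | |f x| ≤ (‖f'‖ + ε) * ‖v‖} := by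
    rintro x ⟨hx, hxv, hxF, hxvF⟩
    refine ⟨hx, ?_⟩
    -- A segment that leaves `F` crosses its frontier, where `f` vanishes; hence `|f x|` is at most
    -- the Lipschitz constant times `‖v‖`, and the band estimate applies.
    obtain ⟨w, hw, hwF⟩ : ∃ w ∈ segment ℝ x (x + v), w ∈ frontier F := by
      by_contra! hcon
      exact hxvF ((mem_iff_of_segment hcon).1 hxF)
    have hwB : w ∈ Metric.ball z₀ R := (convex_ball z₀ R).segment_subset hx hxv hw
    have h1 := h x (hBS hx) w (hBS hwB)
    rw [hF w hwB hwF, sub_zero, Real.norm_eq_abs] at h1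
    have h2 : ‖x - w‖ ≤ ‖v‖ := by
      rw [segment_eq_image'] at hw
      obtain ⟨τ, hτ, rfl⟩ := hw
      have : x - (x + τ • (x + v - x)) = -(τ • v) := by module
      rw [this, norm_neg, norm_smul, Real.norm_of_nonneg hτ.1]
      exact mul_le_of_le_one_left (norm_nonneg _) hτ.2
    have h3 : |f' (x - w)| ≤ ‖f'‖ * ‖x - w‖ := f'.le_opNorm _
    have h4 : |f x| ≤ |f x - f' (x - w)| + |f' (x - w)| := by
      simpa using abs_add_le (f x - f' (x - w)) (f' (x - w))
    have h5 : (‖f'‖ + ε) * ‖x - w‖ ≤ (‖f'‖ + ε) * ‖v‖ := by gcongr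
    nlinarith
  refine (measure_mono hsub).trans ((volume_abs_le_le h hu hεu Metric.isOpen_ball one_pos hTS
    ht).trans ?_)
  rw [← ENNReal.ofReal_toReal hS, ← ENNReal.ofReal_mul (by positivity)]
  refine ENNReal.ofReal_le_ofReal (le_of_eq ?_)
  rw [Measure.real]
  ring

lemma exists_apply_eq_one (hf' : f' ≠ 0) : ∃ u, f' u = 1 := by
  obtain ⟨v, hv⟩ := DFunLike.ne_iff.1 hf'
  exact ⟨(f' v)⁻¹ • v, by rw [map_smul, smul_eq_mul]; exact inv_mul_cancel₀ hv⟩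

lemma exists_ball_approximatesLinearOn (hf : HasStrictFDerivAt f f' x₀) (hε : 0 < ε) :
    ∃ δ > 0, ApproximatesLinearOn f f' (Metric.ball x₀ δ) ε := by
  obtain ⟨s, hs, h⟩ := hf.approximates_deriv_on_nhds (.inr hε)
  obtain ⟨δ, hδ, hδs⟩ := Metric.mem_nhds_iff.1 hs
  exact ⟨δ, hδ, h.mono_set hδs⟩

/-- Linear approximation is scale invariant, with the same `f'` and `ε`. This makes the perimeter
bound uniform along a blow-up. -/
lemma ApproximatesLinearOn.zoom {S : Set (Eu n)} (h : ApproximatesLinearOn f f' S ε) (c : Eu n)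
    {r : ℝ} (hr : 0 < r) :
    ApproximatesLinearOn (fun y => r⁻¹ * f (c + r • y)) f' (NonlocalCapillarity.zoom S c r) ε := by
  intro y hy z hz
  have h1 := h _ hy _ hz
  have h2 : c + r • y - (c + r • z) = r • (y - z) := by module
  rw [h2, map_smul, norm_smul, Real.norm_of_nonneg hr.le, smul_eq_mul] at h1
  have h3 : r⁻¹ * f (c + r • y) - r⁻¹ * f (c + r • z) - f' (y - z) =
      r⁻¹ * (f (c + r • y) - f (c + r • z) - r * f' (y - z)) := by
    field_simp
  rw [h3, norm_mul, norm_inv, Real.norm_of_nonneg hr.le, inv_mul_le_iff₀ hr]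
  linarith

lemma frontier_zoom (F : Set (Eu n)) (c : Eu n) {r : ℝ} (hr : r ≠ 0) :
    frontier (zoom F c r) = zoom (frontier F) c r :=
  (((Homeomorph.smulOfNeZero r hr).trans (Homeomorph.addLeft c)).preimage_frontier F).symm

variable {c : ℕ → Eu n} {r : ℕ → ℝ}

/-- Compact sets are eventually mapped into a neighbourhood of the base point. -/
lemma eventually_zoom_subset (hc : Tendsto c atTop (𝓝 x₀)) (hr : Tendsto r atTop (𝓝 0))
    {P : Eu n → Prop} (hP : ∀ᶠ x in 𝓝 x₀, P x) (R : ℝ) :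
    ∀ᶠ k in atTop, ∀ y ∈ Metric.ball (0 : Eu n) R, P (c k + r k • y) := by
  obtain ⟨δ, hδ, hδP⟩ := Metric.eventually_nhds_iff.1 hP
  have h1 : Tendsto (fun k => dist (c k) x₀ + |r k| * R) atTop (𝓝 0) := by
    have := (tendsto_iff_dist_tendsto_zero.1 hc).add (hr.abs.mul_const R)
    simpa using this
  filter_upwards [h1.eventually_lt_const hδ] with k hk y hy
  refine hδP (lt_of_le_of_lt ?_ hk)
  have h2 : ‖y‖ ≤ R := (mem_ball_zero_iff.1 hy).le
  calc dist (c k + r k • y) x₀ ≤ dist (c k + r k • y) (c k) + dist (c k) x₀ := dist_triangle _ _ _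
    _ = |r k| * ‖y‖ + dist (c k) x₀ := by simp [dist_eq_norm, norm_smul]
    _ ≤ _ := by rw [add_comm]; gcongr

/-- Sign of a strictly differentiable function along a blow-up sequence. -/
lemma eventually_pos_zoom (hf : HasStrictFDerivAt f f' x₀) (hc : Tendsto c atTop (𝓝 x₀))
    (hr : ∀ k, 0 < r k) (hr0 : Tendsto r atTop (𝓝 0)) {β : ℝ}
    (hβ : Tendsto (fun k => f (c k) / r k) atTop (𝓝 β)) {K : Set (Eu n)} (hK : IsCompact K)
    (hpos : ∀ y ∈ K, 0 < f' y + β) :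
    ∀ᶠ k in atTop, ∀ y ∈ K, 0 < f (c k + r k • y) := by
  obtain ⟨R, hR0, hR⟩ := hK.isBounded.subset_ball_lt 0 0
  obtain ⟨m, hm, hmK⟩ : ∃ m, 0 < m ∧ ∀ y ∈ K, m ≤ f' y + β := by
    rcases K.eq_empty_or_nonempty with rfl | hne
    · exact ⟨1, one_pos, by simp⟩
    · obtain ⟨y, hy, hmin⟩ := hK.exists_isMinOn hne
        (by fun_prop : Continuous fun y => f' y + β).continuousOn
      exact ⟨_, hpos y hy, fun z hz => hmin hz⟩
  -- At unit scale the linearization costs at most `m / 3` on the ball of radius `R`, and replacing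
  -- `f (c k) / r k` by `β` costs another `m / 3`; a positive margin is left.
  have hε : 0 < Real.toNNReal (m / (3 * R)) := Real.toNNReal_pos.2 (by positivity)
  obtain ⟨δ, hδ, happ⟩ := exists_ball_approximatesLinearOn hf hε
  filter_upwards [eventually_zoom_subset hc hr0 (Metric.ball_mem_nhds x₀ hδ) R,
    hβ.eventually_const_lt (by linarith : β - m / 3 < β)] with k h1 h2 y hy
  have hrk := hr k
  have h3 := happ _ (h1 y (hR hy)) _ (h1 0 (Metric.mem_ball_self hR0))
  rw [smul_zero, add_zero, add_sub_cancel_left, map_smul, norm_smul, Real.norm_of_nonneg hrk.le,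
    Real.coe_toNNReal _ (by positivity), Real.norm_eq_abs, smul_eq_mul] at h3
  have h4 := (abs_le.1 h3).1
  have h5 : ‖y‖ ≤ R := (mem_ball_zero_iff.1 (hR hy)).le
  have h6 : m / (3 * R) * (r k * ‖y‖) ≤ m / 3 * r k := by
    have : m / (3 * R) * (r k * R) = m / 3 * r k := by field_simp
    rw [← this]; gcongr
  rw [lt_div_iff₀ hrk] at h2
  nlinarith [hmK y hy]

end

/-! ### The local geometry of the liquid interface at a regular contact point -/

/-- Near `x₀`, the interface `Ω ∩ ∂E` lies in a `C¹` hypersurface `{φ = 0}` through `x₀`, and `Ω` is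
the sublevel set `{ψ < 0}`, with `ψ` of class `C¹`. -/
structure IsContactPoint (Ω E : Set (Eu n)) (x₀ : Eu n) (φ ψ : Eu n → ℝ)
    (φ' ψ' : Eu n →L[ℝ] ℝ) : Prop where
  hφ : HasStrictFDerivAt φ φ' x₀
  hψ : HasStrictFDerivAt ψ ψ' x₀
  φ'_ne : φ' ≠ 0
  ψ'_ne : ψ' ≠ 0
  φ_zero : φ x₀ = 0
  ψ_zero : ψ x₀ = 0
  interface : ∀ᶠ x in 𝓝 x₀, x ∈ Ω → x ∈ frontier E → φ x = 0
  domain : ∀ᶠ x in 𝓝 x₀, (x ∈ Ω ↔ ψ x < 0)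
  mem_closure : x₀ ∈ closure (Ω ∩ frontier E)

/-- At interior and at boundary points of the hypersurface alike, the interface is contained in the
zero set of a `C¹` function with nonzero differential; this inclusion is the information carried
forward. -/
lemma exists_isContactPoint {Ω E : Set (Eu n)} {x₀ : Eu n} {s : ℝ} (hΩo : IsOpen Ω)
    (hΩ : HasC1Boundary Ω) (hx₀ : x₀ ∈ regularSet s Ω E ∩ frontier Ω) :
    ∃ φ ψ φ' ψ', IsContactPoint Ω E x₀ φ ψ φ' ψ' := by
  obtain ⟨⟨hcl, δ, α, hδ, -, -, hreg⟩, hfr⟩ := hx₀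
  have hb := Metric.mem_ball_self (x := x₀) hδ
  obtain ⟨W, ψ, hW, hxW, hψ, hψ', hΩW⟩ := hΩ x₀ hfr
  have hψs := (hψ.contDiffAt (hW.mem_nhds hxW)).hasStrictFDerivAt one_ne_zero
  have hmem : ∀ x ∈ W, (x ∈ Ω ↔ ψ x < 0) := fun x hx => by
    have := Set.ext_iff.1 hΩW x
    simp only [mem_inter_iff, mem_ofPred_eq, hx, and_true, true_and] at this
    exact this
  have hψ0 : ψ x₀ = 0 := by
    have h1 : ¬ ψ x₀ < 0 := fun h => by
      have : x₀ ∈ Ω := (hmem x₀ hxW).2 h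
      rw [hΩo.frontier_eq] at hfr
      exact hfr.2 this
    by_contra hne
    have h2 : 0 < ψ x₀ := (not_lt.1 h1).lt_of_ne' hne
    have h3 : ∀ᶠ x in 𝓝 x₀, x ∉ Ω := by
      filter_upwards [hψs.hasFDerivAt.continuousAt.eventually_const_lt h2, hW.mem_nhds hxW]
        with x hx hxW h
      exact lt_asymm hx ((hmem x hxW).1 h)
    exact mem_closure_iff_frequently.1 (frontier_subset_closure hfr) h3
  obtain ⟨U, φ, hU, hxU, hφ, hφ', hφ0, hφU⟩ : ∃ (U : Set (Eu n)) (φ : Eu n → ℝ), IsOpen U ∧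
      x₀ ∈ U ∧ ContDiffOn ℝ 1 φ U ∧ fderiv ℝ φ x₀ ≠ 0 ∧ φ x₀ = 0 ∧
      ∀ x ∈ U, x ∈ Metric.ball x₀ δ → x ∈ liquidInterface Ω E → φ x = 0 := by
    rcases hreg x₀ ⟨hb, hcl⟩ with ⟨U, φ, hU, hxU, hφ, hφ', hS⟩ | ⟨-, U, φ, η, hU, hxU, hφ, -, hφ0, -,
      hli, hS⟩
    · have key : ∀ x ∈ U, x ∈ Metric.ball x₀ δ → x ∈ liquidInterface Ω E → φ x = 0 :=
        fun x hx hxb hxl => ((Set.ext_iff.1 hS x).1 ⟨⟨hxb, hxl⟩, hx⟩).2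
      exact ⟨U, φ, hU, hxU, hφ.1, hφ', key x₀ hxU hb hcl, key⟩
    · refine ⟨U, φ, hU, hxU, hφ.1, hli.ne_zero 0, hφ0, fun x hx hxb hxl => ?_⟩
      exact ((Set.ext_iff.1 hS x).1 ⟨⟨hxb, hxl⟩, hx⟩).2.1
  refine ⟨φ, ψ, fderiv ℝ φ x₀, fderiv ℝ ψ x₀,
    (hφ.contDiffAt (hU.mem_nhds hxU)).hasStrictFDerivAt one_ne_zero, hψs, hφ', hψ', hφ0, hψ0,
    ?_, ?_, hcl⟩
  · filter_upwards [hU.mem_nhds hxU, Metric.ball_mem_nhds x₀ hδ] with x h1 h2 h3 h4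
    exact hφU x h1 h2 (subset_closure ⟨h3, h4⟩)
  · filter_upwards [hW.mem_nhds hxW] with x hx using hmem x hx

section

variable {Ω E Ω' E' : Set (Eu n)} {x₀ z₀ : Eu n} {φ ψ : Eu n → ℝ} {φ' ψ' : Eu n →L[ℝ] ℝ}
  {c : ℕ → Eu n} {r : ℕ → ℝ} {ρ : ℝ}

/-- The perimeter constant depends on the linearization of `φ` and on a fixed ball, not on the
scale; discarding the first `N` terms turns eventual properties into properties of every term. -/
lemma IsContactPoint.exists_isBlowUp (hP : IsContactPoint Ω E x₀ φ ψ φ' ψ')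
    (hc : Tendsto c atTop (𝓝 x₀)) (hr : ∀ k, 0 < r k) (hr0 : Tendsto r atTop (𝓝 0)) (hρ : 0 < ρ)
    (hΩ' : MeasurableSet Ω') (hE' : MeasurableSet E')
    (hmΩ : ∀ᵐ y, ∀ᶠ k in atTop, (y ∈ zoom Ω (c k) (r k) ↔ y ∈ Ω'))
    (hmE : ∀ᵐ y, ∀ᶠ k in atTop, (y ∈ zoom E (c k) (r k) ↔ y ∈ E'))
    (hball : ∀ᶠ k in atTop, Metric.ball z₀ (2 * ρ) ⊆ zoom Ω (c k) (r k)) :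
    ∃ N C, IsBlowUp Ω E Ω' E' (fun k => c (k + N)) (fun k => r (k + N)) z₀ ρ C := by
  obtain ⟨u, hu⟩ := exists_apply_eq_one hP.φ'_ne
  have hu0 : 0 < ‖u‖ := norm_pos_iff.2 fun h => by simp [h] at hu
  set ε : ℝ≥0 := Real.toNNReal (1 / (2 * ‖u‖)) with hε
  have hε0 : 0 < ε := Real.toNNReal_pos.2 (by positivity)
  have hεu : ε * ‖u‖ ≤ 1 / 2 := by
    rw [hε, Real.coe_toNNReal _ (by positivity)]
    apply le_of_eq; field_simp
  obtain ⟨δ, hδ, happ⟩ := exists_ball_approximatesLinearOn hP.hφ hε0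
  set R : ℝ := ‖z₀‖ + 2 * ρ + ‖u‖ with hR
  have hsub : ∀ x ∈ Metric.ball z₀ (2 * ρ), ∀ τ ∈ Icc (0 : ℝ) 1,
      x + τ • u ∈ Metric.ball (0 : Eu n) R := by
    intro x hx τ hτ
    rw [mem_ball_zero_iff]
    have h1 : ‖x - z₀‖ < 2 * ρ := mem_ball_iff_norm.1 hx
    have h2 : ‖τ • u‖ ≤ ‖u‖ := by
      rw [norm_smul, Real.norm_of_nonneg hτ.1]
      exact mul_le_of_le_one_left (norm_nonneg _) hτ.2
    have h3 : ‖x + τ • u‖ ≤ ‖x - z₀‖ + ‖z₀‖ + ‖τ • u‖ := by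
      refine (norm_add_le _ _).trans ?_
      gcongr
      simpa using norm_add_le (x - z₀) z₀
    linarith
  have hev := (eventually_zoom_subset hc hr0 (Metric.ball_mem_nhds x₀ hδ) R).and
    ((eventually_zoom_subset hc hr0 hP.interface R).and hball)
  obtain ⟨N, hN⟩ := eventually_atTop.1 hev
  have hsh {p : ℕ → Prop} (h : ∀ᶠ k in atTop, p k) : ∀ᶠ k in atTop, p (k + N) :=
    (tendsto_add_atTop_nat N).eventually h
  have hcN : Tendsto (fun k => c (k + N)) atTop (𝓝 x₀) := hc.comp (tendsto_add_atTop_nat N)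
  obtain ⟨R', hR'⟩ := (Metric.isBounded_range_of_tendsto _ hcN).exists_norm_le
  refine ⟨N, 10 * (‖φ'‖ + ε) * volume.real (Metric.ball (0 : Eu n) R), fun k => hr _,
    hr0.comp (tendsto_add_atTop_nat N), ⟨R', fun k => hR' _ ⟨k, rfl⟩⟩, hρ, by positivity, hΩ', hE',
    hmΩ.mono fun y hy => hsh hy, hmE.mono fun y hy => hsh hy,
    fun k => (hN _ (Nat.le_add_left _ _)).2.2, fun k v => ?_⟩
  obtain ⟨h1, h2, h3⟩ := hN (k + N) (Nat.le_add_left _ _)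
  have happ' := (ApproximatesLinearOn.zoom happ (c (k + N)) (hr (k + N))).mono_set
    (fun y hy => h1 y hy : Metric.ball (0 : Eu n) R ⊆ _)
  refine volume_exit_le Metric.isBounded_ball.measure_lt_top.ne happ' hu hεu hsub
    (fun x hx hxF => ?_) v
  rw [frontier_zoom _ _ (hr _).ne'] at hxF
  have hxR : x ∈ Metric.ball (0 : Eu n) R := by simpa using hsub x hx 0 ⟨le_rfl, zero_le_one⟩
  rw [h2 x hxR (h3 hx) hxF, mul_zero]

/-- `E` lies on exactly one side of the interface near each of its points. -/
lemma IsContactPoint.opposite_sides (hP : IsContactPoint Ω E x₀ φ ψ φ' ψ') (hΩo : IsOpen Ω)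
    (hEn : IsNormalized Ω E) {ε : ℝ≥0} (hε : 0 < ε) :
    ∃ δ > 0, ∀ p ∈ Ω ∩ frontier E, ∀ w₁ w₂ : Eu n, ε * ‖w₁‖ < φ' w₁ → φ' w₂ < -(ε * ‖w₂‖) →
      segment ℝ p (p + w₁) ⊆ Ω ∩ Metric.ball x₀ δ → segment ℝ p (p + w₂) ⊆ Ω ∩ Metric.ball x₀ δ →
      (p + w₁ ∈ E ↔ p + w₂ ∉ E) := by
  obtain ⟨u, hu⟩ := exists_apply_eq_one hP.φ'_ne
  have hu0 : 0 < ‖u‖ := norm_pos_iff.2 fun h => by simp [h] at hu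
  set ε' : ℝ≥0 := min ε (Real.toNNReal (1 / (2 * ‖u‖))) with hε'
  have hε'0 : 0 < ε' := lt_min hε (Real.toNNReal_pos.2 (by positivity))
  have hεu : ε' * ‖u‖ ≤ 1 / 2 := by
    have h1 : (ε' : ℝ) ≤ 1 / (2 * ‖u‖) := by
      rw [← Real.coe_toNNReal (1 / (2 * ‖u‖)) (by positivity)]
      exact NNReal.coe_le_coe.2 (min_le_right _ _)
    calc ε' * ‖u‖ ≤ 1 / (2 * ‖u‖) * ‖u‖ := by gcongr
      _ = 1 / 2 := by field_simp
  have hε'ε : (ε' : ℝ) ≤ ε := NNReal.coe_le_coe.2 (min_le_left _ _)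
  obtain ⟨δ₁, hδ₁, happ⟩ := exists_ball_approximatesLinearOn hP.hφ hε'0
  obtain ⟨δ₂, hδ₂, hint⟩ := Metric.eventually_nhds_iff_ball.1 hP.interface
  refine ⟨min δ₁ δ₂, lt_min hδ₁ hδ₂, fun p hp w₁ w₂ hw₁ hw₂ hseg₁ hseg₂ => ?_⟩
  set δ := min δ₁ δ₂
  set U : Set (Eu n) := Ω ∩ Metric.ball x₀ δ with hU
  have hUo : IsOpen U := hΩo.inter Metric.isOpen_ball
  have hpU : p ∈ U := hseg₁ (left_mem_segment _ _ _)
  have happU : ApproximatesLinearOn φ φ' U ε' :=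
    happ.mono_set (inter_subset_right.trans (Metric.ball_subset_ball (min_le_left _ _)))
  have hintU : ∀ x ∈ U, x ∈ frontier E → φ x = 0 := fun x hx hxE =>
    hint x (Metric.ball_subset_ball (min_le_right _ _) hx.2) hx.1 hxE
  -- a small translate of each segment stays in `U`
  have hnear : ∀ w, segment ℝ p (p + w) ⊆ U → ∀ᶠ v in 𝓝 (0 : Eu n),
      ∀ τ ∈ Icc (0 : ℝ) 1, p + τ • w + v ∈ U := by
    intro w hw
    have hopen : IsOpen {q : Eu n × ℝ | p + q.2 • w + q.1 ∈ U} :=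
      hUo.preimage (by fun_prop)
    refine isCompact_Icc.eventually_forall_of_forall_eventually fun τ hτ => ?_
    refine hopen.mem_nhds ?_
    change p + τ • w + 0 ∈ U
    rw [add_zero]
    refine hw ?_
    rw [segment_eq_image']
    exact ⟨τ, hτ, by simp⟩
  have hφp : φ p = 0 := hintU p hpU hp.2
  -- A point `p + v` on the side of `w` is joined to `p + w` without meeting the interface. From `p
  -- + v` to `p + v + w` the function `φ` moves further from zero; from there to `p + w` the path
  -- stays in a small ball where `φ` does not vanish.
  have hside : ∀ w, segment ℝ p (p + w) ⊆ U → ε' * ‖w‖ < |φ' w| →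
      ∀ᶠ v in 𝓝 (0 : Eu n), 0 < φ (p + v) * φ' w → (p + v ∈ E ↔ p + w ∈ E) := by
    intro w hw hwφ
    have hstep : ∀ x τ, x ∈ U → x + τ • w ∈ U → τ ∈ Icc (0 : ℝ) 1 →
        φ x * φ' w + τ * (|φ' w| * (|φ' w| - ε' * ‖w‖)) ≤ φ (x + τ • w) * φ' w := by
      intro x τ hx hxτ hτ
      have h1 := happU _ hxτ _ hx
      rw [add_sub_cancel_left, map_smul, norm_smul, Real.norm_of_nonneg hτ.1, smul_eq_mul,
        Real.norm_eq_abs] at h1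
      have h2 : |(φ (x + τ • w) - φ x - τ * φ' w) * φ' w| ≤ ε' * (τ * ‖w‖) * |φ' w| := by
        rw [abs_mul]; gcongr
      have h3 := (abs_le.1 h2).1
      linear_combination h3 + τ * abs_mul_abs_self (φ' w)
    have hgap : 0 < |φ' w| * (|φ' w| - ε' * ‖w‖) := by
      have : 0 ≤ ε' * ‖w‖ := by positivity
      exact mul_pos (by linarith) (by linarith)
    have hwU : p + w ∈ U := hw (right_mem_segment _ _ _)
    have hpw : 0 < φ (p + w) * φ' w := by
      have := hstep p 1 hpU (by simpa using hwU) ⟨zero_le_one, le_rfl⟩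
      rw [hφp, one_smul] at this
      linarith
    have hG : IsOpen (U ∩ (fun y => φ y * φ' w) ⁻¹' Ioi 0) :=
      (happU.continuousOn.mul continuousOn_const).isOpen_inter_preimage hUo isOpen_Ioi
    obtain ⟨η, hη, hηG⟩ := Metric.isOpen_iff.1 hG (p + w) ⟨hwU, hpw⟩
    filter_upwards [hnear w hw, Metric.ball_mem_nhds 0 hη] with v h1 h2 h3
    rw [mem_ball_zero_iff] at h2
    have e1 : p + v ∈ E ↔ p + v + w ∈ E := by
      refine mem_iff_of_segment fun x hx hxE => ?_
      rw [segment_eq_image'] at hx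
      obtain ⟨τ, hτ, rfl⟩ := hx
      have e0 : p + v + τ • (p + v + w - (p + v)) = p + v + τ • w := by module
      have e3 : p + τ • w + v = p + v + τ • w := by module
      have hU1 := h1 τ hτ
      have hU2 := h1 0 ⟨le_rfl, zero_le_one⟩
      rw [zero_smul, add_zero] at hU2
      rw [e3] at hU1
      simp only [e0] at hxE
      have h4 := hstep (p + v) τ hU2 hU1 hτ
      rw [hintU _ hU1 hxE] at h4
      have := mul_nonneg hτ.1 hgap.le
      linarith
    have e2 : p + w ∈ E ↔ p + v + w ∈ E := by
      refine mem_iff_of_segment fun x hx hxE => ?_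
      rw [segment_eq_image'] at hx
      obtain ⟨τ, hτ, rfl⟩ := hx
      have e0 : p + w + τ • (p + v + w - (p + w)) = p + w + τ • v := by module
      simp only [e0] at hxE
      have h4 : p + w + τ • v ∈ Metric.ball (p + w) η := by
        rw [mem_ball_iff_norm, add_sub_cancel_left, norm_smul, Real.norm_of_nonneg hτ.1]
        exact (mul_le_of_le_one_left (norm_nonneg _) hτ.2).trans_lt h2
      obtain ⟨h5, h6⟩ := hηG h4
      simp only [mem_preimage, hintU _ h5 hxE, zero_mul, mem_Ioi, lt_irrefl] at h6
    rw [e1, e2]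
  have hw₁0 : 0 < φ' w₁ := lt_of_le_of_lt (by positivity) hw₁
  have hw₂0 : φ' w₂ < 0 := hw₂.trans_le (by rw [neg_nonpos]; positivity)
  have hb₁ : ε' * ‖w₁‖ ≤ ε * ‖w₁‖ := by gcongr
  have hb₂ : ε' * ‖w₂‖ ≤ ε * ‖w₂‖ := by gcongr
  obtain ⟨η₁, hη₁, hUη⟩ := Metric.isOpen_iff.1 hUo p hpU
  obtain ⟨η₂, hη₂, hη⟩ := Metric.eventually_nhds_iff_ball.1
    ((hside w₁ hseg₁ (by rw [abs_of_pos hw₁0]; linarith)).and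
      (hside w₂ hseg₂ (by rw [abs_of_neg hw₂0]; linarith)))
  set η : ℝ := min η₁ η₂ / 2 with hηdef
  have hη0 : 0 < η := half_pos (lt_min hη₁ hη₂)
  have hηη₁ : 2 * η ≤ η₁ := by rw [hηdef]; linarith [min_le_left η₁ η₂]
  have hηη₂ : η ≤ η₂ := by rw [hηdef]; linarith [min_le_right η₁ η₂]
  -- The zero set is null: let the width of the band tend to zero in the packing estimate.
  have hnull : volume {x ∈ Metric.ball p η | φ x = 0} = 0 := by
    have hUfin : volume U ≠ ∞ :=
      ((measure_mono inter_subset_right).trans_lt Metric.isBounded_ball.measure_lt_top).ne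
    have h1 : ∀ t > 0, volume {x ∈ Metric.ball p η | φ x = 0} ≤
        ENNReal.ofReal (10 * t / (η / ‖u‖)) * volume U := by
      intro t ht
      have hsub : {x ∈ Metric.ball p η | φ x = 0} ⊆ {x ∈ Metric.ball p η | |φ x| ≤ t} :=
        fun x hx => ⟨hx.1, by rw [hx.2, abs_zero]; exact ht.le⟩
      refine (measure_mono hsub).trans (volume_abs_le_le happU hu hεu
        Metric.isOpen_ball (by positivity : 0 < η / ‖u‖) (fun x hx τ hτ => hUη ?_) ht)
      have h2 : ‖τ • u‖ ≤ η := by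
        rw [norm_smul, Real.norm_of_nonneg hτ.1, ← le_div_iff₀ hu0]; exact hτ.2
      have h3 := mem_ball_iff_norm.1 hx
      have h4 := norm_add_le (x - p) (τ • u)
      rw [mem_ball_iff_norm, show x + τ • u - p = x - p + τ • u by module]
      linarith
    have h2 : Tendsto (fun t : ℝ => ENNReal.ofReal (10 * t / (η / ‖u‖)) * volume U) (𝓝[>] 0)
        (𝓝 0) := by
      have h3 : Tendsto (fun t : ℝ => 10 * t / (η / ‖u‖)) (𝓝[>] 0) (𝓝 0) := by
        have : Continuous fun t : ℝ => 10 * t / (η / ‖u‖) := by fun_prop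
        simpa using (this.tendsto 0).mono_left nhdsWithin_le_nhds
      have h4 := ENNReal.Tendsto.mul_const (ENNReal.tendsto_ofReal h3) (.inr hUfin)
      simpa using h4
    exact le_antisymm (ge_of_tendsto h2 (by
      filter_upwards [self_mem_nhdsWithin] with t ht using h1 t ht)) zero_le
  by_contra hcon
  have hsame : p + w₁ ∈ E ↔ p + w₂ ∈ E := by tauto
  -- If both sides had the same status, `E` would be null or of full measure in a small ball around
  -- `p`, against the normalization.
  have hstatus : ∀ x ∈ Metric.ball p η, φ x ≠ 0 → (x ∈ E ↔ p + w₁ ∈ E) := by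
    intro x hx hx0
    have h1 : x - p ∈ Metric.ball 0 η₂ := by
      rw [mem_ball_zero_iff]; exact (mem_ball_iff_norm.1 hx).trans_le hηη₂
    obtain ⟨h2, h3⟩ := hη _ h1
    rw [add_sub_cancel] at h2 h3
    rcases hx0.lt_or_gt with h | h
    · rw [h3 (mul_pos_of_neg_of_neg h hw₂0), hsame]
    · exact h2 (mul_pos h hw₁0)
  obtain ⟨hn₁, hn₂⟩ := hEn p hp η hη0
  by_cases hw : p + w₁ ∈ E
  · refine hn₂.not_ge ?_
    have h1 : Metric.ball p η ⊆ (E ∩ Metric.ball p η) ∪ {x ∈ Metric.ball p η | φ x = 0} := by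
      intro x hx
      by_cases hx0 : φ x = 0
      · exact .inr ⟨hx, hx0⟩
      · exact .inl ⟨(hstatus x hx hx0).2 hw, hx⟩
    calc volume (Metric.ball p η) ≤ _ := measure_mono h1
      _ ≤ _ := measure_union_le _ _
      _ = _ := by rw [hnull, add_zero]
  · refine hn₁.ne' (measure_mono_null (fun x hx => ?_) hnull)
    refine ⟨hx.2, ?_⟩
    by_contra hx0
    exact hw ((hstatus x hx.2 hx0).1 hx.1)

end

/-! ### Blow-up sequences at a contact point -/

lemma rescale_eq_zoom (F : Set (Eu n)) (c : Eu n) {r : ℝ} (hr : r ≠ 0) :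
    rescale F c r = zoom F c r := by
  ext y
  rw [mem_zoom, rescale, mem_image]
  constructor
  · rintro ⟨x, hx, rfl⟩
    simpa [smul_smul, hr] using hx
  · intro hy
    exact ⟨_, hy, by simp [smul_smul, hr]⟩

/-- Borel–Cantelli for the symmetric differences on the growing balls, which eventually contain any
given point. -/
lemma ae_eventually_mem_iff {A : ℕ → Set (Eu n)} {G : Set (Eu n)}
    (h : ∀ k, volume ((A k ∆ G) ∩ Metric.closedBall 0 k) ≤ (1 / 2) ^ k) :
    ∀ᵐ y, ∀ᶠ k in atTop, (y ∈ A k ↔ y ∈ G) := by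
  have h1 : ∑' k, volume ((A k ∆ G) ∩ Metric.closedBall 0 (k : ℝ)) ≠ ∞ := by
    refine ((ENNReal.tsum_le_tsum h).trans_lt ?_).ne
    rw [ENNReal.tsum_geometric, one_div, ENNReal.one_sub_inv_two, inv_inv]
    exact ENNReal.ofNat_lt_top
  filter_upwards [ae_eventually_notMem h1] with y hy
  filter_upwards [hy, eventually_ge_atTop ⌈‖y‖⌉₊] with k h2 h3
  have h4 : y ∈ Metric.closedBall (0 : Eu n) k := by
    rw [mem_closedBall_zero_iff]
    exact (Nat.le_ceil _).trans (by exact_mod_cast h3)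
  have h5 : y ∉ A k ∆ G := fun h => h2 ⟨h, h4⟩
  rw [Set.mem_symmDiff] at h5
  tauto

lemma BlowUpTendsto.exists_seq {F₁ F₂ G₁ G₂ : Set (Eu n)} {x₀ : Eu n}
    (h₁ : BlowUpTendsto F₁ x₀ G₁) (h₂ : BlowUpTendsto F₂ x₀ G₂) :
    ∃ r : ℕ → ℝ, (∀ k, 0 < r k) ∧ Tendsto r atTop (𝓝 0) ∧
      (∀ᵐ y, ∀ᶠ k in atTop, (y ∈ zoom F₁ x₀ (r k) ↔ y ∈ G₁)) ∧
      ∀ᵐ y, ∀ᶠ k in atTop, (y ∈ zoom F₂ x₀ (r k) ↔ y ∈ G₂) := by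
  have hex : ∀ k : ℕ, ∃ r : ℝ, r ∈ Ioo (0 : ℝ) (1 / (k + 1)) ∧
      volume ((rescale F₁ x₀ r ∆ G₁) ∩ Metric.closedBall 0 (k : ℝ)) ≤ (1 / 2) ^ k ∧
      volume ((rescale F₂ x₀ r ∆ G₂) ∩ Metric.closedBall 0 (k : ℝ)) ≤ (1 / 2) ^ k := by
    intro k
    have hp : (0 : ℝ≥0∞) < (1 / 2) ^ k := by
      refine pos_iff_ne_zero.2 (pow_ne_zero _ ?_)
      simp
    have e1 := (h₁ _ (isCompact_closedBall 0 (k : ℝ))).eventually_le_const hp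
    have e2 := (h₂ _ (isCompact_closedBall 0 (k : ℝ))).eventually_le_const hp
    have e3 : ∀ᶠ r : ℝ in 𝓝[>] 0, r ∈ Ioo (0 : ℝ) (1 / (k + 1)) :=
      Ioo_mem_nhdsGT (by positivity)
    obtain ⟨r, h⟩ := (e3.and (e1.and e2)).exists
    exact ⟨r, h⟩
  choose r hr h1 h2 using hex
  have hr0 : Tendsto r atTop (𝓝 0) :=
    tendsto_of_tendsto_of_tendsto_of_le_of_le tendsto_const_nhds
      tendsto_one_div_add_atTop_nhds_zero_nat (fun k => (hr k).1.le) fun k => (hr k).2.le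
  refine ⟨r, fun k => (hr k).1, hr0, ae_eventually_mem_iff fun k => ?_,
    ae_eventually_mem_iff fun k => ?_⟩
  · rw [← rescale_eq_zoom F₁ x₀ (hr k).1.ne']; exact h1 k
  · rw [← rescale_eq_zoom F₂ x₀ (hr k).1.ne']; exact h2 k

/-! ### Position of the container and of `E` along a blow-up sequence -/

section

variable {Ω E H G : Set (Eu n)} {x₀ z₀ e : Eu n} {φ ψ : Eu n → ℝ} {φ' ψ' : Eu n →L[ℝ] ℝ}
  {c : ℕ → Eu n} {r : ℕ → ℝ} {β : ℝ} {K : Set (Eu n)}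

/-- The number `β` is the limiting height of the base points relative to `∂Ω`: it is `0` for
blow-ups at `x₀` and `-1` for those along a tangent interface. The limit container is `{ψ' y + β <
0}`. -/
lemma IsContactPoint.eventually_mem (hP : IsContactPoint Ω E x₀ φ ψ φ' ψ')
    (hc : Tendsto c atTop (𝓝 x₀)) (hr : ∀ k, 0 < r k) (hr0 : Tendsto r atTop (𝓝 0))
    (hβ : Tendsto (fun k => ψ (c k) / r k) atTop (𝓝 β)) (hK : IsCompact K)
    (hneg : ∀ y ∈ K, ψ' y + β < 0) : ∀ᶠ k in atTop, ∀ y ∈ K, y ∈ zoom Ω (c k) (r k) := by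
  obtain ⟨R, hR⟩ := hK.isBounded.subset_ball 0
  have h1 := eventually_pos_zoom hP.hψ.neg hc hr hr0 (β := -β) (by simpa [neg_div] using hβ.neg) hK
    fun y hy => by
      have := hneg y hy
      simp only [neg_apply]
      linarith
  filter_upwards [h1, eventually_zoom_subset hc hr0 hP.domain R] with k h2 h3 y hy
  exact (h3 y (hR hy)).2 (neg_pos.1 (h2 y hy))

lemma IsContactPoint.eventually_notMem (hP : IsContactPoint Ω E x₀ φ ψ φ' ψ')
    (hc : Tendsto c atTop (𝓝 x₀)) (hr : ∀ k, 0 < r k) (hr0 : Tendsto r atTop (𝓝 0))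
    (hβ : Tendsto (fun k => ψ (c k) / r k) atTop (𝓝 β)) {y : Eu n} (hpos : 0 < ψ' y + β) :
    ∀ᶠ k in atTop, y ∉ zoom Ω (c k) (r k) := by
  have h1 := eventually_pos_zoom hP.hψ hc hr hr0 hβ (isCompact_singleton (x := y))
    fun z hz => by rwa [mem_singleton_iff.1 hz]
  filter_upwards [h1, eventually_zoom_subset hc hr0 hP.domain (‖y‖ + 1)] with k h2 h3 h4
  exact lt_asymm (h2 y rfl) ((h3 y (by simp)).1 h4)

/-- Along a blow-up sequence, `E` does not separate two points joined by a segment that avoids the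
limit of the interface. -/
lemma IsContactPoint.eventually_mem_iff (hP : IsContactPoint Ω E x₀ φ ψ φ' ψ')
    (hc : Tendsto c atTop (𝓝 x₀)) (hr : ∀ k, 0 < r k) (hr0 : Tendsto r atTop (𝓝 0))
    (hφ : ∀ k, φ (c k) = 0) (hK : IsCompact K) (hKc : Convex ℝ K)
    (hΩ : ∀ᶠ k in atTop, ∀ y ∈ K, y ∈ zoom Ω (c k) (r k))
    (hK0 : (∀ y ∈ K, 0 < φ' y) ∨ ∀ y ∈ K, φ' y < 0) :
    ∀ᶠ k in atTop, ∀ a ∈ K, ∀ b ∈ K, (a ∈ zoom E (c k) (r k) ↔ b ∈ zoom E (c k) (r k)) := by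
  obtain ⟨R, hR⟩ := hK.isBounded.subset_ball 0
  have h1 : ∀ᶠ k in atTop, ∀ y ∈ K, φ (c k + r k • y) ≠ 0 := by
    rcases hK0 with h | h
    · have := eventually_pos_zoom hP.hφ hc hr hr0 (β := 0) (by simp [hφ]) hK fun y hy => by
        rw [add_zero]; exact h y hy
      filter_upwards [this] with k hk y hy using (hk y hy).ne'
    · have := eventually_pos_zoom hP.hφ.neg hc hr hr0 (β := 0) (by simp [hφ]) hK fun y hy => by
        have := h y hy
        simp only [neg_apply]
        linarith
      filter_upwards [this] with k hk y hy using (neg_pos.1 (hk y hy)).ne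
  filter_upwards [h1, hΩ, eventually_zoom_subset hc hr0 hP.interface R] with k h2 h3 h4 a ha b hb
  refine mem_iff_of_segment fun y hy hyE => ?_
  have hyK := hKc.segment_subset ha hb hy
  rw [frontier_zoom _ _ (hr k).ne'] at hyE
  exact h2 y hyK (h4 y (hR hyK) (h3 y hyK) hyE)

/-- The blow-up of the container lies in a half-space determined by the differential. -/
lemma IsContactPoint.blowUp_subset (hP : IsContactPoint Ω E x₀ φ ψ φ' ψ') (hr : ∀ k, 0 < r k)
    (hr0 : Tendsto r atTop (𝓝 0)) (hH : IsOpen H)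
    (hΩ : ∀ᵐ y, ∀ᶠ k in atTop, (y ∈ zoom Ω x₀ (r k) ↔ y ∈ H)) : ∀ y ∈ H, ψ' y < 0 := by
  have hempty : ∀ y ∈ H, ψ' y ≤ 0 := by
    by_contra! hcon
    obtain ⟨y, hy, hy0⟩ := hcon
    have hopen : IsOpen (H ∩ {z | 0 < ψ' z}) := hH.inter (isOpen_lt continuous_const ψ'.continuous)
    have hfreq : ∃ᵐ z, z ∈ H ∩ {z | 0 < ψ' z} := by
      rw [frequently_ae_mem_iff]
      exact (hopen.measure_pos volume ⟨y, hy, hy0⟩).ne'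
    obtain ⟨z, ⟨hzH, hz0⟩, hz⟩ := (hfreq.and_eventually hΩ).exists
    have h1 := hP.eventually_notMem tendsto_const_nhds hr hr0 (β := 0) (by simp [hP.ψ_zero])
      (by rw [add_zero]; exact hz0)
    obtain ⟨k, h2, h3⟩ := (h1.and hz).exists
    exact h2 (h3.2 hzH)
  intro y hy
  -- If `ψ' y = 0`, a small move along a direction where `ψ'` is positive would remain in the open
  -- set `H`.
  refine (hempty y hy).lt_of_ne fun h0 => ?_
  obtain ⟨u, hu⟩ := exists_apply_eq_one hP.ψ'_ne
  have hcont : Tendsto (fun t : ℝ => y + t • u) (𝓝[>] 0) (𝓝 y) := by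
    have : Continuous fun t : ℝ => y + t • u := by fun_prop
    simpa using (this.tendsto 0).mono_left nhdsWithin_le_nhds
  obtain ⟨t, ht, ht0⟩ := ((hcont.eventually (hH.mem_nhds hy)).and self_mem_nhdsWithin).exists
  have := hempty _ ht
  rw [map_add, map_smul, h0, hu, zero_add, smul_eq_mul, mul_one] at this
  exact this.not_gt ht0

/-- Blow-ups at a fixed contact point. -/
lemma IsContactPoint.exists_isBlowUp_fixed (hP : IsContactPoint Ω E x₀ φ ψ φ' ψ') (hH : IsOpen H)
    (hG : MeasurableSet G) (hΩH : BlowUpTendsto Ω x₀ H) (hEG : BlowUpTendsto E x₀ G)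
    {W : Set (Eu n)} (hW : W ∈ 𝓝 z₀) (hWH : W ⊆ H) :
    ∃ c r ρ C, IsBlowUp Ω E H G c r z₀ ρ C ∧ Metric.ball z₀ (2 * ρ) ⊆ W := by
  obtain ⟨r, hr, hr0, hmΩ, hmE⟩ := hΩH.exists_seq hEG
  obtain ⟨δ, hδ, hδW⟩ := Metric.nhds_basis_closedBall.mem_iff.1 hW
  have hsub : Metric.ball z₀ (2 * (δ / 2)) ⊆ Metric.closedBall z₀ δ := by
    rw [mul_div_cancel₀ _ two_ne_zero]; exact Metric.ball_subset_closedBall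
  have h1 := hP.eventually_mem (c := fun _ => x₀) tendsto_const_nhds hr hr0 (β := 0)
    (by simp [hP.ψ_zero]) (isCompact_closedBall z₀ δ) fun y hy => by
      rw [add_zero]; exact hP.blowUp_subset hr hr0 hH hmΩ y (hWH (hδW hy))
  obtain ⟨N, C, hB⟩ := hP.exists_isBlowUp (c := fun _ => x₀) tendsto_const_nhds hr hr0 (half_pos hδ)
    hH.measurableSet hG hmΩ hmE (h1.mono fun k hk y hy => hk y (hsub hy))
  exact ⟨_, _, _, _, hB, hsub.trans hδW⟩

end

/-! ### Degenerate blow-ups -/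

section

variable {Ω E : Set (Eu n)} {x₀ e : Eu n} {φ ψ : Eu n → ℝ} {φ' ψ' : Eu n →L[ℝ] ℝ}

lemma IsContactPoint.exists_seq (hP : IsContactPoint Ω E x₀ φ ψ φ' ψ') :
    ∃ p : ℕ → Eu n, Tendsto p atTop (𝓝 x₀) ∧ ∀ k, p k ∈ Ω ∩ frontier E ∧ φ (p k) = 0 ∧
      ψ (p k) < 0 := by
  obtain ⟨p, hp, hpx⟩ := mem_closure_iff_seq_limit.1 hP.mem_closure
  obtain ⟨N, hN⟩ := eventually_atTop.1 (hpx.eventually (hP.interface.and hP.domain))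
  refine ⟨fun k => p (k + N), hpx.comp (tendsto_add_atTop_nat N), fun k => ⟨hp _, ?_, ?_⟩⟩
  · exact (hN _ (Nat.le_add_left _ _)).1 (hp _).1 (hp _).2
  · exact (hN _ (Nat.le_add_left _ _)).2.1 (hp _).1

/-- Used to normalize the two differentials; the factor of `ψ` must be positive, since the sign of
`ψ` describes `Ω`. -/
lemma IsContactPoint.rescaled (hP : IsContactPoint Ω E x₀ φ ψ φ' ψ') {a b : ℝ} (ha : a ≠ 0)
    (hb : 0 < b) : IsContactPoint Ω E x₀ (a • φ) (b • ψ) (a • φ') (b • ψ') where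
  hφ := hP.hφ.const_smul a
  hψ := hP.hψ.const_smul b
  φ'_ne := smul_ne_zero ha hP.φ'_ne
  ψ'_ne := smul_ne_zero hb.ne' hP.ψ'_ne
  φ_zero := by simp [hP.φ_zero]
  ψ_zero := by simp [hP.ψ_zero]
  interface := hP.interface.mono fun x hx h1 h2 => by simp [hx h1 h2]
  domain := hP.domain.mono fun x hx => by
    rw [hx, Pi.smul_apply, smul_eq_mul, mul_neg_iff]
    constructor
    · exact fun h => .inl ⟨hb, h⟩
    · rintro (h | h)
      · exact h.2
      · exact absurd h.1 hb.not_gt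
  mem_closure := hP.mem_closure

/-- If the interface is transversal to `∂Ω`, then both `E` and its complement in `Ω` have positive
density at the contact point. -/
lemma IsContactPoint.not_tendsto_of_transversal (hP : IsContactPoint Ω E x₀ φ ψ φ' ψ')
    (hΩo : IsOpen Ω) (hEn : IsNormalized Ω E) {u : Eu n} (hψu : ψ' u = 0) (hφu : 0 < φ' u) :
    ∃ C : Set (Eu n), IsCompact C ∧
      ¬ Tendsto (fun r : ℝ => volume (zoom E x₀ r ∩ C)) (𝓝[>] 0) (𝓝 0) ∧
      ¬ Tendsto (fun r : ℝ => volume (zoom (Ω \ E) x₀ r ∩ C)) (𝓝[>] 0) (𝓝 0) := by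
  obtain ⟨v₀, hv₀⟩ := exists_apply_eq_one hP.ψ'_ne
  -- Both `w₁` and `w₂` point into the container, with `ψ' = -1`. The tangential component `± L • u`
  -- is large enough to send them to opposite sides of the interface, with `φ' w₁ ≥ 1` and `φ' w₂ ≤
  -- -1`.
  set L : ℝ := (|φ' v₀| + 1) / φ' u with hL
  have hLu : L * φ' u = |φ' v₀| + 1 := div_mul_cancel₀ _ hφu.ne'
  set w₁ : Eu n := -v₀ + L • u with hw₁
  set w₂ : Eu n := -v₀ - L • u with hw₂
  have hφ₁ : 1 ≤ φ' w₁ := by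
    rw [hw₁, map_add, map_neg, map_smul, smul_eq_mul, hLu]
    linarith [le_abs_self (φ' v₀)]
  have hφ₂ : φ' w₂ ≤ -1 := by
    rw [hw₂, map_sub, map_neg, map_smul, smul_eq_mul, hLu]
    linarith [neg_abs_le (φ' v₀)]
  have hψ₁ : ψ' w₁ = -1 := by
    rw [hw₁, map_add, map_neg, map_smul, hψu, hv₀]; simp
  have hψ₂ : ψ' w₂ = -1 := by
    rw [hw₂, map_sub, map_neg, map_smul, hψu, hv₀]; simp
  -- For this `M` the unit balls around `M • w₁` and `M • w₂` keep strict signs for both `φ'` and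
  -- `ψ'`.
  set M : ℝ := ‖φ'‖ + ‖ψ'‖ + 1 with hM
  have hM0 : 0 < M := by positivity
  set B₁ := Metric.closedBall (M • w₁) 1 with hB₁
  set B₂ := Metric.closedBall (M • w₂) 1 with hB₂
  have happ (f : Eu n →L[ℝ] ℝ) (w y : Eu n) (hy : y ∈ Metric.closedBall (M • w) 1) :
      |f y - M * f w| ≤ ‖f‖ := by
    have h1 : f y - M * f w = f (y - M • w) := by simp
    rw [h1]
    exact (f.le_opNorm _).trans (mul_le_of_le_one_right (norm_nonneg _) (mem_closedBall_iff_norm.1 hy))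
  have hφB₁ : ∀ y ∈ B₁, 0 < φ' y := fun y hy => by
    have := (abs_le.1 (happ φ' w₁ y hy)).1
    nlinarith [norm_nonneg ψ']
  have hφB₂ : ∀ y ∈ B₂, φ' y < 0 := fun y hy => by
    have := (abs_le.1 (happ φ' w₂ y hy)).2
    nlinarith [norm_nonneg ψ']
  have hψB₁ : ∀ y ∈ B₁, ψ' y + 0 < 0 := fun y hy => by
    have := (abs_le.1 (happ ψ' w₁ y hy)).2
    rw [hψ₁] at this
    linarith [norm_nonneg φ']
  have hψB₂ : ∀ y ∈ B₂, ψ' y + 0 < 0 := fun y hy => by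
    have := (abs_le.1 (happ ψ' w₂ y hy)).2
    rw [hψ₂] at this
    linarith [norm_nonneg φ']
  obtain ⟨p, hpx, hp⟩ := hP.exists_seq
  -- At this scale the interface point `p k` becomes a unit vector `q k`, so moving from it by `M •
  -- w₁` or `M • w₂` lands in the corresponding reference ball.
  set r : ℕ → ℝ := fun k => ‖p k - x₀‖ with hrdef
  have hr : ∀ k, 0 < r k := fun k => norm_pos_iff.2 fun h => by
    have := (hp k).2.2
    rw [sub_eq_zero.1 h, hP.ψ_zero] at this
    exact lt_irrefl _ this
  have hr0 : Tendsto r atTop (𝓝 0) := by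
    have := tendsto_iff_dist_tendsto_zero.1 hpx
    simpa [dist_eq_norm] using this
  set q : ℕ → Eu n := fun k => (r k)⁻¹ • (p k - x₀) with hq
  have hq1 : ∀ k, ‖q k‖ = 1 := fun k => by
    rw [hq, norm_smul, norm_inv, Real.norm_of_nonneg (hr k).le]
    exact inv_mul_cancel₀ (hr k).ne'
  have hpq : ∀ k, p k = x₀ + r k • q k := fun k => by
    rw [hq]; simp [smul_smul, (hr k).ne']
  -- the two reference balls
  have hΩ₁ := hP.eventually_mem (c := fun _ => x₀) tendsto_const_nhds hr hr0 (β := 0)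
    (by simp [hP.ψ_zero]) (isCompact_closedBall _ _) hψB₁
  have hΩ₂ := hP.eventually_mem (c := fun _ => x₀) tendsto_const_nhds hr hr0 (β := 0)
    (by simp [hP.ψ_zero]) (isCompact_closedBall _ _) hψB₂
  have hE₁ := hP.eventually_mem_iff (c := fun _ => x₀) tendsto_const_nhds hr hr0
    (fun _ => hP.φ_zero) (isCompact_closedBall _ _) (convex_closedBall _ _) hΩ₁ (.inl hφB₁)
  have hE₂ := hP.eventually_mem_iff (c := fun _ => x₀) tendsto_const_nhds hr hr0
    (fun _ => hP.φ_zero) (isCompact_closedBall _ _) (convex_closedBall _ _) hΩ₂ (.inr hφB₂)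
  -- the two balls lie on opposite sides of the interface
  set ε : ℝ≥0 := Real.toNNReal (1 / (2 * (‖w₁‖ + ‖w₂‖ + 1))) with hε
  have hε0 : 0 < ε := Real.toNNReal_pos.2 (by positivity)
  have hεw : ε * (‖w₁‖ + ‖w₂‖ + 1) = 1 / 2 := by
    rw [hε, Real.coe_toNNReal _ (by positivity)]; field_simp
  have hε0' : (0 : ℝ) < ε := hε0
  have hε₁ : ε * ‖w₁‖ < 1 := by nlinarith [mul_nonneg hε0'.le (norm_nonneg w₂)]
  have hε₂ : ε * ‖w₂‖ < 1 := by nlinarith [mul_nonneg hε0'.le (norm_nonneg w₁)]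
  obtain ⟨δ, hδ, hopp⟩ := hP.opposite_sides hΩo hEn hε0
  obtain ⟨δ', hδ', hψapp⟩ := exists_ball_approximatesLinearOn hP.hψ hε0
  -- Along `w` the function `ψ` decreases from the negative value `ψ (p k)`, so the segment stays in
  -- `Ω`.
  have hseg : ∀ w, ψ' w = -1 → ε * ‖w‖ < 1 → ∀ᶠ k in atTop,
      segment ℝ (p k) (p k + (r k * M) • w) ⊆ Ω ∩ Metric.ball x₀ δ := by
    intro w hψw hεw
    have h1 : ∀ᶠ x in 𝓝 x₀, x ∈ Metric.ball x₀ δ ∧ x ∈ Metric.ball x₀ δ' ∧ (x ∈ Ω ↔ ψ x < 0) :=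
      (Metric.isOpen_ball.eventually_mem (Metric.mem_ball_self hδ)).and
        ((Metric.isOpen_ball.eventually_mem (Metric.mem_ball_self hδ')).and hP.domain)
    filter_upwards [eventually_zoom_subset (c := fun _ => x₀) tendsto_const_nhds hr0 h1
      (2 + M * ‖w‖)] with k hk x hx
    rw [segment_eq_image'] at hx
    obtain ⟨τ, hτ, rfl⟩ := hx
    have hin : ∀ τ ∈ Icc (0 : ℝ) 1, q k + (τ * M) • w ∈ Metric.ball (0 : Eu n) (2 + M * ‖w‖) := by
      intro τ hτ
      rw [mem_ball_zero_iff]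
      have h2 : ‖(τ * M) • w‖ ≤ M * ‖w‖ := by
        rw [norm_smul, Real.norm_of_nonneg (mul_nonneg hτ.1 hM0.le)]
        gcongr
        exact mul_le_of_le_one_left hM0.le hτ.2
      linarith [norm_add_le (q k) ((τ * M) • w), hq1 k]
    have e1 : p k + τ • (p k + (r k * M) • w - p k) = x₀ + r k • (q k + (τ * M) • w) := by
      rw [hpq k]; module
    obtain ⟨h3, h4, h5⟩ := hk _ (hin τ hτ)
    obtain ⟨-, h7, -⟩ := hk _ (hin 0 ⟨le_rfl, zero_le_one⟩)
    rw [zero_mul, zero_smul, add_zero, ← hpq k] at h7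
    simp only [e1]
    refine ⟨h5.2 ?_, h3⟩
    have h8 := hψapp _ h4 _ h7
    have e2 : x₀ + r k • (q k + (τ * M) • w) - p k = (r k * (τ * M)) • w := by
      rw [hpq k]; module
    have h9 : 0 ≤ r k * (τ * M) := mul_nonneg (hr k).le (mul_nonneg hτ.1 hM0.le)
    rw [e2, map_smul, hψw, norm_smul, Real.norm_of_nonneg h9, smul_eq_mul, Real.norm_eq_abs] at h8
    have h10 := (abs_le.1 h8).2
    nlinarith [(hp k).2.2]
  -- One ball is filled by `E` and the other by `Ω \ E`. Which is which may depend on `k`, hence the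
  -- union of the two as the compact set.
  have hmain : ∀ᶠ k in atTop, (B₁ ⊆ zoom E x₀ (r k) ∧ B₂ ⊆ zoom (Ω \ E) x₀ (r k)) ∨
      (B₂ ⊆ zoom E x₀ (r k) ∧ B₁ ⊆ zoom (Ω \ E) x₀ (r k)) := by
    filter_upwards [hΩ₁, hΩ₂, hE₁, hE₂, hseg w₁ hψ₁ hε₁, hseg w₂ hψ₂ hε₂]
      with k k1 k2 k3 k4 k5 k6
    have hrM : 0 < r k * M := mul_pos (hr k) hM0
    have h1 := hopp (p k) (hp k).1 ((r k * M) • w₁) ((r k * M) • w₂)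
      (by
        rw [norm_smul, Real.norm_of_nonneg hrM.le, map_smul, smul_eq_mul]
        nlinarith)
      (by
        rw [norm_smul, Real.norm_of_nonneg hrM.le, map_smul, smul_eq_mul]
        nlinarith) k5 k6
    have e (w : Eu n) : p k + (r k * M) • w = x₀ + r k • (M • w + q k) := by
      rw [hpq k]; module
    have hmem (w : Eu n) : M • w + q k ∈ Metric.closedBall (M • w) 1 := by
      rw [mem_closedBall_iff_norm, add_sub_cancel_left, hq1]
    rw [e, e] at h1
    by_cases h2 : x₀ + r k • (M • w₁ + q k) ∈ E
    · exact .inl ⟨fun y hy => (k3 y hy _ (hmem w₁)).2 h2,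
        fun y hy => ⟨k2 y hy, fun h => h1.1 h2 ((k4 y hy _ (hmem w₂)).1 h)⟩⟩
    · exact .inr ⟨fun y hy => (k4 y hy _ (hmem w₂)).2 (by_contra fun h => h2 (h1.2 h)),
        fun y hy => ⟨k1 y hy, fun h => h2 ((k3 y hy _ (hmem w₁)).1 h)⟩⟩
  set m : ℝ≥0∞ := volume (Metric.closedBall (0 : Eu n) 1) with hm
  have hm0 : 0 < m := Metric.measure_closedBall_pos _ _ one_pos
  have hvB : ∀ z : Eu n, volume (Metric.closedBall z 1) = m := fun z =>
    Measure.addHaar_closedBall_center _ _ _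
  have hcontra : ∀ F : Set (Eu n), (∀ᶠ k in atTop, B₁ ⊆ zoom F x₀ (r k) ∨ B₂ ⊆ zoom F x₀ (r k)) →
      ¬ Tendsto (fun r : ℝ => volume (zoom F x₀ r ∩ (B₁ ∪ B₂))) (𝓝[>] 0) (𝓝 0) := by
    intro F hF hlim
    have h1 := hlim.comp (tendsto_nhdsWithin_iff.2 ⟨hr0, .of_forall hr⟩ : Tendsto r atTop (𝓝[>] 0))
    obtain ⟨k, h2, h3⟩ := ((h1.eventually_lt_const hm0).and hF).exists
    refine h2.not_ge ?_
    rcases h3 with h3 | h3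
    · rw [← hvB (M • w₁)]
      exact measure_mono fun y hy => ⟨h3 hy, .inl hy⟩
    · rw [← hvB (M • w₂)]
      exact measure_mono fun y hy => ⟨h3 hy, .inr hy⟩
  exact ⟨B₁ ∪ B₂, (isCompact_closedBall _ _).union (isCompact_closedBall _ _),
    hcontra E (hmain.mono fun k hk => hk.imp And.left And.left),
    hcontra (Ω \ E) (hmain.mono fun k hk => hk.symm.imp And.right And.right)⟩

/-- If the interface is tangent to `∂Ω`, a blow-up along points of the interface converges to a
strip or to a half-space. -/
lemma IsContactPoint.exists_isBlowUp_tangent (hP : IsContactPoint Ω E x₀ φ ψ φ' ψ')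
    (hΩo : IsOpen Ω) (hEΩ : E ⊆ Ω) (hEn : IsNormalized Ω E) (he : ‖e‖ = 1)
    (hφ' : ∀ y, φ' y = inner ℝ e y) (hψ' : ∀ y, ψ' y = -inner ℝ e y) :
    ∃ c r C, IsBlowUp Ω E {x | -1 < inner ℝ e x} {x | -1 < inner ℝ e x ∧ inner ℝ e x < 0}
        c r 0 (1 / 4) C ∨
      IsBlowUp Ω E {x | -1 < inner ℝ e x} {x | -1 < inner ℝ e x ∧ 0 < inner ℝ e x}
        c r 0 (1 / 4) C := by
  obtain ⟨p₀, hpx₀, hp₀⟩ := hP.exists_seq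
  -- The side of the interface occupied by `E` might alternate; along a subsequence it is constant,
  -- and the point `e` is used to detect it.
  obtain ⟨θ, hθ, hθe⟩ : ∃ θ : ℕ → ℕ, StrictMono θ ∧
      ((∀ k, e ∈ zoom E (p₀ (θ k)) (-ψ (p₀ (θ k)))) ∨
        ∀ k, e ∉ zoom E (p₀ (θ k)) (-ψ (p₀ (θ k)))) := by
    have : ∃ᶠ k in atTop, (e ∈ zoom E (p₀ k) (-ψ (p₀ k)) ∨ e ∉ zoom E (p₀ k) (-ψ (p₀ k))) :=
      Eventually.frequently (.of_forall fun k => em _)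
    rcases frequently_or_distrib.1 this with h | h
    · obtain ⟨θ, hθ, h⟩ := extraction_of_frequently_atTop h
      exact ⟨θ, hθ, .inl h⟩
    · obtain ⟨θ, hθ, h⟩ := extraction_of_frequently_atTop h
      exact ⟨θ, hθ, .inr h⟩
  set p : ℕ → Eu n := fun k => p₀ (θ k) with hpdef
  -- With this scale `ψ (p k) / r k = -1`: the wall is sent to `⟪e, y⟫ = -1` and the interface to
  -- `⟪e, y⟫ = 0`.
  set r : ℕ → ℝ := fun k => -ψ (p k) with hrdef
  have hp : ∀ k, p k ∈ Ω ∩ frontier E ∧ φ (p k) = 0 ∧ ψ (p k) < 0 := fun k => hp₀ (θ k)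
  have hpx : Tendsto p atTop (𝓝 x₀) := hpx₀.comp hθ.tendsto_atTop
  have hr : ∀ k, 0 < r k := fun k => neg_pos.2 (hp k).2.2
  have hr0 : Tendsto r atTop (𝓝 0) := by
    have := (hP.hψ.hasFDerivAt.continuousAt.tendsto.comp hpx).neg
    rwa [hP.ψ_zero, neg_zero] at this
  have hβ : Tendsto (fun k => ψ (p k) / r k) atTop (𝓝 (-1)) := by
    refine tendsto_const_nhds.congr fun k => ?_
    rw [hrdef, div_neg, div_self (hp k).2.2.ne]
  have hcont : Continuous fun y : Eu n => inner ℝ e y := by fun_prop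
  have hee : inner ℝ e e = 1 := by rw [real_inner_self_eq_norm_sq, he, one_pow]
  have hin {K : Set (Eu n)} (hK : IsCompact K) (h : ∀ y ∈ K, -1 < inner ℝ e y) :
      ∀ᶠ k in atTop, ∀ y ∈ K, y ∈ zoom Ω (p k) (r k) :=
    hP.eventually_mem hpx hr hr0 hβ hK fun y hy => by rw [hψ']; linarith [h y hy]
  have hout {y : Eu n} (h : inner ℝ e y < -1) : ∀ᶠ k in atTop, y ∉ zoom Ω (p k) (r k) :=
    hP.eventually_notMem hpx hr hr0 hβ (by rw [hψ']; linarith)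
  have hsegc (a b : Eu n) : IsCompact (segment ℝ a b) := by
    rw [segment_eq_image']
    exact isCompact_Icc.image (by fun_prop)
  have hhalf (t : ℝ) : Convex ℝ {y : Eu n | t < inner ℝ e y} :=
    convex_halfSpace_gt (innerSL ℝ e).isLinear t
  have hhalf' (t : ℝ) : Convex ℝ {y : Eu n | inner ℝ e y < t} :=
    convex_halfSpace_lt (innerSL ℝ e).isLinear t
  have hpos {y : Eu n} (hy : 0 < inner ℝ e y) : ∀ᶠ k in atTop,
      (y ∈ zoom E (p k) (r k) ↔ e ∈ zoom E (p k) (r k)) := by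
    have h1 : ∀ z ∈ segment ℝ y e, 0 < inner ℝ e z := fun z hz =>
      (hhalf 0).segment_subset hy (by rw [mem_ofPred_eq, hee]; exact one_pos) hz
    have h2 := hP.eventually_mem_iff hpx hr hr0 (fun k => (hp k).2.1) (hsegc y e)
      (convex_segment _ _) (hin (hsegc y e) fun z hz => by linarith [h1 z hz])
      (.inl fun z hz => by rw [hφ']; exact h1 z hz)
    filter_upwards [h2] with k hk
    exact hk _ (left_mem_segment _ _ _) _ (right_mem_segment _ _ _)
  -- The reference point `-(1/2) • e` lies in the middle of the strip and plays the role that `e`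
  -- plays above the interface.
  have hneg {y : Eu n} (hy : -1 < inner ℝ e y) (hy0 : inner ℝ e y < 0) : ∀ᶠ k in atTop,
      (y ∈ zoom E (p k) (r k) ↔ (-(1 / 2 : ℝ)) • e ∈ zoom E (p k) (r k)) := by
    have h0 : inner ℝ e ((-(1 / 2 : ℝ)) • e) = -(1 / 2) := by rw [inner_smul_right, hee, mul_one]
    have h1 : ∀ z ∈ segment ℝ y ((-(1 / 2 : ℝ)) • e), -1 < inner ℝ e z := fun z hz =>
      (hhalf (-1)).segment_subset hy (by rw [mem_ofPred_eq, h0]; norm_num) hz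
    have h1' : ∀ z ∈ segment ℝ y ((-(1 / 2 : ℝ)) • e), inner ℝ e z < 0 := fun z hz =>
      (hhalf' 0).segment_subset hy0 (by rw [mem_ofPred_eq, h0]; norm_num) hz
    have h2 := hP.eventually_mem_iff hpx hr hr0 (fun k => (hp k).2.1) (hsegc _ _)
      (convex_segment _ _) (hin (hsegc _ _) h1) (.inr fun z hz => by rw [hφ']; exact h1' z hz)
    filter_upwards [h2] with k hk
    exact hk _ (left_mem_segment _ _ _) _ (right_mem_segment _ _ _)
  have hopp : ∀ᶠ k in atTop,
      (e ∈ zoom E (p k) (r k) ↔ (-(1 / 2 : ℝ)) • e ∉ zoom E (p k) (r k)) := by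
    obtain ⟨δ, hδ, hopp⟩ := hP.opposite_sides hΩo hEn (ε := 1 / 2) (by norm_num)
    have hseg : ∀ t : ℝ, t ∈ Ioc (-1 : ℝ) 1 → ∀ᶠ k in atTop,
        segment ℝ (p k) (p k + (r k * t) • e) ⊆ Ω ∩ Metric.ball x₀ δ := by
      intro t ht
      have h1 : ∀ τ ∈ Icc (0 : ℝ) 1, -1 < inner ℝ e ((τ * t) • e) := fun τ hτ => by
        rw [inner_smul_right, hee, mul_one]
        rcases le_total 0 t with h | h
        · linarith [mul_nonneg hτ.1 h]
        · nlinarith [mul_nonneg (sub_nonneg.2 hτ.2) (neg_nonneg.2 h), ht.1]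
      have hK : IsCompact ((fun τ : ℝ => (τ * t) • e) '' Icc 0 1) :=
        isCompact_Icc.image (by fun_prop)
      filter_upwards [hin hK (by rintro _ ⟨τ, hτ, rfl⟩; exact h1 τ hτ),
        eventually_zoom_subset hpx hr0 (Metric.ball_mem_nhds x₀ hδ) 2] with k h2 h3 x hx
      rw [segment_eq_image'] at hx
      obtain ⟨τ, hτ, rfl⟩ := hx
      have e1 : p k + τ • (p k + (r k * t) • e - p k) = p k + r k • ((τ * t) • e) := by module
      simp only [e1]
      refine ⟨h2 _ ⟨τ, hτ, rfl⟩, h3 _ ?_⟩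
      rw [mem_ball_zero_iff, norm_smul, he, mul_one, Real.norm_eq_abs, abs_lt]
      constructor <;> nlinarith [hτ.1, hτ.2, ht.1, ht.2]
    filter_upwards [hseg 1 (by norm_num), hseg (-(1 / 2)) (by norm_num)] with k h1 h2
    have hrk := hr k
    have h3 := hopp (p k) (hp k).1 _ _
      (by
        rw [hφ', inner_smul_right, hee, norm_smul, he, mul_one, mul_one, mul_one,
          Real.norm_of_nonneg hrk.le]
        push_cast
        linarith)
      (by
        rw [hφ', inner_smul_right, hee, norm_smul, he, Real.norm_eq_abs, abs_mul,
          abs_of_pos hrk, abs_neg, abs_of_pos (by norm_num : (0 : ℝ) < 1 / 2)]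
        push_cast
        linarith) h1 h2
    rw [mul_one] at h3
    rw [mem_zoom, mem_zoom, smul_smul]
    exact h3
  have hplane : ∀ᵐ y : Eu n, inner ℝ e y ≠ 0 ∧ inner ℝ e y ≠ -1 := by
    have h0 : ∀ᵐ y : Eu n, inner ℝ e y ≠ 0 := by
      rw [ae_iff]; simpa using volume_hyperplane he
    have h1 : ∀ᵐ y : Eu n, inner ℝ e (y + e) ≠ 0 :=
      (measurePreserving_add_right volume e).quasiMeasurePreserving.ae h0
    filter_upwards [h0, h1] with y hy hy1
    refine ⟨hy, fun h => hy1 ?_⟩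
    rw [inner_add_right, hee, h]; norm_num
  have hmΩ : ∀ᵐ y, ∀ᶠ k in atTop, (y ∈ zoom Ω (p k) (r k) ↔ y ∈ {x | -1 < inner ℝ e x}) := by
    filter_upwards [hplane] with y hy
    rcases hy.2.lt_or_gt with h | h
    · filter_upwards [hout h] with k hk
      exact ⟨fun h' => absurd h' hk, fun h' => absurd h (lt_asymm h')⟩
    · filter_upwards [hin (isCompact_singleton (x := y)) (by simpa using h)] with k hk
      exact ⟨fun _ => h, fun _ => hk y rfl⟩
  have hball : ∀ᶠ k in atTop, Metric.ball (0 : Eu n) (2 * (1 / 4)) ⊆ zoom Ω (p k) (r k) := by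
    filter_upwards [hin (isCompact_closedBall (0 : Eu n) (1 / 2)) fun y hy => by
      have h1 := (abs_le.1 (abs_real_inner_le_norm e y)).1
      rw [he, one_mul] at h1
      linarith [mem_closedBall_zero_iff.1 hy]] with k hk y hy
    refine hk y (Metric.ball_subset_closedBall (Metric.ball_subset_ball (by norm_num) hy))
  have hmeas (s : Set ℝ) (hs : MeasurableSet s) :
      MeasurableSet {x : Eu n | -1 < inner ℝ e x ∧ inner ℝ e x ∈ s} :=
    (measurableSet_lt measurable_const hcont.measurable).inter (hcont.measurable hs)
  have hmΩ' : MeasurableSet {x : Eu n | -1 < inner ℝ e x} :=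
    measurableSet_lt measurable_const hcont.measurable
  rcases hθe with hθe | hθe
  · obtain ⟨N, C, hB⟩ := hP.exists_isBlowUp hpx hr hr0 (by norm_num : (0 : ℝ) < 1 / 4) hmΩ'
      (hmeas (Ioi 0) measurableSet_Ioi) hmΩ (by
        filter_upwards [hplane] with y hy
        rcases hy.2.lt_or_gt with h | h
        · filter_upwards [hout h] with k hk
          exact ⟨fun h' => absurd (hEΩ h') hk, fun h' => absurd h (lt_asymm h'.1)⟩
        rcases hy.1.lt_or_gt with h0 | h0
        · filter_upwards [hneg h h0, hopp] with k hk hk'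
          exact ⟨fun h' => absurd (hk.1 h') (hk'.1 (hθe k)), fun h' => absurd h0 (lt_asymm h'.2)⟩
        · filter_upwards [hpos h0] with k hk
          exact ⟨fun _ => ⟨h, h0⟩, fun _ => hk.2 (hθe k)⟩) hball
    exact ⟨_, _, _, .inr hB⟩
  · obtain ⟨N, C, hB⟩ := hP.exists_isBlowUp hpx hr hr0 (by norm_num : (0 : ℝ) < 1 / 4) hmΩ'
      (hmeas (Iio 0) measurableSet_Iio) hmΩ (by
        filter_upwards [hplane] with y hy
        rcases hy.2.lt_or_gt with h | h
        · filter_upwards [hout h] with k hk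
          exact ⟨fun h' => absurd (hEΩ h') hk, fun h' => absurd h (lt_asymm h'.1)⟩
        rcases hy.1.lt_or_gt with h0 | h0
        · filter_upwards [hneg h h0, hopp] with k hk hk'
          exact ⟨fun _ => ⟨h, h0⟩,
            fun _ => hk.2 (by_contra fun h' => hθe k (hk'.2 h'))⟩
        · filter_upwards [hpos h0] with k hk
          exact ⟨fun h' => absurd (hk.1 h') (hθe k), fun h' => absurd h0 (lt_asymm h'.2)⟩) hball
    exact ⟨_, _, _, .inl hB⟩

/-- If `E` or its complement in `Ω` has vanishing density at the contact point, then a blow-up along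
points of the interface converges to a strip or to a half-space. -/
theorem IsContactPoint.exists_isBlowUp_degenerate (hP : IsContactPoint Ω E x₀ φ ψ φ' ψ')
    (hΩo : IsOpen Ω) (hEΩ : E ⊆ Ω) (hEn : IsNormalized Ω E)
    (hdeg : (∀ C : Set (Eu n), IsCompact C →
        Tendsto (fun r : ℝ => volume (zoom E x₀ r ∩ C)) (𝓝[>] 0) (𝓝 0)) ∨
      ∀ C : Set (Eu n), IsCompact C →
        Tendsto (fun r : ℝ => volume (zoom (Ω \ E) x₀ r ∩ C)) (𝓝[>] 0) (𝓝 0)) :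
    ∃ e c r C, ‖e‖ = 1 ∧
      (IsBlowUp Ω E {x | -1 < inner ℝ e x} {x | -1 < inner ℝ e x ∧ inner ℝ e x < 0}
        c r 0 (1 / 4) C ∨
      IsBlowUp Ω E {x | -1 < inner ℝ e x} {x | -1 < inner ℝ e x ∧ 0 < inner ℝ e x}
        c r 0 (1 / 4) C) := by
  -- A direction tangent to `∂Ω` but transversal to the interface would give both `E` and `Ω \ E`
  -- nonvanishing density; hence the two differentials are proportional.
  have hker : ∀ u, ψ' u = 0 → φ' u = 0 := by
    have h1 : ∀ u, ψ' u = 0 → φ' u ≤ 0 := fun u hu => by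
      by_contra! hcon
      obtain ⟨C, hC, h1, h2⟩ := hP.not_tendsto_of_transversal hΩo hEn hu hcon
      rcases hdeg with h | h
      · exact h1 (h C hC)
      · exact h2 (h C hC)
    intro u hu
    have h2 := h1 (-u) (by rw [map_neg, hu, neg_zero])
    rw [map_neg] at h2
    linarith [h1 u hu]
  set v : Eu n := (InnerProductSpace.toDual ℝ (Eu n)).symm ψ' with hv
  have hvψ : ∀ y, inner ℝ v y = ψ' y := fun y => InnerProductSpace.toDual_symm_apply
  have hv0 : 0 < ‖v‖ := by
    rw [hv, LinearIsometryEquiv.norm_map]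
    exact norm_pos_iff.2 hP.ψ'_ne
  -- `e` is the inner unit normal to `Ω` at `x₀`.
  set e : Eu n := -(‖v‖⁻¹ • v) with he
  have hen : ‖e‖ = 1 := by
    rw [he, norm_neg, norm_smul, norm_inv, norm_norm, inv_mul_cancel₀ hv0.ne']
  have hψe : ∀ y, ‖v‖⁻¹ * ψ' y = -inner ℝ e y := fun y => by
    rw [he, inner_neg_left, real_inner_smul_left, hvψ, neg_neg]
  have hφe : ∀ y, φ' y = φ' e * inner ℝ e y := fun y => by
    have h1 : ψ' (y - inner ℝ e y • e) = 0 := by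
      refine (mul_eq_zero.1 ?_).resolve_left (inv_ne_zero hv0.ne')
      rw [hψe, inner_sub_right, inner_smul_right, real_inner_self_eq_norm_sq, hen]
      ring
    have h2 := hker _ h1
    rw [map_sub, map_smul, smul_eq_mul, sub_eq_zero] at h2
    rw [h2, mul_comm]
  have hκ : φ' e ≠ 0 := fun h => hP.φ'_ne (by ext y; rw [hφe, h, zero_mul]; rfl)
  obtain ⟨c, r, C, h⟩ := (hP.rescaled (inv_ne_zero hκ) (inv_pos.2 hv0)).exists_isBlowUp_tangent
    hΩo hEΩ hEn hen (fun y => by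
      rw [smul_apply, smul_eq_mul, hφe y, inv_mul_cancel_left₀ hκ]) fun y => by
      rw [smul_apply, smul_eq_mul, hψe]
  exact ⟨e, c, r, C, hen, h⟩

end

/-! ### The contact angle -/

/-- The polar angle is a complex argument `β`, and the second inequality is `sin (β - ϑ) < 0`
expanded. -/
lemma mem_sector_iff (hn : 2 ≤ n) {ϑ : ℝ} (hϑ : ϑ ∈ Ioc 0 Real.pi) (x : Eu n) :
    x ∈ sector hn 0 ϑ ↔ 0 < x ⟨n - 1, by omega⟩ ∧
      -Real.sin ϑ * x ⟨0, by omega⟩ + Real.cos ϑ * x ⟨n - 1, by omega⟩ < 0 := by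
  constructor
  · rintro ⟨β, hβ, ρ, hρ, h0, h1⟩
    rw [h0, h1]
    refine ⟨mul_pos hρ (Real.sin_pos_of_pos_of_lt_pi hβ.1 (hβ.2.trans_le hϑ.2)), ?_⟩
    have h2 : Real.sin (β - ϑ) < 0 :=
      Real.sin_neg_of_neg_of_neg_pi_lt (by linarith [hβ.2]) (by linarith [hβ.1, hϑ.2])
    rw [Real.sin_sub] at h2
    nlinarith
  · rintro ⟨h1, h2⟩
    set z : ℂ := ⟨x ⟨0, by omega⟩, x ⟨n - 1, by omega⟩⟩ with hz
    have hcos : ‖z‖ * Real.cos z.arg = x ⟨0, by omega⟩ := Complex.norm_mul_cos_arg z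
    have hsin : ‖z‖ * Real.sin z.arg = x ⟨n - 1, by omega⟩ := Complex.norm_mul_sin_arg z
    have hz0 : 0 < ‖z‖ := norm_pos_iff.2 fun h => by
      have : z.im = 0 := by rw [h]; rfl
      exact h1.ne' this
    have hs : 0 < Real.sin z.arg := by
      rw [← hsin] at h1
      exact (mul_pos_iff_of_pos_left hz0).1 h1
    have hβ0 : 0 < z.arg := by
      by_contra! hcon
      exact (Real.sin_nonpos_of_nonpos_of_neg_pi_le hcon (Complex.neg_pi_lt_arg z).le).not_gt hs
    refine ⟨z.arg, ⟨hβ0, ?_⟩, ‖z‖, hz0, hcos.symm, hsin.symm⟩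
    by_contra! hcon
    have h3 : 0 ≤ Real.sin (z.arg - ϑ) :=
      Real.sin_nonneg_of_nonneg_of_le_pi (by linarith) (by linarith [Complex.arg_le_pi z, hϑ.1])
    rw [← hcos, ← hsin] at h2
    rw [Real.sin_sub] at h3
    nlinarith

/-- A wedge of opening `ϑ ∈ (0, π)` is the intersection of two half-spaces. -/
lemma IsAngleBetween.exists_normals {hn : 2 ≤ n} {H V : Set (Eu n)} {ϑ : ℝ}
    (h : IsAngleBetween hn H V ϑ) (hϑ : ϑ ∈ Ioo 0 Real.pi) :
    ∃ e ν : Eu n, ‖e‖ = 1 ∧ ‖ν‖ = 1 ∧ inner ℝ e ν = Real.cos ϑ ∧ H = {x | 0 < inner ℝ e x} ∧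
      H ∩ V = {x | 0 < inner ℝ e x ∧ inner ℝ ν x < 0} := by
  obtain ⟨-, Q, hH, hHV⟩ := h
  set i₀ : Fin n := ⟨0, by omega⟩ with hi₀
  set i₁ : Fin n := ⟨n - 1, by omega⟩ with hi₁
  have hne : i₀ ≠ i₁ := fun h => by
    have := congrArg Fin.val h
    simp only [hi₀, hi₁] at this
    omega
  set a : Eu n := EuclideanSpace.single i₀ 1 with ha
  set b : Eu n := EuclideanSpace.single i₁ 1 with hb
  have hinner (i : Fin n) (x : Eu n) : inner ℝ (EuclideanSpace.single i (1 : ℝ)) x = x i := by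
    simp [EuclideanSpace.inner_single_left]
  have hab : inner ℝ b a = 0 := by rw [hb, hinner, ha]; simp [hne.symm]
  have hba : inner ℝ a b = 0 := by rw [real_inner_comm, hab]
  have haa : inner ℝ a a = 1 := by rw [ha, hinner]; simp
  have hbb : inner ℝ b b = 1 := by rw [hb, hinner]; simp
  -- `w` is the outer unit normal to the side of the sector at angle `ϑ`.
  set w : Eu n := -Real.sin ϑ • a + Real.cos ϑ • b with hw
  have hwx (x : Eu n) : inner ℝ w x = -Real.sin ϑ * x i₀ + Real.cos ϑ * x i₁ := by
    rw [hw, inner_add_left, real_inner_smul_left, real_inner_smul_left, ha, hb, hinner, hinner]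
  have hQ (v x : Eu n) : inner ℝ (Q v) x = inner ℝ v (Q.symm x) := by
    rw [← Q.inner_map_map v, Q.apply_symm_apply]
  have himg (S : Set (Eu n)) (x : Eu n) : x ∈ Q '' S ↔ Q.symm x ∈ S := by
    constructor
    · rintro ⟨y, hy, rfl⟩
      simpa using hy
    · exact fun hx => ⟨_, hx, by simp⟩
  have hbw : inner ℝ b w = Real.cos ϑ := by
    rw [hw, inner_add_right, inner_smul_right, inner_smul_right, hab, hbb]; ring
  have hww : ‖w‖ = 1 := by
    have h1 : ‖w‖ ^ 2 = 1 := by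
      rw [← real_inner_self_eq_norm_sq]
      nth_rewrite 1 [hw]
      rw [inner_add_left, real_inner_smul_left, real_inner_smul_left, hbw, hw, inner_add_right,
        inner_smul_right, inner_smul_right, haa, hba]
      linear_combination Real.sin_sq_add_cos_sq ϑ
    exact (pow_eq_one_iff_of_nonneg (norm_nonneg w) two_ne_zero).1 h1
  refine ⟨Q b, Q w, ?_, ?_, ?_, ?_, ?_⟩
  · rw [Q.norm_map, hb]; simp
  · rw [Q.norm_map, hww]
  · rw [Q.inner_map_map, hbw]
  · ext x
    rw [hH, himg, mem_sector_iff hn ⟨Real.pi_pos, le_rfl⟩, mem_ofPred_eq, hQ, hb, hinner]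
    simp [hi₁]
  · ext x
    rw [hHV, himg, mem_sector_iff hn ⟨hϑ.1, hϑ.2.le⟩, mem_ofPred_eq, hQ, hQ, hwx, hb, hinner]

lemma mirror_neg {ν : Eu n} (hν : ‖ν‖ = 1) (x : Eu n) : mirror (-ν) x = mirror ν x := by
  rw [mirror_apply hν, mirror_apply (by rwa [norm_neg]), inner_neg_left]
  module

/-! ### Exclusion of contact angles -/

section

variable {s₁ s₂ lam σ : ℝ} {ϱ : ℝ≥0∞} {K₁ K₂ g a₁ : Eu n → ℝ} {Ω E Ω' E' H V : Set (Eu n)}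
  {c : ℕ → Eu n} {r : ℕ → ℝ} {ν e z₀ x₀ : Eu n} {ρ C ϑ : ℝ} {φ ψ : Eu n → ℝ}
  {φ' ψ' : Eu n →L[ℝ] ℝ}

/-- A wedge or a strip is a possible blow-up only if adhesion does not dominate and, when adhesion is
negligible, only if it is symmetric. -/
theorem IsBlowUp.false_of_wedge (hB : IsBlowUp Ω E Ω' E' c r z₀ ρ C)
    (hC : CriticalSetting n s₁ s₂ lam σ ϱ K₁ K₂ g Ω E) (he : ‖e‖ = 1) (hν : ‖ν‖ = 1)
    (hz₀ : inner ℝ ν z₀ = 0) {b : ℝ} (hb : 0 ≤ b)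
    (hball : ∀ x ∈ Metric.ball z₀ (2 * ρ), -b < inner ℝ e x ∧ -b < inner ℝ e (mirror ν x))
    (hΩ' : Ω' = {x | -b < inner ℝ e x})
    (hE' : E' = {x | -b < inner ℝ e x ∧ inner ℝ ν x < 0} ∨
      E' = {x | -b < inner ℝ e x ∧ 0 < inner ℝ ν x})
    (ha₁ : HasBlowUp s₁ a₁ K₁)
    (hconst : ∃ a : ℝ, ∀ w ∈ Metric.sphere (0 : Eu n) 1, a₁ w = a)
    (hs : (s₁ < s₂ ∧ σ ≠ 0) ∨ (0 < inner ℝ e ν ∧ (σ = 0 ∨ s₂ < s₁))) : False := by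
  rcases hs with ⟨hs, hσ⟩ | ⟨heν, hs⟩
  · have hM : 0 < volume (Ω'ᶜ ∩ Metric.ball 0 (b + 2)) := by
      have hcont : Continuous fun y : Eu n => inner ℝ e y := by fun_prop
      have hopen : IsOpen ({x : Eu n | inner ℝ e x < -b} ∩ Metric.ball 0 (b + 2)) :=
        (isOpen_lt hcont continuous_const).inter Metric.isOpen_ball
      have hmem : -(b + 1) • e ∈ {x : Eu n | inner ℝ e x < -b} ∩ Metric.ball 0 (b + 2) := by
        refine ⟨?_, ?_⟩
        · rw [mem_ofPred_eq, inner_smul_right, real_inner_self_eq_norm_sq, he]; linarith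
        · rw [mem_ball_zero_iff, norm_smul, he, norm_neg, Real.norm_of_nonneg (by linarith)]
          linarith
      refine (hopen.measure_pos volume ⟨_, hmem⟩).trans_le
        (measure_mono (inter_subset_inter_left _ fun x hx hx' => ?_))
      rw [hΩ'] at hx'
      exact lt_asymm (show inner ℝ e x < -b from hx) hx'
    rcases hE' with rfl | rfl
    · exact hB.false_of_adhesion_dominant hC hν hz₀
        (fun x hx => ⟨fun h => h.2, fun h => ⟨(hball x hx).1, h⟩⟩) hM hs hσ
    · refine hB.false_of_adhesion_dominant (ν := -ν) hC (by rwa [norm_neg])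
        (by rw [inner_neg_left, hz₀, neg_zero]) (fun x hx => ?_) hM hs hσ
      rw [inner_neg_left, neg_lt_zero]
      exact ⟨fun h => h.2, fun h => ⟨(hball x hx).1, h⟩⟩
  · exact hB.false_of_asymmetric hC hν hz₀ heν hb hball hΩ' hE' ha₁ hconst hs

/-- A contact angle `ϑ ∈ (0, π)` is possible only if adhesion does not dominate and, when adhesion is
negligible, only if `ϑ = π / 2`. -/
theorem CriticalSetting.false_of_angle_mem_Ioo
    (hC : CriticalSetting n s₁ s₂ lam σ ϱ K₁ K₂ g Ω E)
    (hP : IsContactPoint Ω E x₀ φ ψ φ' ψ') {hn : 2 ≤ n} (hϑ : IsAngleBetween hn H V ϑ)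
    (hϑI : ϑ ∈ Ioo 0 Real.pi) (hΩH : BlowUpTendsto Ω x₀ H) (hEV : BlowUpTendsto E x₀ (H ∩ V))
    (ha₁ : HasBlowUp s₁ a₁ K₁)
    (hconst : ∃ a : ℝ, ∀ w ∈ Metric.sphere (0 : Eu n) 1, a₁ w = a)
    (hs : (s₁ < s₂ ∧ σ ≠ 0) ∨ (ϑ ≠ Real.pi / 2 ∧ (σ = 0 ∨ s₂ < s₁))) : False := by
  obtain ⟨e, ν, he, hν, heν, hH, hHV⟩ := hϑ.exists_normals hϑI
  rw [hH] at hΩH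
  rw [hHV] at hEV
  have hc₁ : Continuous fun y : Eu n => inner ℝ e y := by fun_prop
  have hc₂ : Continuous fun y : Eu n => inner ℝ ν y := by fun_prop
  have hHo : IsOpen {x : Eu n | 0 < inner ℝ e x} := isOpen_lt continuous_const hc₁
  have hGo : IsOpen {x : Eu n | 0 < inner ℝ e x ∧ inner ℝ ν x < 0} :=
    hHo.inter (isOpen_lt hc₂ continuous_const)
  -- The projection of the inner normal onto the interface plane: it is fixed by the reflection and
  -- lies inside the container, since `⟪e, z₀⟫ = sin² ϑ > 0`.
  set z₀ : Eu n := e - inner ℝ e ν • ν with hz₀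
  have hνz : inner ℝ ν z₀ = 0 := by
    rw [hz₀, inner_sub_right, inner_smul_right, real_inner_self_eq_norm_sq, hν, real_inner_comm]
    ring
  have hez : 0 < inner ℝ e z₀ := by
    rw [hz₀, inner_sub_right, inner_smul_right, real_inner_self_eq_norm_sq, he, heν]
    have := pow_pos (Real.sin_pos_of_pos_of_lt_pi hϑI.1 hϑI.2) 2
    nlinarith [Real.sin_sq_add_cos_sq ϑ]
  have hmz : mirror ν z₀ = z₀ := by rw [mirror_apply hν, hνz]; simp
  have hW : {x : Eu n | 0 < inner ℝ e x ∧ 0 < inner ℝ e (mirror ν x)} ∈ 𝓝 z₀ := by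
    refine (hHo.inter (isOpen_lt continuous_const
      (hc₁.comp (mirror ν).continuous))).mem_nhds ⟨hez, ?_⟩
    change 0 < inner ℝ e (mirror ν z₀)
    rwa [hmz]
  obtain ⟨c, r, ρ, C, hB, hball⟩ := hP.exists_isBlowUp_fixed hHo hGo.measurableSet hΩH hEV hW
    fun x hx => hx.1
  have hν' : ‖-ν‖ = 1 := by rwa [norm_neg]
  -- Replacing `ν` by `-ν` makes `⟪e, ν⟫ = cos ϑ` nonnegative; it vanishes only for `ϑ = π / 2`.
  rcases lt_or_ge (inner ℝ e ν) 0 with hlt | hge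
  · refine hB.false_of_wedge (ν := -ν) (b := 0) hC he hν' (by rw [inner_neg_left, hνz, neg_zero])
      le_rfl (fun x hx => by rw [neg_zero, mirror_neg hν]; exact hball hx) (by simp) (.inr ?_) ha₁
      hconst (hs.imp_right fun h => ⟨by rw [inner_neg_right]; linarith, h.2⟩)
    simp [inner_neg_left]
  · refine hB.false_of_wedge (b := 0) hC he hν hνz le_rfl
      (fun x hx => by rw [neg_zero]; exact hball hx) (by simp) (.inl (by simp)) ha₁ hconst
      (hs.imp_right fun h => ⟨hge.lt_of_ne' fun h0 => h.1 ?_, h.2⟩)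
    rw [heν, ← Real.cos_pi_div_two] at h0
    exact Real.injOn_cos ⟨hϑI.1.le, hϑI.2.le⟩ ⟨by positivity, by linarith [Real.pi_pos]⟩ h0

/-- Angle `0` corresponds to vanishing density of `E`, angle `π` to vanishing density of `Ω \ E`. -/
lemma tendsto_volume_zoom_of_blowUp {G : Set (Eu n)} (hΩ : BlowUpTendsto Ω x₀ H)
    (hE : BlowUpTendsto E x₀ G) (hG : G = ∅ ∨ G = H) :
    (∀ C : Set (Eu n), IsCompact C →
        Tendsto (fun r : ℝ => volume (zoom E x₀ r ∩ C)) (𝓝[>] 0) (𝓝 0)) ∨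
      ∀ C : Set (Eu n), IsCompact C →
        Tendsto (fun r : ℝ => volume (zoom (Ω \ E) x₀ r ∩ C)) (𝓝[>] 0) (𝓝 0) := by
  rcases hG with rfl | rfl
  · refine .inl fun C hC => (hE C hC).congr' ?_
    filter_upwards [self_mem_nhdsWithin] with r hr
    rw [rescale_eq_zoom _ _ (ne_of_gt hr), ← Set.bot_eq_empty, symmDiff_bot]
  · refine .inr fun C hC => ?_
    have h1 := (hΩ C hC).add (hE C hC)
    rw [add_zero] at h1
    refine tendsto_of_tendsto_of_tendsto_of_le_of_le' tendsto_const_nhds h1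
      (.of_forall fun _ => zero_le) ?_
    filter_upwards [self_mem_nhdsWithin] with r hr
    rw [rescale_eq_zoom _ _ (ne_of_gt hr), rescale_eq_zoom _ _ (ne_of_gt hr)]
    refine (measure_mono ?_).trans (measure_union_le _ _)
    rintro y ⟨⟨hyΩ, hyE⟩, hyC⟩
    by_cases hy : y ∈ G
    · exact .inr ⟨.inr ⟨hy, hyE⟩, hyC⟩
    · exact .inl ⟨.inl ⟨hyΩ, hy⟩, hyC⟩

/-- The contact angles `0` and `π` are possible only if adhesion is neither dominant nor
negligible. -/
theorem CriticalSetting.false_of_angle_eq_zero_or_pi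
    (hC : CriticalSetting n s₁ s₂ lam σ ϱ K₁ K₂ g Ω E)
    (hP : IsContactPoint Ω E x₀ φ ψ φ' ψ') (hEn : IsNormalized Ω E) {hn : 2 ≤ n}
    (hϑ : IsAngleBetween hn H V ϑ) (hϑ0 : ϑ = 0 ∨ ϑ = Real.pi) (hΩH : BlowUpTendsto Ω x₀ H)
    (hEV : BlowUpTendsto E x₀ (H ∩ V)) (ha₁ : HasBlowUp s₁ a₁ K₁)
    (hconst : ∃ a : ℝ, ∀ w ∈ Metric.sphere (0 : Eu n) 1, a₁ w = a)
    (hs : (s₁ < s₂ ∧ σ ≠ 0) ∨ (σ = 0 ∨ s₂ < s₁)) : False := by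
  have hG : H ∩ V = ∅ ∨ H ∩ V = H := by
    obtain ⟨-, Q, hH, hHV⟩ := hϑ
    rcases hϑ0 with rfl | rfl
    · refine .inl (hHV.trans ?_)
      rw [image_eq_empty]
      exact eq_empty_of_forall_notMem fun x ⟨β, hβ, _⟩ => by simp at hβ
    · exact .inr (hHV.trans hH.symm)
  obtain ⟨e, c, r, C, he, hB⟩ := hP.exists_isBlowUp_degenerate hC.hΩo hC.hE.subset hEn
    (tendsto_volume_zoom_of_blowUp hΩH hEV hG)
  have hee : inner ℝ e e = 1 := by rw [real_inner_self_eq_norm_sq, he, one_pow]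
  have hball : ∀ x ∈ Metric.ball (0 : Eu n) (2 * (1 / 4)),
      -1 < inner ℝ e x ∧ -1 < inner ℝ e (mirror e x) := fun x hx => by
    have h1 := abs_le.1 (abs_real_inner_le_norm e x)
    rw [he, one_mul] at h1
    have h2 := mem_ball_zero_iff.1 hx
    rw [inner_mirror_self he]
    constructor <;> linarith [h1.1, h1.2]
  -- The interface is parallel to the wall, so `ν = e` and `⟪e, ν⟫ = 1`: asymmetry is automatic.
  have hs' := hs.imp_right fun h => (⟨by rw [hee]; exact one_pos, h⟩ :
    0 < inner ℝ e e ∧ (σ = 0 ∨ s₂ < s₁))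
  rcases hB with hB | hB
  · exact hB.false_of_wedge hC he he (inner_zero_right _) zero_le_one hball rfl (.inl rfl) ha₁ hconst
      hs'
  · exact hB.false_of_wedge hC he he (inner_zero_right _) zero_le_one hball rfl (.inr rfl) ha₁ hconst
      hs'

end

end NonlocalCapillarity

theorem corollary1p5 (n : ℕ) (hn : 2 ≤ n) (s₁ s₂ lam σ : ℝ) (ϱ : ℝ≥0∞)
    (hs₁ : s₁ ∈ Ioo (0 : ℝ) 1) (hs₂ : s₂ ∈ Ioo (0 : ℝ) 1) (hlam : 1 ≤ lam) (hϱ : 0 < ϱ)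
    (K₁ K₂ a₁ a₂ : Eu n → ℝ)
    (hK₁ : IsKernelC 2 s₁ lam ϱ K₁) (hK₂ : IsKernelC 2 s₂ lam ϱ K₂)
    (ha₁ : HasBlowUp s₁ a₁ K₁) (ha₂ : HasBlowUp s₂ a₂ K₂)
    (hconst : ∃ c : ℝ, ∀ w ∈ Metric.sphere (0 : Eu n) 1, a₁ w = c)
    (g : Eu n → ℝ) (hg : ContDiff ℝ 1 g)
    (Ω : Set (Eu n)) (hΩo : IsOpen Ω) (hΩb : Bornology.IsBounded Ω) (hΩ : HasC1Boundary Ω)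
    (E : Set (Eu n)) (hE : IsCritical K₁ K₂ σ g Ω E) (hEn : IsNormalized Ω E)
    (x₀ : Eu n) (hx₀ : x₀ ∈ regularSet s₁ Ω E ∩ frontier Ω)
    (H V : Set (Eu n)) (hH : IsOpenHalfSpace H) (hV : IsOpenHalfSpace V)
    (hΩH : BlowUpTendsto Ω x₀ H) (hEV : BlowUpTendsto E x₀ (H ∩ V))
    (ϑ : ℝ) (hϑ : IsAngleBetween hn H V ϑ) :
    (s₁ < s₂ → σ < 0 → ϑ = 0) ∧
    (s₁ < s₂ → 0 < σ → ϑ = Real.pi) ∧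
    ((s₁ < s₂ ∧ σ = 0) ∨ s₂ < s₁ → ϑ = Real.pi / 2) := by
  have hC : CriticalSetting n s₁ s₂ lam σ ϱ K₁ K₂ g Ω E :=
    ⟨by omega, hs₁, hs₂, by linarith, hϱ, hK₁, hK₂, hg, hΩo, hΩb, hE⟩
  obtain ⟨φ, ψ, φ', ψ', hP⟩ := exists_isContactPoint hΩo hΩ hx₀
  have hopen := fun h => hC.false_of_angle_mem_Ioo hP hϑ h hΩH hEV ha₁ hconst
  have hend := fun h => hC.false_of_angle_eq_zero_or_pi hP hEn hϑ h hΩH hEV ha₁ hconst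
  have hIoo : ϑ ≠ 0 → ϑ ≠ Real.pi → ϑ ∈ Ioo 0 Real.pi := fun h0 hπ =>
    ⟨hϑ.1.1.lt_of_ne' h0, hϑ.1.2.lt_of_ne hπ⟩
  refine ⟨fun hs hσ => ?_, fun hs hσ => ?_, fun hs => ?_⟩
  · by_contra h0
    rcases eq_or_ne ϑ Real.pi with hπ | hπ
    · exact hend (.inr hπ) (.inl ⟨hs, hσ.ne⟩)
    · exact hopen (hIoo h0 hπ) (.inl ⟨hs, hσ.ne⟩)
  · by_contra hπ
    rcases eq_or_ne ϑ 0 with h0 | h0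
    · exact hend (.inl h0) (.inl ⟨hs, hσ.ne'⟩)
    · exact hopen (hIoo h0 hπ) (.inl ⟨hs, hσ.ne'⟩)
  · have hs' : σ = 0 ∨ s₂ < s₁ := hs.imp_left And.right
    by_contra hne
    rcases eq_or_ne ϑ 0 with h0 | h0
    · exact hend (.inl h0) (.inr hs')
    rcases eq_or_ne ϑ Real.pi with hπ | hπ
    · exact hend (.inr hπ) (.inr hs')
    · exact hopen (hIoo h0 hπ) (.inr ⟨hne, hs'⟩)
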